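/- Let $D(p)$ denote the open unit disc centred at $p\in\mathbb{R}^2$. A configuration of $n$ points in the plane is \emph{valid} if the unit discs centred at its points are pairwise disjoint (they may touch). Let $S$ and $T$ be two valid configurations of $n$ points each, and let $M:S\to T$ be a bijection, also regarded as the set of pairs $A=(A^S,A^T)$ with $A^T=M(A^S)$. A translation $\vec v\in\mathbb{R}^2$ is \emph{valid} if the pairs can be ordered so that, when in this order each disc $D(A^S)$ is moved once, along a straight segment, to $D(A^T+\vec v)$, the moving disc never intersects a disc $D(B^S)$ that has not moved yet, nor a disc $D(B^T+\vec v)$ that has already been moved. Let $Q$ be the set of valid translations. The problem SA-LST-V$(S,T,M)$ is to find a valid translation of minimum length $|\vec v|$, or to report that $Q=\emptyset$. For a pair $A$ let $H_{\vec v}(A)$ be the convex hull of $D(A^S)\cup D(A^T+\vec v)$. The two \emph{vippodromes} of an ordered pair $(A,B)$, $A\ne B$, are $$V^{(1)}_{AB}=\{\vec v: D(A^S)\cap H_{\vec v}(B)\neq\emptyset\},\qquad V^{(2)}_{AB}=\{\vec v: D(B^T+\vec v)\cap H_{\vec v}(A)\neq\emptyset\}.$$ The boundary $\gamma$ of a vippodrome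 is a simple curve, unbounded in both directions. Let $D_Q(\gamma)$ be a balanced binary search tree of the maximal arcs of $\gamma\cap Q$, ordered along $\gamma$, each stored by its endpoints (an arc may be unbounded), of height at most $2\log_2(m+1)$, where $m$ is the number of arcs. Let $D_Q$ be the collection of the trees $D_Q(\gamma)$ over all vippodrome boundaries $\gamma$. Running time is the number of unit-cost steps of a real RAM: exact real numbers with $+,-,\times,/,\sqrt{\ }$ and comparison; natural numbers with addition, truncated subtraction and comparison, used as indices and pointers; and indirect addressing. \textbf{Theorem.} (a) There are a single program and a constant $C$ such that, for all $n$, $S$, $T$, $M$ as above, the program, started with $n,S,T,M$ and the precomputed structures $D_Q$ in memory, solves SA-LST-V$(S,T,M)$ in at most $C(n^2\log n+1)$ steps (with $n^2\log n$ read as $0$ for $n=0$). That is, once $Q$ and $D_Q$ have been computed, the problem is solved in $O(n^2\log n)$ time. (b) Every valid translation of minimum length is either the origin or a point of some vippodrome boundary. (c) There is an absolute constant $K$ such that every vippodrome boundary can be split at no more than $K$ points into subarcs along each of which $|\vec v|$ is monotone (not necessarily strictly). -/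

import Mathlib

namespace DiscReconfig

/-! ## Geometry: configurations, itineraries, valid translations -/

/-- The Euclidean plane. -/
abbrev Plane : Type := EuclideanSpace ℝ (Fin 2)

/-- The open unit disc centred at `p`. Discs are open, so that touching discs do not collide. -/
def disc (p : Plane) : Set Plane := Metric.ball p 1

/-- A valid configuration of `n` points: the unit discs centred there are pairwise disjoint
(they may touch). -/
def ValidConfig {n : ℕ} (c : Fin n → Plane) : Prop :=
  ∀ i j, i ≠ j → Disjoint (disc (c i)) (disc (c j))

/-- A labeled instance: two valid configurations of `n` points each and a bijection between them,
given by indices. The elements of the matching are the pairs `(S i, T (M i))`, so they are indexed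
by `Fin n`. -/
structure Instance (n : ℕ) where
  S : Fin n → Plane
  T : Fin n → Plane
  M : Equiv.Perm (Fin n)
  validS : ValidConfig S
  validT : ValidConfig T

namespace Instance

variable {n : ℕ} (I : Instance n)

/-- The start position of the pair `A`. -/
def src (A : Fin n) : Plane := I.S A

/-- The target position of the pair `A` (before the target configuration is translated). -/
def tgt (A : Fin n) : Plane := I.T (I.M A)

/-- The disc of the pair `A`, at time `τ ∈ [0,1]` of its straight motion from its start position to
its target position translated by `v`. -/
def movingDisc (v : Plane) (A : Fin n) (τ : ℝ) : Set Plane :=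
  disc (AffineMap.lineMap (I.src A) (I.tgt A + v) τ)

/-- The order `π` (the pair `π k` moves in step `k`) is a valid itinerary from `S` to `T + v`: in
each step the moving disc collides neither with a disc that has not moved yet nor with a disc that
has already been moved. -/
def IsItinerary (v : Plane) (π : Equiv.Perm (Fin n)) : Prop :=
  ∀ k : Fin n, ∀ τ ∈ Set.Icc (0 : ℝ) 1,
    (∀ j, k < j → Disjoint (I.movingDisc v (π k) τ) (disc (I.src (π j)))) ∧
    (∀ j, j < k → Disjoint (I.movingDisc v (π k) τ) (disc (I.tgt (π j) + v)))

/-- The region `Q` of all valid translations: those that admit a valid itinerary. -/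
def Q : Set Plane := {v | ∃ π, I.IsItinerary v π}

/-- `v` is an optimal solution: a valid translation of minimum length. -/
def IsShortest (v : Plane) : Prop := v ∈ I.Q ∧ ∀ w ∈ I.Q, ‖v‖ ≤ ‖w‖

/-! ## Vippodromes and the structures `D_Q` -/

/-- The hippodrome of the pair `A` for the translation `v`. -/
def hippodrome (v : Plane) (A : Fin n) : Set Plane :=
  convexHull ℝ (disc (I.src A) ∪ disc (I.tgt A + v))

/-- The vippodromes of `(A, B)`: of the first type (`k = 0`) and of the second type (`k = 1`). -/
def vippodrome (A B : Fin n) : Fin 2 → Set Plane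
  | 0 => {v | (disc (I.src A) ∩ I.hippodrome v B).Nonempty}
  | 1 => {v | (disc (I.tgt B + v) ∩ I.hippodrome v A).Nonempty}

/-- The boundary curve `γ` of a vippodrome. -/
def curve (A B : Fin n) (k : Fin 2) : Set Plane := frontier (I.vippodrome A B k)

/-- The direction of the symmetry axis of a vippodrome. -/
def axis (A B : Fin n) : Fin 2 → Plane
  | 0 => I.src A - I.src B
  | 1 => I.tgt A - I.tgt B

/-- The position of a point along the boundary curve of a vippodrome. A vippodrome is an open
convex set, symmetric about its axis, that recedes in an open cone of directions around the axis.
So its boundary is the graph of a continuous function over the whole line perpendicular to the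
axis, and the coordinate in that perpendicular direction parametrizes the curve continuously and
bijectively by the real line. -/
def pos (A B : Fin n) (k : Fin 2) (v : Plane) : ℝ :=
  I.axis A B k 0 * v 1 - I.axis A B k 1 * v 0

end Instance

/-- A closed arc of a curve, given by its two endpoints; `none` means that the arc is unbounded on
that side. -/
structure Arc where
  lo : Option Plane
  hi : Option Plane

/-- The points of the arc `a` of the curve `γ`, where `f` is the position along the curve. -/
def Arc.carrier (γ : Set Plane) (f : Plane → ℝ) (a : Arc) : Set Plane :=
  {x ∈ γ | (∀ p ∈ a.lo, f p ≤ f x) ∧ (∀ q ∈ a.hi, f x ≤ f q)}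

/-- `l` lists the maximal arcs of `γ ∩ Q`, in their order along `γ`: their endpoints lie on `γ`,
consecutive arcs are separated by a gap, and their union is `γ ∩ Q`. -/
def IsArcList (γ Q : Set Plane) (f : Plane → ℝ) (l : List Arc) : Prop :=
  (∀ a ∈ l, (∀ p ∈ a.lo, p ∈ γ) ∧ (∀ q ∈ a.hi, q ∈ γ) ∧ ∀ p ∈ a.lo, ∀ q ∈ a.hi, f p ≤ f q) ∧
  l.Pairwise (fun a b => ∃ q ∈ a.hi, ∃ p ∈ b.lo, f q < f p) ∧
  {x | ∃ a ∈ l, x ∈ a.carrier γ f} = γ ∩ Q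

/-- The values of a binary tree in symmetric order. -/
def inorder {α : Type} : BinaryTree α → List α
  | .nil => []
  | .node a l r => inorder l ++ a :: inorder r

/-- The balance condition on search trees: logarithmic height. The constant `2` covers the usual
balanced trees (perfectly balanced, AVL, red-black). -/
def Balanced {α : Type} (t : BinaryTree α) : Prop :=
  (t.height : ℝ) ≤ 2 * Real.logb 2 ((t.numNodes : ℝ) + 1)

/-- `t` is a structure `D_Q(γ)` for the boundary curve `γ` of the vippodrome `(A, B, k)`: a balanced
binary search tree of the arcs of `γ ∩ Q`, ordered along `γ`. -/
def IsDQ {n : ℕ} (I : Instance n) (A B : Fin n) (k : Fin 2) (t : BinaryTree Arc) : Prop :=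
  IsArcList (I.curve A B k) I.Q (I.pos A B k) (inorder t) ∧ Balanced t

/-! ## The machine model: a real RAM with a step count

A machine has scalar variables and arrays for natural numbers (used for indices, pointers and
flags), and scalar variables and arrays for real numbers, which are stored and compared exactly.
The only operations on natural numbers are addition and truncated subtraction; those on reals are
`+`, `-`, `*`, `/` and square root. There is no rounding and no conversion between the two sorts.
Every operation, memory access, comparison and control step costs one unit. A program is a fixed
finite text, the same for all inputs. -/

/-- A memory state. The first argument of an array is its name, the second one the index. -/
structure State where
  natVar : ℕ → ℕ
  realVar : ℕ → ℝ
  natArr : ℕ → ℕ → ℕ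
  realArr : ℕ → ℕ → ℝ

/-- Expressions for natural numbers. -/
inductive NExp where
  | const (c : ℕ)
  | var (x : ℕ)
  | load (a : ℕ) (e : NExp)
  | add (e₁ e₂ : NExp)
  | sub (e₁ e₂ : NExp)

namespace NExp

def eval (σ : State) : NExp → ℕ
  | const c => c
  | var x => σ.natVar x
  | load a e => σ.natArr a (e.eval σ)
  | add e₁ e₂ => e₁.eval σ + e₂.eval σ
  | sub e₁ e₂ => e₁.eval σ - e₂.eval σ

def cost : NExp → ℕ
  | const _ => 1
  | var _ => 1
  | load _ e => e.cost + 1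
  | add e₁ e₂ => e₁.cost + e₂.cost + 1
  | sub e₁ e₂ => e₁.cost + e₂.cost + 1

end NExp

/-- Expressions for real numbers. The only constants are natural numbers. -/
inductive RExp where
  | const (c : ℕ)
  | var (x : ℕ)
  | load (a : ℕ) (e : NExp)
  | add (e₁ e₂ : RExp)
  | sub (e₁ e₂ : RExp)
  | mul (e₁ e₂ : RExp)
  | div (e₁ e₂ : RExp)
  | sqrt (e : RExp)

namespace RExp

noncomputable def eval (σ : State) : RExp → ℝ
  | const c => (c : ℝ)
  | var x => σ.realVar x
  | load a e => σ.realArr a (e.eval σ)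
  | add e₁ e₂ => e₁.eval σ + e₂.eval σ
  | sub e₁ e₂ => e₁.eval σ - e₂.eval σ
  | mul e₁ e₂ => e₁.eval σ * e₂.eval σ
  | div e₁ e₂ => e₁.eval σ / e₂.eval σ
  | sqrt e => Real.sqrt (e.eval σ)

def cost : RExp → ℕ
  | const _ => 1
  | var _ => 1
  | load _ e => e.cost + 1
  | add e₁ e₂ => e₁.cost + e₂.cost + 1
  | sub e₁ e₂ => e₁.cost + e₂.cost + 1
  | mul e₁ e₂ => e₁.cost + e₂.cost + 1
  | div e₁ e₂ => e₁.cost + e₂.cost + 1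
  | sqrt e => e.cost + 1

end RExp

/-- Tests. -/
inductive BExp where
  | natLe (e₁ e₂ : NExp)
  | realLe (e₁ e₂ : RExp)
  | not (b : BExp)
  | and (b₁ b₂ : BExp)

namespace BExp

def eval (σ : State) : BExp → Prop
  | natLe e₁ e₂ => e₁.eval σ ≤ e₂.eval σ
  | realLe e₁ e₂ => e₁.eval σ ≤ e₂.eval σ
  | not b => ¬ b.eval σ
  | and b₁ b₂ => b₁.eval σ ∧ b₂.eval σ

def cost : BExp → ℕ
  | natLe e₁ e₂ => e₁.cost + e₂.cost + 1
  | realLe e₁ e₂ => e₁.cost + e₂.cost + 1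
  | not b => b.cost + 1
  | and b₁ b₂ => b₁.cost + b₂.cost + 1

end BExp

/-- Programs. -/
inductive Program where
  | skip
  | setNat (x : ℕ) (e : NExp)
  | setReal (x : ℕ) (e : RExp)
  | storeNat (a : ℕ) (i e : NExp)
  | storeReal (a : ℕ) (i : NExp) (e : RExp)
  | seq (p q : Program)
  | ite (b : BExp) (p q : Program)
  | loop (b : BExp) (p : Program)

namespace State

def setNat (σ : State) (x v : ℕ) : State :=
  { σ with natVar := Function.update σ.natVar x v }

noncomputable def setReal (σ : State) (x : ℕ) (v : ℝ) : State :=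
  { σ with realVar := Function.update σ.realVar x v }

def storeNat (σ : State) (a i v : ℕ) : State :=
  { σ with natArr := Function.update σ.natArr a (Function.update (σ.natArr a) i v) }

noncomputable def storeReal (σ : State) (a i : ℕ) (v : ℝ) : State :=
  { σ with realArr := Function.update σ.realArr a (Function.update (σ.realArr a) i v) }

end State

/-- `Exec p σ t σ'`: started in the state `σ`, the program `p` halts after exactly `t` steps, in the
state `σ'`. -/
inductive Exec : Program → State → ℕ → State → Prop
  | skip (σ : State) : Exec .skip σ 1 σ
  | setNat (σ : State) (x : ℕ) (e : NExp) :
      Exec (.setNat x e) σ (e.cost + 1) (σ.setNat x (e.eval σ))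
  | setReal (σ : State) (x : ℕ) (e : RExp) :
      Exec (.setReal x e) σ (e.cost + 1) (σ.setReal x (e.eval σ))
  | storeNat (σ : State) (a : ℕ) (i e : NExp) :
      Exec (.storeNat a i e) σ (i.cost + e.cost + 1) (σ.storeNat a (i.eval σ) (e.eval σ))
  | storeReal (σ : State) (a : ℕ) (i : NExp) (e : RExp) :
      Exec (.storeReal a i e) σ (i.cost + e.cost + 1) (σ.storeReal a (i.eval σ) (e.eval σ))
  | seq {p q : Program} {σ σ₁ σ₂ : State} {t₁ t₂ : ℕ} :
      Exec p σ t₁ σ₁ → Exec q σ₁ t₂ σ₂ → Exec (.seq p q) σ (t₁ + t₂) σ₂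
  | iteTrue {b : BExp} {p q : Program} {σ σ₁ : State} {t : ℕ} :
      b.eval σ → Exec p σ t σ₁ → Exec (.ite b p q) σ (b.cost + 1 + t) σ₁
  | iteFalse {b : BExp} {p q : Program} {σ σ₁ : State} {t : ℕ} :
      ¬ b.eval σ → Exec q σ t σ₁ → Exec (.ite b p q) σ (b.cost + 1 + t) σ₁
  | loopDone {b : BExp} {p : Program} {σ : State} :
      ¬ b.eval σ → Exec (.loop b p) σ (b.cost + 1) σ
  | loopStep {b : BExp} {p : Program} {σ σ₁ σ₂ : State} {t₁ t₂ : ℕ} :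
      b.eval σ → Exec p σ t₁ σ₁ → Exec (.loop b p) σ₁ t₂ σ₂ →
      Exec (.loop b p) σ (b.cost + 1 + t₁ + t₂) σ₂

/-- Programs are deterministic: the running time and the final state are unique. -/
theorem Exec.unique {p : Program} {σ σ₁ σ₂ : State} {t₁ t₂ : ℕ}
    (h₁ : Exec p σ t₁ σ₁) (h₂ : Exec p σ t₂ σ₂) : t₁ = t₂ ∧ σ₁ = σ₂ := by
  induction h₁ generalizing t₂ σ₂ with
  | skip | setNat | setReal | storeNat | storeReal => cases h₂; exact ⟨rfl, rfl⟩
  | seq _ _ ih₁ ih₂ =>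
    cases h₂ with
    | seq h h' =>
      obtain ⟨rfl, rfl⟩ := ih₁ h
      obtain ⟨rfl, rfl⟩ := ih₂ h'
      exact ⟨rfl, rfl⟩
  | iteTrue hb _ ih =>
    cases h₂ with
    | iteTrue _ h => obtain ⟨rfl, rfl⟩ := ih h; exact ⟨rfl, rfl⟩
    | iteFalse hb' _ => exact absurd hb hb'
  | iteFalse hb _ ih =>
    cases h₂ with
    | iteTrue hb' _ => exact absurd hb' hb
    | iteFalse _ h => obtain ⟨rfl, rfl⟩ := ih h; exact ⟨rfl, rfl⟩
  | loopDone hb =>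
    cases h₂ with
    | loopDone => exact ⟨rfl, rfl⟩
    | loopStep hb' _ _ => exact absurd hb' hb
  | loopStep hb _ _ ih₁ ih₂ =>
    cases h₂ with
    | loopDone hb' => exact absurd hb hb'
    | loopStep _ h h' =>
      obtain ⟨rfl, rfl⟩ := ih₁ h
      obtain ⟨rfl, rfl⟩ := ih₂ h'
      exact ⟨rfl, rfl⟩

/-! ## Input and output -/

/-- The optional point `p` is stored in cell `c`: natural-number array `flag` holds whether it is
present, real arrays `x` and `y` hold its coordinates if it is. -/
def StoresPoint (σ : State) (flag x y c : ℕ) : Option Plane → Prop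
  | none => σ.natArr flag c = 0
  | some p => σ.natArr flag c = 1 ∧ σ.realArr x c = p 0 ∧ σ.realArr y c = p 1

/-- The pointer `c` is the root of a copy of the tree `t` in memory. The null pointer is `0`. The
children of the node `c` are in natural-number arrays `2` and `3`, its arc is in natural-number
arrays `4` and `5` (flags) and real arrays `4`, `5`, `6` and `7` (endpoints). -/
def StoresTree (σ : State) : BinaryTree Arc → ℕ → Prop
  | .nil, c => c = 0
  | .node a l r, c => c ≠ 0 ∧ StoresPoint σ 4 4 5 c a.lo ∧ StoresPoint σ 5 6 7 c a.hi ∧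
      StoresTree σ l (σ.natArr 2 c) ∧ StoresTree σ r (σ.natArr 3 c)

/-- The memory holds the input `n`, `S`, `T`, `M`, and the structures `D_Q`, that is, a structure
`D_Q(γ)` for the boundary `γ` of every vippodrome. Natural-number array `1` is the table of their
roots. The rest of the memory is arbitrary. -/
def HoldsInput {n : ℕ} (I : Instance n) (σ : State) : Prop :=
  σ.natVar 0 = n ∧
  (∀ i : Fin n,
    σ.realArr 0 i = I.S i 0 ∧ σ.realArr 1 i = I.S i 1 ∧
    σ.realArr 2 i = I.T i 0 ∧ σ.realArr 3 i = I.T i 1 ∧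
    σ.natArr 0 i = I.M i) ∧
  (∀ (A B : Fin n) (k : Fin 2), A ≠ B →
    ∃ t, IsDQ I A B k t ∧ StoresTree σ t (σ.natArr 1 (2 * (n * A + B) + k)))

/-- The memory holds the output: either flag `1` and a shortest valid translation, or flag `0`, if
there is no valid translation. -/
def HoldsOutput {n : ℕ} (I : Instance n) (σ : State) : Prop :=
  (σ.natVar 0 = 1 ∧ I.IsShortest !₂[σ.realVar 0, σ.realVar 1]) ∨
  (σ.natVar 0 = 0 ∧ I.Q = ∅)

end DiscReconfig

/-!
All three parts rest on one computation. Relative to the motion of one pair, both vippodromes of a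
pair `(A, B)` are translates of a *shadow*: the union of all dilations, by factors at least `1`, of
an open disc of radius `2` that does not contain the origin
(`Instance.vippodrome_eq_shadow`). In coordinates along and across its axis a shadow is the strict
epigraph of an explicit function `front`, an arc of a circle continued by its two tangent rays
(`mem_shadow_iff`, `mem_frontier_shadow_iff`).

*The optimum lies on a curve or is the origin.* A translation is valid iff the pairs can be ordered
compatibly with its memberships in the vippodromes (`Instance.mem_Q_iff`). The vippodromes are
open, so away from their boundaries these memberships are locally constant, and a nonzero valid
translation off the curves can be shortened
(`Instance.IsShortest.eq_zero_or_mem_curve`). For the same reason `Q` is closed, and an optimum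
exists as soon as `Q` is nonempty.

*Monotonicity.* The squared distance from a point is a convex quadratic polynomial along a tangent
ray and a linear functional along the circle, hence has at most one local extremum on each of the
three pieces. This gives six positions, `splitPoints`, with explicit formulas, between which the
distance is monotone. In a form more convenient for searching: from every point of the curve one of
these positions can be reached along the curve without increasing the distance
(`exists_splitPoint_descent`).

*The program* first tests the origin by removing, as long as possible, pairs without remaining
predecessors, keeping count of the predecessors; this takes `O(n²)` steps (`runs_removeAll`). Then
it searches each of the `O(n²)` trees for the six split points of its curve, and tries on every node
it visits the point of the stored arc nearest to the split point. Between the split point and any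
valid point of the curve lies one of the points tried (`runs_descend`), so by
`exists_splitPoint_descent` a shortest valid translation is found. The search takes time
proportional to the height of the tree, which is `O(log n)`: the membership of a point moving along
one front in another shadow changes a bounded number of times
(`exists_changesIn_shadow`), and validity changes between consecutive arcs, so that there are
`O(n²)` arcs (`Instance.length_arcList_le`).

Programs are verified through `Runs`, total correctness with a bound for the number of steps. What
a program leaves unchanged is read off from its text (`Exec.frame`).
-/

namespace DiscReconfig
/-! ### The front of the shadow of a disc -/

/-- The front of the shadow, seen from the origin, of the open disc of radius `2` about `(r, 0)`,
as a graph over the second coordinate: the front arc of the circle up to the two points of tangency,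
and beyond them the two tangent rays. -/
noncomputable def front (r y : ℝ) : ℝ :=
  if |y| < 2 * √(r ^ 2 - 4) / r then r - √(4 - y ^ 2) else √(r ^ 2 - 4) * |y| / 2

theorem sq_sqrt_sub_four {r : ℝ} (hr : 2 ≤ r) : √(r ^ 2 - 4) ^ 2 = r ^ 2 - 4 :=
  Real.sq_sqrt (by nlinarith)

theorem abs_lt_two_of_lt_tangent {r y : ℝ} (hr : 2 ≤ r) (hy : |y| < 2 * √(r ^ 2 - 4) / r) :
    |y| < 2 := by
  refine hy.trans_le ?_
  rw [div_le_iff₀ (by linarith)]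
  have h := Real.sqrt_le_sqrt (show r ^ 2 - 4 ≤ r ^ 2 by linarith)
  rw [Real.sqrt_sq (by linarith)] at h
  linarith

/-- The shadow of the disc is the cone spanned by it without the part on the near side of the chord
of contact that lies outside the disc. -/
theorem front_lt_iff {r : ℝ} (hr : 2 ≤ r) (x y : ℝ) :
    front r y < x ↔ √(r ^ 2 - 4) * y < 2 * x ∧ -(√(r ^ 2 - 4) * y) < 2 * x ∧
      ((x - r) ^ 2 + y ^ 2 < 4 ∨ r ^ 2 - 4 < r * x) := by
  have hs := sq_sqrt_sub_four hr
  have hs0 := Real.sqrt_nonneg (r ^ 2 - 4)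
  have habs := abs_lt_two_of_lt_tangent (y := y) hr
  unfold front
  set s := √(r ^ 2 - 4) with hsdef
  have hr0 : 0 < r := by linarith
  have hcone : (s * y < 2 * x ∧ -(s * y) < 2 * x) ↔ s * |y| < 2 * x := by
    rw [← abs_of_nonneg hs0, ← abs_mul, abs_of_nonneg hs0, abs_lt]
    constructor
    · rintro ⟨h1, h2⟩; constructor <;> linarith
    · rintro ⟨h1, h2⟩; constructor <;> linarith
  rw [← and_assoc, hcone]
  have hy0 := abs_nonneg y
  have hyy := sq_abs y
  generalize |y| = z at *
  rw [← hyy]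
  split_ifs with h
  · have hz2 : z < 2 := habs h
    have h' : z * r < 2 * s := (lt_div_iff₀ hr0).1 h
    have hS := Real.sq_sqrt (show 0 ≤ 4 - z ^ 2 by nlinarith)
    have hS0 : 0 < √(4 - z ^ 2) := Real.sqrt_pos.2 (by nlinarith)
    set S := √(4 - z ^ 2)
    -- on the front arc the height above the axis is below that of the point of tangency
    have hSr : 4 < r * S := by
      have : (z * r) ^ 2 < (2 * s) ^ 2 := by
        apply pow_lt_pow_left₀ h' (by positivity) (by norm_num)
      nlinarith [mul_pos hr0 hS0]
    constructor
    · intro hx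
      have hsz : s * z < 2 * (r - S) := by
        -- the disc lies inside its tangent cone
        have e : (2 * (r - S)) ^ 2 - (s * z) ^ 2 = (r * S - 4) ^ 2 := by
          have : z ^ 2 = 4 - S ^ 2 := by linarith
          rw [mul_pow s z, this, hs]; ring
        have hpos : 0 < (r * S - 4) ^ 2 := by
          have : 0 < r * S - 4 := by linarith
          positivity
        have hSle : S ≤ 2 := by nlinarith
        exact lt_of_pow_lt_pow_left₀ 2 (by linarith) (by linarith)
      refine ⟨by linarith, ?_⟩
      by_cases hxr : x < r
      · left; nlinarith
      · right; nlinarith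
    · rintro ⟨h1, h2⟩
      rcases h2 with h2 | h2
      · nlinarith [sq_nonneg (x - r + S)]
      · -- beyond the chord of contact the front arc has been passed
        nlinarith
  · constructor
    · intro hx
      have h' : 2 * s ≤ z * r := (div_le_iff₀ hr0).1 (not_lt.1 h)
      refine ⟨by linarith, Or.inr ?_⟩
      nlinarith
    · rintro ⟨h1, -⟩; linarith

theorem exists_mem_scaled_disc_iff {r : ℝ} (hr : 2 ≤ r) (x y : ℝ) :
    (∃ τ ∈ Set.Icc (0 : ℝ) 1, (τ * x - r) ^ 2 + (τ * y) ^ 2 < 4) ↔ front r y < x := by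
  have hs := sq_sqrt_sub_four hr
  have hs0 := Real.sqrt_nonneg (r ^ 2 - 4)
  have hr0 : 0 < r := by linarith
  rw [front_lt_iff hr]
  set s := √(r ^ 2 - 4) with hsdef
  constructor
  · rintro ⟨τ, ⟨h0, h1⟩, h⟩
    have hτ : 0 < τ := by
      rcases h0.eq_or_lt with rfl | h'
      · nlinarith
      · exact h'
    have hX : 0 < τ * x := by nlinarith
    have hx : 0 < x := pos_of_mul_pos_right hX h0
    have hcone : (s * y) ^ 2 < (2 * x) ^ 2 := by
      have e : 4 * (τ * x) ^ 2 - (r ^ 2 - 4) * (4 - (τ * x - r) ^ 2)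
          = (r * (τ * x) - (r ^ 2 - 4)) ^ 2 := by ring
      have h2 : τ ^ 2 * (s * y) ^ 2 < τ ^ 2 * (2 * x) ^ 2 ∨ s = 0 := by
        rcases hs0.eq_or_lt with h' | h'
        · exact Or.inr h'.symm
        · left
          have : s ^ 2 * (τ * y) ^ 2 < s ^ 2 * (4 - (τ * x - r) ^ 2) := by
            apply mul_lt_mul_of_pos_left _ (by positivity); linarith
          rw [hs] at this
          nlinarith [sq_nonneg (r * (τ * x) - (r ^ 2 - 4))]
      rcases h2 with h2 | h2
      · exact lt_of_mul_lt_mul_left h2 (by positivity)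
      · rw [h2]; nlinarith
    obtain ⟨c1, c2⟩ := abs_lt_of_sq_lt_sq' hcone (by linarith)
    refine ⟨c2, by linarith, ?_⟩
    by_contra! hcon
    obtain ⟨k1, k2⟩ := hcon
    -- outside the disc and before the chord of contact, moving towards the origin leads away
    have hth : x ^ 2 + y ^ 2 ≤ r * x := by
      have hrx : 0 < r * x := mul_pos hr0 hx
      rw [mul_pow, mul_pow, hs] at hcone
      refine le_of_mul_le_mul_left ?_ (hrx.trans_le k2)
      nlinarith [mul_le_mul_of_nonneg_left k2 hrx.le]
    have e : (τ * x - r) ^ 2 + (τ * y) ^ 2 - ((x - r) ^ 2 + y ^ 2)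
        = (1 - τ) * (2 * (r * x) - (1 + τ) * (x ^ 2 + y ^ 2)) := by ring
    have : 0 ≤ (1 - τ) * (2 * (r * x) - (1 + τ) * (x ^ 2 + y ^ 2)) := by
      apply mul_nonneg (by linarith)
      nlinarith [sq_nonneg x, sq_nonneg y]
    linarith
  · rintro ⟨c1, c2, h⟩
    have hx : 0 < x := by linarith
    rcases h with h | h
    · exact ⟨1, by norm_num, by simpa using h⟩
    have hN : 0 < x ^ 2 + y ^ 2 := by positivity
    by_cases hth : r * x ≤ x ^ 2 + y ^ 2
    · -- the foot of the perpendicular from the centre of the disc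
      refine ⟨r * x / (x ^ 2 + y ^ 2), ⟨by positivity, (div_le_one hN).2 hth⟩, ?_⟩
      have e : (r * x / (x ^ 2 + y ^ 2) * x - r) ^ 2 + (r * x / (x ^ 2 + y ^ 2) * y) ^ 2
          = r ^ 2 * y ^ 2 / (x ^ 2 + y ^ 2) := by
        field_simp
        ring
      rw [e, div_lt_iff₀ hN]
      have : (s * y) ^ 2 < (2 * x) ^ 2 := by
        apply sq_lt_sq'
        · linarith
        · exact c1
      rw [mul_pow, hs] at this
      nlinarith
    · exact ⟨1, by norm_num, by nlinarith⟩

theorem continuous_front {r : ℝ} (hr : 2 ≤ r) : Continuous (front r) := by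
  have hr0 : 0 < r := by linarith
  have hs := sq_sqrt_sub_four hr
  have hs0 := Real.sqrt_nonneg (r ^ 2 - 4)
  have : front r = fun y => if 2 * √(r ^ 2 - 4) / r ≤ |y| then √(r ^ 2 - 4) * |y| / 2
      else r - √(4 - y ^ 2) := by
    funext y
    unfold front
    by_cases h : |y| < 2 * √(r ^ 2 - 4) / r
    · rw [if_pos h, if_neg (not_le.2 h)]
    · rw [if_neg h, if_pos (not_lt.1 h)]
  rw [this]
  refine Continuous.if_le (by fun_prop) (by fun_prop) (by fun_prop) (by fun_prop) ?_
  intro y hy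
  have h4 : 4 - y ^ 2 = (4 / r) ^ 2 := by
    rw [← sq_abs y, ← hy, div_pow, mul_pow, hs]
    field_simp
    ring
  rw [h4, Real.sqrt_sq (by positivity), ← hy]
  field_simp
  rw [hs]

/-! ### The distance from a point along the front -/

theorem front_of_abs_le {r y : ℝ} (hr : 2 ≤ r) (hy : |y| ≤ 2 * √(r ^ 2 - 4) / r) :
    front r y = r - √(4 - y ^ 2) := by
  rcases hy.lt_or_eq with h | h
  · exact if_pos h
  · have hs := sq_sqrt_sub_four hr
    have h4 : 4 - y ^ 2 = (4 / r) ^ 2 := by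
      rw [← sq_abs y, h, div_pow, mul_pow, hs]
      field_simp
      ring
    rw [front, if_neg h.not_lt, h4, Real.sqrt_sq (by positivity), h]
    field_simp
    rw [hs]

theorem front_of_le_abs {r y : ℝ} (hy : 2 * √(r ^ 2 - 4) / r ≤ |y|) :
    front r y = √(r ^ 2 - 4) * |y| / 2 := if_neg (not_lt.2 hy)

theorem tangent_le_two {r : ℝ} (hr : 2 ≤ r) : 2 * √(r ^ 2 - 4) / r ≤ 2 := by
  by_contra! h
  have := abs_lt_two_of_lt_tangent (y := 2) hr (by simpa using h)
  simp at this

theorem concaveOn_sqrt_four_sub_sq :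
    ConcaveOn ℝ (Set.Icc (-2) 2) fun y : ℝ => √(4 - y ^ 2) := by
  refine ⟨convex_Icc _ _, ?_⟩
  rintro x ⟨hx1, hx2⟩ y ⟨hy1, hy2⟩ a b ha hb hab
  have hS := Real.sq_sqrt (show 0 ≤ 4 - x ^ 2 by nlinarith)
  have hT := Real.sq_sqrt (show 0 ≤ 4 - y ^ 2 by nlinarith)
  simp only [smul_eq_mul]
  apply Real.le_sqrt_of_sq_le
  have h4 : √(4 - x ^ 2) * √(4 - y ^ 2) + x * y ≤ 4 := by
    nlinarith [sq_nonneg (√(4 - x ^ 2) - √(4 - y ^ 2)), sq_nonneg (x - y)]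
  have hab2 : 0 ≤ a * b := mul_nonneg ha hb
  have e : (a * √(4 - x ^ 2) + b * √(4 - y ^ 2)) ^ 2 + (a * x + b * y) ^ 2
      = 4 * (a + b) ^ 2 - 2 * (a * b) * (4 - (√(4 - x ^ 2) * √(4 - y ^ 2) + x * y)) := by
    linear_combination a ^ 2 * hS + b ^ 2 * hT
  rw [hab] at e
  nlinarith

theorem concaveOn_arc {p : ℝ} (hp : 0 ≤ p) (q c : ℝ) :
    ConcaveOn ℝ (Set.Icc (-2) 2) fun y : ℝ => p * √(4 - y ^ 2) + q * y + c := by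
  refine ⟨convex_Icc _ _, ?_⟩
  intro x hx y hy a b ha hb hab
  have h := concaveOn_sqrt_four_sub_sq.2 hx hy ha hb hab
  simp only [smul_eq_mul] at h ⊢
  have := mul_le_mul_of_nonneg_left h hp
  have hb' : b = 1 - a := by linarith
  subst hb'
  linarith

theorem monotoneOn_and_antitoneOn_of_max {s : Set ℝ} {h : ℝ → ℝ} (hh : ConcaveOn ℝ s h) {m : ℝ}
    (hm : m ∈ s) (hmax : ∀ y ∈ s, h y ≤ h m) :
    MonotoneOn h (s ∩ Set.Iic m) ∧ AntitoneOn h (s ∩ Set.Ici m) := by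
  constructor
  · rintro x ⟨hx, -⟩ y ⟨-, hym⟩ hxy
    have := hh.min_le_of_mem_Icc hx hm ⟨hxy, hym⟩
    rwa [min_eq_left (hmax x hx)] at this
  · rintro x ⟨-, hxm⟩ y ⟨hy, -⟩ hxy
    have := hh.min_le_of_mem_Icc hm hy ⟨hxm, hxy⟩
    rwa [min_eq_right (hmax y hy)] at this

/-- The extremal direction of a linear functional on the half-circle: by Cauchy–Schwarz it is the
direction of the functional itself. -/
theorem arc_le_max {p q : ℝ} (hp : 0 ≤ p) :
    2 * q / √(p ^ 2 + q ^ 2) ∈ Set.Icc (-2 : ℝ) 2 ∧ ∀ y ∈ Set.Icc (-2 : ℝ) 2,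
      p * √(4 - y ^ 2) + q * y ≤ p * √(4 - (2 * q / √(p ^ 2 + q ^ 2)) ^ 2)
        + q * (2 * q / √(p ^ 2 + q ^ 2)) := by
  have hρ2 := Real.sq_sqrt (show 0 ≤ p ^ 2 + q ^ 2 by positivity)
  rcases (Real.sqrt_nonneg (p ^ 2 + q ^ 2)).eq_or_lt with h | h
  · have hp0 : p = 0 := by nlinarith
    have hq0 : q = 0 := by nlinarith
    subst hp0 hq0
    simp
  · set ρ := √(p ^ 2 + q ^ 2)
    have e : 4 - (2 * q / ρ) ^ 2 = (2 * p / ρ) ^ 2 := by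
      field_simp
      linarith
    refine ⟨abs_le.1 (abs_le_of_sq_le_sq (by linarith [sq_nonneg (2 * p / ρ)]) (by norm_num)), ?_⟩
    rintro y ⟨hy1, hy2⟩
    rw [e, Real.sqrt_sq (by positivity)]
    have hval : p * (2 * p / ρ) + q * (2 * q / ρ) = 2 * ρ := by
      field_simp
      linarith
    rw [hval]
    have hS := Real.sq_sqrt (show 0 ≤ 4 - y ^ 2 by nlinarith)
    apply le_of_sq_le_sq _ (by positivity)
    nlinarith [sq_nonneg (p * y - q * √(4 - y ^ 2))]

/-- The squared distance of the point `(p, q)` from the point of the front in position `y`. -/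
noncomputable def frontDist (r p q y : ℝ) : ℝ := (front r y - p) ^ 2 + (y - q) ^ 2

/-- Positions on the front between which the distance from `(p, q)` is monotone: the points of
tangency, the feet of the perpendiculars to the tangent lines, and the points where the line from
`(p, q)` to the centre meets the circle. -/
noncomputable def splitPoints (r p q : ℝ) : Finset ℝ :=
  {2 * √(r ^ 2 - 4) / r, -(2 * √(r ^ 2 - 4) / r),
    (2 * √(r ^ 2 - 4) * p + 4 * q) / r ^ 2, (4 * q - 2 * √(r ^ 2 - 4) * p) / r ^ 2,
    2 * q / √((r - p) ^ 2 + q ^ 2), -(2 * q / √((r - p) ^ 2 + q ^ 2))}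

theorem frontDist_right {r y : ℝ} (hr : 2 ≤ r) (p q : ℝ) (hy : 2 * √(r ^ 2 - 4) / r ≤ y) :
    frontDist r p q y = r ^ 2 / 4 * (y - (2 * √(r ^ 2 - 4) * p + 4 * q) / r ^ 2) ^ 2 +
      (p ^ 2 + q ^ 2 - (2 * √(r ^ 2 - 4) * p + 4 * q) ^ 2 / (4 * r ^ 2)) := by
  have hr0 : 0 < r := by linarith
  have hs := sq_sqrt_sub_four hr
  have hy0 : 0 ≤ y := le_trans (by positivity) hy
  rw [frontDist, front_of_le_abs (by rwa [abs_of_nonneg hy0]), abs_of_nonneg hy0]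
  field_simp
  linear_combination 4 * r ^ 2 * y ^ 2 * hs

theorem front_neg (r y : ℝ) : front r (-y) = front r y := by simp [front]

theorem frontDist_neg (r p q y : ℝ) : frontDist r p (-q) (-y) = frontDist r p q y := by
  rw [frontDist, frontDist, front_neg]; ring

theorem frontDist_left {r y : ℝ} (hr : 2 ≤ r) (p q : ℝ) (hy : y ≤ -(2 * √(r ^ 2 - 4) / r)) :
    frontDist r p q y = r ^ 2 / 4 * (y - (4 * q - 2 * √(r ^ 2 - 4) * p) / r ^ 2) ^ 2 +
      (p ^ 2 + q ^ 2 - (4 * q - 2 * √(r ^ 2 - 4) * p) ^ 2 / (4 * r ^ 2)) := by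
  rw [← frontDist_neg, frontDist_right hr p (-q) (le_neg.1 hy)]
  ring

theorem frontDist_arc {r y : ℝ} (hr : 2 ≤ r) (p q : ℝ) (hy : |y| ≤ 2 * √(r ^ 2 - 4) / r) :
    frontDist r p q y =
      4 + (r - p) ^ 2 + q ^ 2 - 2 * ((r - p) * √(4 - y ^ 2) + q * y) := by
  have h2 := abs_le.1 (hy.trans (tangent_le_two hr))
  have hS := Real.sq_sqrt (show 0 ≤ 4 - y ^ 2 by nlinarith)
  rw [frontDist, front_of_abs_le hr hy]
  linear_combination hS

/-- Along the arc, the distance has a single extremum. -/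
theorem frontDist_arc_unimodal {r : ℝ} (hr : 2 ≤ r) (p q : ℝ) :
    ∃ m ∈ splitPoints r p q,
      let s := Set.Icc (-(2 * √(r ^ 2 - 4) / r)) (2 * √(r ^ 2 - 4) / r)
      (AntitoneOn (frontDist r p q) (s ∩ Set.Iic m) ∧
        MonotoneOn (frontDist r p q) (s ∩ Set.Ici m)) ∨
      (MonotoneOn (frontDist r p q) (s ∩ Set.Iic m) ∧
        AntitoneOn (frontDist r p q) (s ∩ Set.Ici m)) := by
  have key : ∀ {p' : ℝ} (q' : ℝ), 0 ≤ p' →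
      MonotoneOn (fun y => p' * √(4 - y ^ 2) + q' * y)
        (Set.Icc (-2 : ℝ) 2 ∩ Set.Iic (2 * q' / √(p' ^ 2 + q' ^ 2))) ∧
      AntitoneOn (fun y => p' * √(4 - y ^ 2) + q' * y)
        (Set.Icc (-2 : ℝ) 2 ∩ Set.Ici (2 * q' / √(p' ^ 2 + q' ^ 2))) := by
    intro p' q' hp'
    obtain ⟨h1, h2⟩ := arc_le_max (q := q') hp'
    exact monotoneOn_and_antitoneOn_of_max (by simpa using concaveOn_arc hp' q' 0) h1 h2
  have hst : ∀ y ∈ Set.Icc (-(2 * √(r ^ 2 - 4) / r)) (2 * √(r ^ 2 - 4) / r),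
      y ∈ Set.Icc (-2 : ℝ) 2 :=
    fun y hy => ⟨by linarith [hy.1, tangent_le_two hr], hy.2.trans (tangent_le_two hr)⟩
  rcases le_total 0 (r - p) with hp | hp
  · obtain ⟨k1, k2⟩ := key q hp
    refine ⟨2 * q / √((r - p) ^ 2 + q ^ 2), by simp [splitPoints], Or.inl ⟨?_, ?_⟩⟩
    · rintro x ⟨hx, hxm⟩ y ⟨hy, hym⟩ hxy
      rw [frontDist_arc hr p q (abs_le.2 hx), frontDist_arc hr p q (abs_le.2 hy)]
      linarith [k1 ⟨hst x hx, hxm⟩ ⟨hst y hy, hym⟩ hxy]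
    · rintro x ⟨hx, hxm⟩ y ⟨hy, hym⟩ hxy
      rw [frontDist_arc hr p q (abs_le.2 hx), frontDist_arc hr p q (abs_le.2 hy)]
      linarith [k2 ⟨hst x hx, hxm⟩ ⟨hst y hy, hym⟩ hxy]
  · obtain ⟨k1, k2⟩ := key (-q) (neg_nonneg.2 hp)
    have e : 2 * -q / √((-(r - p)) ^ 2 + (-q) ^ 2) = -(2 * q / √((r - p) ^ 2 + q ^ 2)) := by
      rw [neg_sq, neg_sq]; ring
    rw [e] at k1 k2
    refine ⟨-(2 * q / √((r - p) ^ 2 + q ^ 2)), by simp [splitPoints], Or.inr ⟨?_, ?_⟩⟩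
    · rintro x ⟨hx, hxm⟩ y ⟨hy, hym⟩ hxy
      rw [frontDist_arc hr p q (abs_le.2 hx), frontDist_arc hr p q (abs_le.2 hy)]
      have := k1 ⟨hst x hx, hxm⟩ ⟨hst y hy, hym⟩ hxy
      simp only at this
      linarith
    · rintro x ⟨hx, hxm⟩ y ⟨hy, hym⟩ hxy
      rw [frontDist_arc hr p q (abs_le.2 hx), frontDist_arc hr p q (abs_le.2 hy)]
      have := k2 ⟨hst x hx, hxm⟩ ⟨hst y hy, hym⟩ hxy
      simp only at this
      linarith

/-- Along a tangent ray, the distance decreases up to the foot of the perpendicular and increases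
from there on. -/
theorem frontDist_ray_unimodal {r : ℝ} (hr : 2 ≤ r) (p q : ℝ) {s : Set ℝ}
    (hs : s = Set.Ici (2 * √(r ^ 2 - 4) / r) ∨ s = Set.Iic (-(2 * √(r ^ 2 - 4) / r))) :
    ∃ m ∈ splitPoints r p q, AntitoneOn (frontDist r p q) (s ∩ Set.Iic m) ∧
        MonotoneOn (frontDist r p q) (s ∩ Set.Ici m) := by
  obtain ⟨m, hm, c, hc⟩ : ∃ m ∈ splitPoints r p q, ∃ c, ∀ y ∈ s,
      frontDist r p q y = r ^ 2 / 4 * (y - m) ^ 2 + c := by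
    rcases hs with rfl | rfl
    · exact ⟨_, by simp [splitPoints], _, fun y hy => frontDist_right hr p q hy⟩
    · exact ⟨_, by simp [splitPoints], _, fun y hy => frontDist_left hr p q hy⟩
  have hr2 : 0 ≤ r ^ 2 / 4 := by positivity
  refine ⟨m, hm, ?_, ?_⟩
  · rintro x ⟨hx, hxm⟩ y ⟨hy, hym⟩ hxy
    rw [hc x hx, hc y hy]
    have : (y - m) ^ 2 ≤ (x - m) ^ 2 := by
      nlinarith [Set.mem_Iic.1 hxm, Set.mem_Iic.1 hym]
    nlinarith
  · rintro x ⟨hx, hxm⟩ y ⟨hy, hym⟩ hxy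
    rw [hc x hx, hc y hy]
    have : (x - m) ^ 2 ≤ (y - m) ^ 2 := by
      nlinarith [Set.mem_Ici.1 hxm, Set.mem_Ici.1 hym]
    nlinarith

theorem frontDist_monotoneOn_or_antitoneOn {r : ℝ} (hr : 2 ≤ r) (p q : ℝ) {J : Set ℝ}
    (hJ : J.OrdConnected) (hd : Disjoint J (splitPoints r p q : Set ℝ)) :
    MonotoneOn (frontDist r p q) J ∨ AntitoneOn (frontDist r p q) J := by
  have side : ∀ m ∈ splitPoints r p q, J ⊆ Set.Iic m ∨ J ⊆ Set.Ici m := by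
    intro m hm
    by_contra! h
    obtain ⟨h1, h2⟩ := h
    obtain ⟨x, hx, hxm⟩ := Set.not_subset.1 h1
    obtain ⟨y, hy, hym⟩ := Set.not_subset.1 h2
    have hmJ : m ∈ J := hJ.out hy hx ⟨(not_le.1 hym).le, (not_le.1 hxm).le⟩
    exact Set.disjoint_left.1 hd hmJ hm
  have glue : ∀ (s : Set ℝ) (m : ℝ), J ⊆ s → m ∈ splitPoints r p q →
      (AntitoneOn (frontDist r p q) (s ∩ Set.Iic m) ∧
        MonotoneOn (frontDist r p q) (s ∩ Set.Ici m)) ∨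
      (MonotoneOn (frontDist r p q) (s ∩ Set.Iic m) ∧
        AntitoneOn (frontDist r p q) (s ∩ Set.Ici m)) →
      MonotoneOn (frontDist r p q) J ∨ AntitoneOn (frontDist r p q) J := by
    intro s m hs hm h
    rcases side m hm with hJm | hJm <;> rcases h with ⟨h1, h2⟩ | ⟨h1, h2⟩
    · exact Or.inr (h1.mono (Set.subset_inter hs hJm))
    · exact Or.inl (h1.mono (Set.subset_inter hs hJm))
    · exact Or.inl (h2.mono (Set.subset_inter hs hJm))
    · exact Or.inr (h2.mono (Set.subset_inter hs hJm))
  rcases side (2 * √(r ^ 2 - 4) / r) (by simp [splitPoints]) with h1 | h1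
  · rcases side (-(2 * √(r ^ 2 - 4) / r)) (by simp [splitPoints]) with h2 | h2
    · obtain ⟨m, hm, h⟩ := frontDist_ray_unimodal hr p q (Or.inr rfl)
      exact glue _ m h2 hm (Or.inl h)
    · obtain ⟨m, hm, h⟩ := frontDist_arc_unimodal hr p q
      exact glue (Set.Icc _ _) m (fun x hx => ⟨h2 hx, h1 hx⟩) hm h
  · obtain ⟨m, hm, h⟩ := frontDist_ray_unimodal hr p q (Or.inl rfl)
    exact glue _ m h1 hm (Or.inl h)

/-- From every position on the front, some split point can be reached without increasing the
distance. -/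
theorem exists_splitPoint_descent {r : ℝ} (hr : 2 ≤ r) (p q y : ℝ) :
    ∃ z ∈ splitPoints r p q, ∀ w ∈ Set.uIcc z y, frontDist r p q w ≤ frontDist r p q y := by
  have ht : 2 * √(r ^ 2 - 4) / r ∈ splitPoints r p q := by simp [splitPoints]
  have ht' : -(2 * √(r ^ 2 - 4) / r) ∈ splitPoints r p q := by simp [splitPoints]
  set t := 2 * √(r ^ 2 - 4) / r with htdef
  have ht0 : 0 ≤ t := by positivity
  rcases le_total t y with h1 | h1
  · obtain ⟨m, hm, k1, k2⟩ := frontDist_ray_unimodal hr p q (Or.inl rfl)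
    rw [← htdef] at k1 k2
    rcases le_total m y with h2 | h2
    · refine ⟨max t m, by rcases max_choice t m with h | h <;> rwa [h], ?_⟩
      rw [Set.uIcc_of_le (max_le h1 h2)]
      rintro w ⟨hw, hwy⟩
      obtain ⟨hw1, hw2⟩ := max_le_iff.1 hw
      exact k2 ⟨hw1, hw2⟩ ⟨h1, h2⟩ hwy
    · refine ⟨m, hm, ?_⟩
      rw [Set.uIcc_of_ge h2]
      rintro w ⟨hw, hwy⟩
      exact k1 ⟨h1, h2⟩ ⟨h1.trans hw, hwy⟩ hw
  rcases le_total y (-t) with h3 | h3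
  · obtain ⟨m, hm, k1, k2⟩ := frontDist_ray_unimodal hr p q (Or.inr rfl)
    rw [← htdef] at k1 k2
    rcases le_total m y with h2 | h2
    · refine ⟨m, hm, ?_⟩
      rw [Set.uIcc_of_le h2]
      rintro w ⟨hw, hwy⟩
      exact k2 ⟨hwy.trans h3, hw⟩ ⟨h3, h2⟩ hwy
    · refine ⟨min (-t) m, by rcases min_choice (-t) m with h | h <;> rwa [h], ?_⟩
      rw [Set.uIcc_of_ge (le_min h3 h2)]
      rintro w ⟨hw, hwy⟩
      obtain ⟨hw1, hw2⟩ := le_min_iff.1 hwy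
      exact k1 ⟨h3, h2⟩ ⟨hw1, hw2⟩ hw
  · obtain ⟨m, hm, h⟩ := frontDist_arc_unimodal hr p q
    simp only [← htdef] at h
    rcases h with ⟨k1, k2⟩ | ⟨k1, k2⟩
    · rcases le_total m y with h2 | h2
      · refine ⟨max (-t) m, by rcases max_choice (-t) m with h | h <;> rwa [h], ?_⟩
        rw [Set.uIcc_of_le (max_le h3 h2)]
        rintro w ⟨hw, hwy⟩
        obtain ⟨hw1, hw2⟩ := max_le_iff.1 hw
        exact k2 ⟨⟨hw1, hwy.trans h1⟩, hw2⟩ ⟨⟨h3, h1⟩, h2⟩ hwy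
      · refine ⟨min t m, by rcases min_choice t m with h | h <;> rwa [h], ?_⟩
        rw [Set.uIcc_of_ge (le_min h1 h2)]
        rintro w ⟨hw, hwy⟩
        obtain ⟨hw1, hw2⟩ := le_min_iff.1 hwy
        exact k1 ⟨⟨h3, h1⟩, h2⟩ ⟨⟨h3.trans hw, hw1⟩, hw2⟩ hw
    · rcases le_total m y with h2 | h2
      · refine ⟨t, ht, ?_⟩
        rw [Set.uIcc_of_ge h1]
        rintro w ⟨hw, hwy⟩
        exact k2 ⟨⟨h3, h1⟩, h2⟩ ⟨⟨h3.trans hw, hwy⟩, h2.trans hw⟩ hw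
      · refine ⟨-t, ht', ?_⟩
        rw [Set.uIcc_of_le h3]
        rintro w ⟨hw, hwy⟩
        exact k1 ⟨⟨hw, hwy.trans h1⟩, hwy.trans h2⟩ ⟨⟨h3, h1⟩, h2⟩ hwy

/-! ### Predicates on the line with few changes -/

/-- The truth value of `P` can change only at the points of `F`. -/
def ChangesIn (P : ℝ → Prop) (F : Finset ℝ) : Prop :=
  ∀ x y, x ≤ y → (∀ z ∈ F, z ∉ Set.Icc x y) → (P x ↔ P y)

theorem ChangesIn.congr {P P' : ℝ → Prop} {F : Finset ℝ} (h : ChangesIn P F)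
    (hP : ∀ y, P' y ↔ P y) : ChangesIn P' F := fun x y hxy hF => by
  rw [hP, hP]; exact h x y hxy hF

/-- Where a function is convex or concave, its sign changes at most twice. -/
theorem exists_sign_changes {s : Set ℝ} {h : ℝ → ℝ} (hh : ConvexOn ℝ s h ∨ ConcaveOn ℝ s h) :
    ∃ a b : ℝ, ∀ x ∈ s, ∀ y ∈ s, x ≤ y → a ∉ Set.Icc x y → b ∉ Set.Icc x y →
      (0 < h x ↔ 0 < h y) := by
  have key : ∀ X : Set ℝ, X.OrdConnected → ∀ x y, x ≤ y → sInf X ∉ Set.Icc x y →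
      sSup X ∉ Set.Icc x y → (x ∈ X ↔ y ∈ X) := by
    intro X hX x y hxy hi hs
    constructor
    · intro hx
      by_contra hy
      have hb : ∀ z ∈ X, z ≤ y := fun z hz => by
        by_contra! h'
        exact hy (hX.out hx hz ⟨hxy, h'.le⟩)
      exact hs ⟨le_csSup ⟨y, hb⟩ hx, csSup_le ⟨x, hx⟩ hb⟩
    · intro hy
      by_contra hx
      have hb : ∀ z ∈ X, x ≤ z := fun z hz => by
        by_contra! h'
        exact hx (hX.out hz hy ⟨h'.le, hxy⟩)
      exact hi ⟨le_csInf ⟨y, hy⟩ hb, csInf_le ⟨x, hb⟩ hy⟩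
  rcases hh with hh | hh
  · refine ⟨sInf {x ∈ s | h x ≤ 0}, sSup {x ∈ s | h x ≤ 0}, fun x hx y hy hxy hi hs => ?_⟩
    have := key _ (hh.convex_le 0).ordConnected x y hxy hi hs
    simp only [Set.mem_sep_iff, hx, hy, true_and] at this
    rw [← not_le, ← not_le, this]
  · refine ⟨sInf {x ∈ s | 0 < h x}, sSup {x ∈ s | 0 < h x}, fun x hx y hy hxy hi hs => ?_⟩
    have := key _ (hh.convex_gt 0).ordConnected x y hxy hi hs
    simpa only [Set.mem_sep_iff, hx, hy, true_and] using this

theorem convexOn_or_concaveOn_quadratic (a b c : ℝ) {s : Set ℝ} (hs : Convex ℝ s) :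
    ConvexOn ℝ s (fun y => a * y ^ 2 + b * y + c) ∨
      ConcaveOn ℝ s (fun y => a * y ^ 2 + b * y + c) := by
  have e : ∀ x y u v : ℝ, u + v = 1 → u * (a * x ^ 2 + b * x + c) + v * (a * y ^ 2 + b * y + c) -
      (a * (u * x + v * y) ^ 2 + b * (u * x + v * y) + c) = a * (u * v * (x - y) ^ 2) := by
    intro x y u v huv
    have : v = 1 - u := by linarith
    subst this; ring
  rcases le_total 0 a with ha | ha
  · refine Or.inl ⟨hs, fun x _ y _ u v hu hv huv => ?_⟩
    have := e x y u v huv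
    have h2 : 0 ≤ a * (u * v * (x - y) ^ 2) := by positivity
    simp only [smul_eq_mul]
    linarith
  · refine Or.inr ⟨hs, fun x _ y _ u v hu hv huv => ?_⟩
    have := e x y u v huv
    have h2 : a * (u * v * (x - y) ^ 2) ≤ 0 :=
      mul_nonpos_of_nonpos_of_nonneg ha (by positivity)
    simp only [smul_eq_mul]
    linarith

theorem convexOn_or_concaveOn_arc (p q c : ℝ) :
    ConvexOn ℝ (Set.Icc (-2) 2) (fun y : ℝ => p * √(4 - y ^ 2) + q * y + c) ∨
      ConcaveOn ℝ (Set.Icc (-2) 2) (fun y : ℝ => p * √(4 - y ^ 2) + q * y + c) := by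
  rcases le_total 0 p with hp | hp
  · exact Or.inr (concaveOn_arc hp q c)
  · left
    have := (concaveOn_arc (neg_nonneg.2 hp) (-q) (-c)).neg
    refine this.congr fun y _ => ?_
    simp only [Pi.neg_apply]
    ring

/-- Along a front, membership in a half-plane, in a disc or in the outside of a disc changes at most
twice on the arc and on each of the tangent rays, and at the points of tangency. -/
theorem exists_changesIn_front {r : ℝ} (hr : 2 ≤ r) (e₀ e₁ e₂ e₃ : ℝ) :
    ∃ F : Finset ℝ, F.card ≤ 8 ∧ ChangesIn (fun y =>
      0 < e₀ * (front r y ^ 2 + y ^ 2) + e₁ * front r y + e₂ * y + e₃) F := by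
  set s := √(r ^ 2 - 4) with hs
  set t := 2 * s / r with ht
  have ht0 : 0 ≤ t := by positivity
  obtain ⟨a₁, b₁, h₁⟩ := exists_sign_changes
    (convexOn_or_concaveOn_quadratic (e₀ * (s ^ 2 / 4 + 1)) (e₁ * s / 2 + e₂) e₃ (convex_Ici t))
  obtain ⟨a₂, b₂, h₂⟩ := exists_sign_changes
    (convexOn_or_concaveOn_quadratic (e₀ * (s ^ 2 / 4 + 1)) (-(e₁ * s / 2) + e₂) e₃
      (convex_Iic (-t)))
  obtain ⟨a₃, b₃, h₃⟩ := exists_sign_changes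
    (convexOn_or_concaveOn_arc (-(2 * r * e₀ + e₁)) e₂ (e₀ * (r ^ 2 + 4) + e₁ * r + e₃))
  refine ⟨[t, -t, a₁, b₁, a₂, b₂, a₃, b₃].toFinset, List.toFinset_card_le _, ?_⟩
  intro x y hxy hF
  simp only [List.mem_toFinset, List.mem_cons, List.not_mem_nil, or_false, forall_eq_or_imp,
    forall_eq] at hF
  beta_reduce
  obtain ⟨f1, f2, fa₁, fb₁, fa₂, fb₂, fa₃, fb₃⟩ := hF
  by_cases c1 : t ≤ x
  · have e : ∀ z, t ≤ z → e₀ * (front r z ^ 2 + z ^ 2) + e₁ * front r z + e₂ * z + e₃ =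
        e₀ * (s ^ 2 / 4 + 1) * z ^ 2 + (e₁ * s / 2 + e₂) * z + e₃ := by
      intro z hz
      rw [front_of_le_abs (by rwa [abs_of_nonneg (ht0.trans hz)]), abs_of_nonneg (ht0.trans hz)]
      ring
    rw [e x c1, e y (c1.trans hxy)]
    exact h₁ x c1 y (c1.trans hxy) hxy fa₁ fb₁
  by_cases c2 : y ≤ -t
  · have e : ∀ z, z ≤ -t → e₀ * (front r z ^ 2 + z ^ 2) + e₁ * front r z + e₂ * z + e₃ =
        e₀ * (s ^ 2 / 4 + 1) * z ^ 2 + (-(e₁ * s / 2) + e₂) * z + e₃ := by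
      intro z hz
      have hz0 : z ≤ 0 := by linarith
      rw [front_of_le_abs (by rw [abs_of_nonpos hz0]; exact le_neg.1 hz), abs_of_nonpos hz0]
      ring
    rw [e x (hxy.trans c2), e y c2]
    exact h₂ x (hxy.trans c2) y c2 hxy fa₂ fb₂
  · have c3 : y < t := by
      by_contra! h
      exact f1 ⟨(not_le.1 c1).le, h⟩
    have c4 : -t < x := by
      by_contra! h
      exact f2 ⟨h, (not_le.1 c2).le⟩
    have h2 := tangent_le_two hr
    have hmem : ∀ z, -t < z → z < t → z ∈ Set.Icc (-2 : ℝ) 2 := fun z h h' =>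
      ⟨by linarith, by linarith⟩
    have e : ∀ z, -t < z → z < t → e₀ * (front r z ^ 2 + z ^ 2) + e₁ * front r z + e₂ * z + e₃ =
        -(2 * r * e₀ + e₁) * √(4 - z ^ 2) + e₂ * z + (e₀ * (r ^ 2 + 4) + e₁ * r + e₃) := by
      intro z h h'
      have hz := hmem z h h'
      have hS := Real.sq_sqrt (show 0 ≤ 4 - z ^ 2 by nlinarith [hz.1, hz.2])
      rw [front_of_abs_le hr (abs_le.2 ⟨h.le, h'.le⟩)]
      linear_combination e₀ * hS
    rw [e x c4 (hxy.trans_lt c3), e y (c4.trans_le hxy) c3]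
    exact h₃ x (hmem x c4 (hxy.trans_lt c3)) y (hmem y (c4.trans_le hxy) c3) hxy fa₃ fb₃

/-! ### Shadows in the plane -/

theorem norm_sq_plane (v : Plane) : ‖v‖ ^ 2 = v 0 ^ 2 + v 1 ^ 2 := by
  rw [EuclideanSpace.norm_sq_eq, Fin.sum_univ_two, Real.norm_eq_abs, Real.norm_eq_abs, sq_abs,
    sq_abs]

theorem norm_plane (v : Plane) : ‖v‖ = √(v 0 * v 0 + v 1 * v 1) := by
  rw [← Real.sqrt_sq (norm_nonneg v), norm_sq_plane, sq, sq]

/-- The translations `v` for which the segment from the origin to `v + d` meets the open disc of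
radius `2` about `a`. -/
def shadow (a d : Plane) : Set Plane := {v | ∃ τ ∈ Set.Icc (0 : ℝ) 1, ‖τ • (v + d) - a‖ < 2}

/-- The coordinate of `v + d` along `a`. -/
noncomputable def along (a d v : Plane) : ℝ := (a 0 * (v 0 + d 0) + a 1 * (v 1 + d 1)) / ‖a‖

/-- The coordinate of `v + d` perpendicular to `a`. -/
noncomputable def across (a d v : Plane) : ℝ := (a 0 * (v 1 + d 1) - a 1 * (v 0 + d 0)) / ‖a‖

/-- The point with coordinates `x` along and `y` perpendicular to `a`. -/
noncomputable def pointAt (a d : Plane) (x y : ℝ) : Plane :=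
  !₂[(x * a 0 - y * a 1) / ‖a‖ - d 0, (x * a 1 + y * a 0) / ‖a‖ - d 1]

section

variable {a d : Plane}

theorem along_pointAt (ha : 0 < ‖a‖) (x y : ℝ) : along a d (pointAt a d x y) = x := by
  have h := norm_sq_plane a
  simp only [along, pointAt, PiLp.toLp_apply, Matrix.cons_val_zero, Matrix.cons_val_one]
  field_simp
  linear_combination -x * h

theorem across_pointAt (ha : 0 < ‖a‖) (x y : ℝ) : across a d (pointAt a d x y) = y := by
  have h := norm_sq_plane a
  simp only [across, pointAt, PiLp.toLp_apply, Matrix.cons_val_zero, Matrix.cons_val_one]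
  field_simp
  linear_combination -y * h

theorem pointAt_along_across (ha : 0 < ‖a‖) (v : Plane) :
    pointAt a d (along a d v) (across a d v) = v := by
  have h := norm_sq_plane a
  ext i
  fin_cases i
  · simp only [along, across, pointAt, PiLp.toLp_apply, Fin.zero_eta, Matrix.cons_val_zero]
    field_simp
    linear_combination -(v 0 + d 0) * h
  · simp only [along, across, pointAt, PiLp.toLp_apply, Fin.mk_one, Matrix.cons_val_one,
      Matrix.cons_val_fin_one]
    field_simp
    linear_combination -(v 1 + d 1) * h

theorem norm_sq_eq_along_across (ha : 0 < ‖a‖) (v : Plane) :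
    ‖v‖ ^ 2 = (along a d v - along a d 0) ^ 2 + (across a d v - across a d 0) ^ 2 := by
  have h := norm_sq_plane a
  rw [norm_sq_plane]
  simp only [along, across, PiLp.zero_apply]
  field_simp
  linear_combination (v 0 ^ 2 + v 1 ^ 2) * h

theorem norm_sub_eq_along_across (ha : 0 < ‖a‖) (v : Plane) (τ : ℝ) :
    ‖τ • (v + d) - a‖ ^ 2 = (τ * along a d v - ‖a‖) ^ 2 + (τ * across a d v) ^ 2 := by
  have h := norm_sq_plane a
  rw [norm_sq_plane]
  simp only [along, across, PiLp.sub_apply, PiLp.smul_apply, PiLp.add_apply, smul_eq_mul]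
  field_simp
  linear_combination (τ ^ 2 * ((v 0 + d 0) ^ 2 + (v 1 + d 1) ^ 2) - ‖a‖ ^ 2) * h

theorem cross_eq_across (ha : 0 < ‖a‖) (v : Plane) :
    a 0 * v 1 - a 1 * v 0 = ‖a‖ * (across a d v - across a d 0) := by
  simp only [across, PiLp.zero_apply]
  field_simp
  ring

theorem mem_shadow_iff (ha : 2 ≤ ‖a‖) (v : Plane) :
    v ∈ shadow a d ↔ front ‖a‖ (across a d v) < along a d v := by
  rw [← exists_mem_scaled_disc_iff ha]
  have ha0 : 0 < ‖a‖ := by linarith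
  refine exists_congr fun τ => and_congr_right fun _ => ?_
  rw [← norm_sub_eq_along_across ha0, show (4 : ℝ) = 2 ^ 2 by norm_num]
  exact (pow_lt_pow_iff_left₀ (norm_nonneg _) (by norm_num) (by norm_num)).symm

theorem continuous_along (a d : Plane) : Continuous (along a d) := by
  unfold along; fun_prop

theorem continuous_across (a d : Plane) : Continuous (across a d) := by
  unfold across; fun_prop

theorem isOpen_shadow (ha : 2 ≤ ‖a‖) : IsOpen (shadow a d) := by
  have : shadow a d = {v | front ‖a‖ (across a d v) < along a d v} := by
    ext v; exact mem_shadow_iff ha v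
  rw [this]
  exact isOpen_lt ((continuous_front ha).comp (continuous_across a d)) (continuous_along a d)

theorem mem_frontier_shadow_iff (ha : 2 ≤ ‖a‖) (v : Plane) :
    v ∈ frontier (shadow a d) ↔ along a d v = front ‖a‖ (across a d v) := by
  have ha0 : 0 < ‖a‖ := by linarith
  have hsh : shadow a d = {v | front ‖a‖ (across a d v) < along a d v} := by
    ext v; exact mem_shadow_iff ha v
  constructor
  · intro h
    rw [hsh] at h
    exact (frontier_lt_subset_eq ((continuous_front ha).comp (continuous_across a d))
      (continuous_along a d) h).symm
  · intro h
    rw [(isOpen_shadow ha).frontier_eq]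
    refine ⟨?_, by rw [mem_shadow_iff ha, h]; exact lt_irrefl _⟩
    -- moving from `v` along the axis leads into the shadow
    have hc : Filter.Tendsto (fun ε : ℝ => v + ε • a) (nhdsWithin 0 (Set.Ioi 0)) (nhds v) := by
      have : Continuous fun ε : ℝ => v + ε • a := by fun_prop
      have h0 := this.tendsto 0
      simp only [zero_smul, add_zero] at h0
      exact h0.mono_left nhdsWithin_le_nhds
    refine mem_closure_of_tendsto hc ?_
    filter_upwards [self_mem_nhdsWithin] with ε hε
    rw [mem_shadow_iff ha]
    have e1 : across a d (v + ε • a) = across a d v := by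
      simp only [across, PiLp.add_apply, PiLp.smul_apply, smul_eq_mul]; ring
    have e2 : along a d (v + ε • a) = along a d v + ε * ‖a‖ := by
      have h := norm_sq_plane a
      simp only [along, PiLp.add_apply, PiLp.smul_apply, smul_eq_mul]
      field_simp
      linear_combination -ε * h
    rw [e1, e2, h]
    have : 0 < ε * ‖a‖ := mul_pos hε ha0
    linarith

/-- The point of the boundary of the shadow in position `y`. -/
noncomputable def frontPoint (a d : Plane) (y : ℝ) : Plane := pointAt a d (front ‖a‖ y) y

theorem across_frontPoint (ha : 2 ≤ ‖a‖) (y : ℝ) : across a d (frontPoint a d y) = y :=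
  across_pointAt (by linarith) _ _

theorem frontPoint_mem (ha : 2 ≤ ‖a‖) (y : ℝ) : frontPoint a d y ∈ frontier (shadow a d) := by
  rw [mem_frontier_shadow_iff ha, across_frontPoint ha, frontPoint, along_pointAt (by linarith)]

theorem frontPoint_across (ha : 2 ≤ ‖a‖) {v : Plane} (hv : v ∈ frontier (shadow a d)) :
    frontPoint a d (across a d v) = v := by
  rw [frontPoint, ← (mem_frontier_shadow_iff ha v).1 hv, pointAt_along_across (by linarith)]

theorem norm_sq_frontPoint (ha : 2 ≤ ‖a‖) (y : ℝ) :
    ‖frontPoint a d y‖ ^ 2 = frontDist ‖a‖ (along a d 0) (across a d 0) y := by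
  have ha0 : 0 < ‖a‖ := by linarith
  rw [norm_sq_eq_along_across (d := d) ha0, frontPoint, along_pointAt ha0, across_pointAt ha0,
    frontDist]

/-- The boundary of one shadow crosses the boundary of another one a bounded number of times. -/
theorem exists_changesIn_shadow (ha : 2 ≤ ‖a‖) {b e : Plane} (hb : 2 ≤ ‖b‖) :
    ∃ F : Finset ℝ, F.card ≤ 32 ∧ ChangesIn (fun y => frontPoint a d y ∈ shadow b e) F := by
  have ha0 : 0 < ‖a‖ := by linarith
  have hb0 : 0 < ‖b‖ := by linarith
  have gen : ∀ e₀ e₁ e₂ e₃ : ℝ, ∃ F : Finset ℝ, F.card ≤ 8 ∧ ChangesIn (fun y =>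
      0 < e₀ * (along b e (frontPoint a d y) ^ 2 + across b e (frontPoint a d y) ^ 2) +
        e₁ * along b e (frontPoint a d y) + e₂ * across b e (frontPoint a d y) + e₃) F := by
    intro e₀ e₁ e₂ e₃
    -- the change between the two systems of coordinates is a rotation and a translation
    obtain ⟨c, s, p, q, hcs, hx, hy⟩ : ∃ c s p q : ℝ, c ^ 2 + s ^ 2 = 1 ∧
        (∀ y, along b e (frontPoint a d y) = c * front ‖a‖ y - s * y + p) ∧
        (∀ y, across b e (frontPoint a d y) = s * front ‖a‖ y + c * y + q) := by
      have h := norm_sq_plane a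
      have h' := norm_sq_plane b
      refine ⟨(b 0 * a 0 + b 1 * a 1) / (‖a‖ * ‖b‖), (b 0 * a 1 - b 1 * a 0) / (‖a‖ * ‖b‖),
        along b e (-d), across b e (-d), ?_, ?_, ?_⟩
      · field_simp
        rw [h, h']; ring
      · intro y
        simp only [along, frontPoint, pointAt, PiLp.toLp_apply, Matrix.cons_val_zero,
          Matrix.cons_val_one, PiLp.neg_apply]
        field_simp
        ring
      · intro y
        simp only [across, frontPoint, pointAt, PiLp.toLp_apply, Matrix.cons_val_zero,
          Matrix.cons_val_one, PiLp.neg_apply]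
        field_simp
        ring
    obtain ⟨F, hF, hc⟩ := exists_changesIn_front ha e₀
      (e₀ * (2 * c * p + 2 * s * q) + e₁ * c + e₂ * s)
      (e₀ * (2 * c * q - 2 * s * p) - e₁ * s + e₂ * c) (e₀ * (p ^ 2 + q ^ 2) + e₁ * p + e₂ * q + e₃)
    refine ⟨F, hF, hc.congr fun y => ?_⟩
    rw [hx, hy]
    have : ∀ u v : ℝ, u = v → (0 < u ↔ 0 < v) := fun u v huv => by rw [huv]
    apply this
    linear_combination e₀ * (front ‖a‖ y ^ 2 + y ^ 2) * hcs
  obtain ⟨F₁, hF₁, h₁⟩ := gen 0 2 (-√(‖b‖ ^ 2 - 4)) 0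
  obtain ⟨F₂, hF₂, h₂⟩ := gen 0 2 √(‖b‖ ^ 2 - 4) 0
  obtain ⟨F₃, hF₃, h₃⟩ := gen (-1) (2 * ‖b‖) 0 (4 - ‖b‖ ^ 2)
  obtain ⟨F₄, hF₄, h₄⟩ := gen 0 ‖b‖ 0 (4 - ‖b‖ ^ 2)
  refine ⟨F₁ ∪ F₂ ∪ (F₃ ∪ F₄), ?_, ?_⟩
  · have i1 := Finset.card_union_le (F₁ ∪ F₂) (F₃ ∪ F₄)
    have i2 := Finset.card_union_le F₁ F₂
    have i3 := Finset.card_union_le F₃ F₄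
    omega
  · intro x y hxy hz
    simp only [Finset.mem_union] at hz
    have g₁ := h₁ x y hxy fun z h => hz z (by tauto)
    have g₂ := h₂ x y hxy fun z h => hz z (by tauto)
    have g₃ := h₃ x y hxy fun z h => hz z (by tauto)
    have g₄ := h₄ x y hxy fun z h => hz z (by tauto)
    have conv : ∀ v : Plane, v ∈ shadow b e ↔
        (0 < 0 * (along b e v ^ 2 + across b e v ^ 2) + 2 * along b e v +
          -√(‖b‖ ^ 2 - 4) * across b e v + 0) ∧
        (0 < 0 * (along b e v ^ 2 + across b e v ^ 2) + 2 * along b e v +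
          √(‖b‖ ^ 2 - 4) * across b e v + 0) ∧
        ((0 < -1 * (along b e v ^ 2 + across b e v ^ 2) + 2 * ‖b‖ * along b e v +
          0 * across b e v + (4 - ‖b‖ ^ 2)) ∨
        (0 < 0 * (along b e v ^ 2 + across b e v ^ 2) + ‖b‖ * along b e v +
          0 * across b e v + (4 - ‖b‖ ^ 2))) := by
      intro v
      rw [mem_shadow_iff hb, front_lt_iff hb]
      refine and_congr ?_ (and_congr ?_ (or_congr ?_ ?_)) <;>
        constructor <;> intro h <;> linarith
    beta_reduce at g₁ g₂ g₃ g₄ ⊢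
    rw [conv, conv, g₁, g₂, g₃, g₄]

end

/-! ### Vippodromes -/

theorem mem_convexHull_discs (p q z : Plane) :
    z ∈ convexHull ℝ (disc p ∪ disc q) ↔
      ∃ τ ∈ Set.Icc (0 : ℝ) 1, z ∈ disc (AffineMap.lineMap p q τ) := by
  have hne : ∀ c : Plane, (disc c).Nonempty := fun c => ⟨c, Metric.mem_ball_self one_pos⟩
  have hcv : ∀ c : Plane, Convex ℝ (disc c) := fun c => convex_ball c 1
  rw [(hcv p).convexHull_union (hcv q) (hne p) (hne q), mem_convexJoin]
  constructor
  · rintro ⟨x, hx, y, hy, hz⟩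
    rw [segment_eq_image_lineMap] at hz
    obtain ⟨τ, hτ, rfl⟩ := hz
    refine ⟨τ, hτ, ?_⟩
    rw [disc, Metric.mem_ball, dist_eq_norm] at hx hy
    rw [disc, Metric.mem_ball, dist_eq_norm]
    have e : AffineMap.lineMap x y τ - AffineMap.lineMap p q τ
        = (1 - τ) • (x - p) + τ • (y - q) := by
      simp only [AffineMap.lineMap_apply_module]; module
    rw [e]
    have := (convex_ball (0 : Plane) 1) (x := x - p) (by simpa using hx) (y := y - q)
      (by simpa using hy) (a := 1 - τ) (b := τ) (by linarith [hτ.2]) hτ.1 (by ring)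
    simpa using this
  · rintro ⟨τ, hτ, hz⟩
    rw [disc, Metric.mem_ball, dist_eq_norm] at hz
    set u := z - AffineMap.lineMap p q τ with hu
    refine ⟨p + u, by simpa [disc] using hz, q + u, by simpa [disc] using hz, ?_⟩
    rw [segment_eq_image_lineMap]
    refine ⟨τ, hτ, ?_⟩
    rw [hu]
    simp only [AffineMap.lineMap_apply_module]; module

theorem disjoint_disc_iff (p q : Plane) : Disjoint (disc p) (disc q) ↔ 2 ≤ ‖p - q‖ := by
  rw [disc, disc, disjoint_ball_ball_iff one_pos one_pos, dist_eq_norm]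
  norm_num

theorem disc_inter_hull_nonempty_iff (c p q : Plane) :
    (disc c ∩ convexHull ℝ (disc p ∪ disc q)).Nonempty ↔
      ∃ τ ∈ Set.Icc (0 : ℝ) 1, ¬ Disjoint (disc (AffineMap.lineMap p q τ)) (disc c) := by
  simp only [Set.not_disjoint_iff]
  constructor
  · rintro ⟨z, hz, h⟩
    obtain ⟨τ, hτ, h⟩ := (mem_convexHull_discs p q z).1 h
    exact ⟨τ, hτ, z, h, hz⟩
  · rintro ⟨τ, hτ, z, h, hz⟩
    exact ⟨z, hz, (mem_convexHull_discs p q z).2 ⟨τ, hτ, h⟩⟩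

namespace Instance

variable {n : ℕ} (I : Instance n)

/-- The translation vector by which a vippodrome has to be moved so that its cone has its apex at
the origin. -/
def offset (A B : Fin n) : Fin 2 → Plane
  | 0 => I.tgt B - I.src B
  | 1 => I.tgt A - I.src A

theorem vippodrome_eq_shadow (A B : Fin n) (k : Fin 2) :
    I.vippodrome A B k = shadow (I.axis A B k) (I.offset A B k) := by
  ext v
  fin_cases k
  · simp only [vippodrome, hippodrome, Set.mem_ofPred_eq, shadow, axis, offset]
    rw [disc_inter_hull_nonempty_iff]
    refine exists_congr fun τ => and_congr_right fun _ => ?_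
    rw [disjoint_disc_iff, not_le, AffineMap.lineMap_apply_module]
    have e : (1 - τ) • I.src B + τ • (I.tgt B + v) - I.src A
        = τ • (v + (I.tgt B - I.src B)) - (I.src A - I.src B) := by module
    rw [e]
  · simp only [vippodrome, hippodrome, Set.mem_ofPred_eq, shadow, axis, offset]
    rw [disc_inter_hull_nonempty_iff]
    -- the target disc is seen from the moving disc, in reversed time
    have e : ∀ τ : ℝ, (1 - τ) • I.src A + τ • (I.tgt A + v) - (I.tgt B + v)
        = -((1 - τ) • (v + (I.tgt A - I.src A)) - (I.tgt A - I.tgt B)) := fun τ => by module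
    constructor
    · rintro ⟨τ, ⟨h0, h1⟩, h⟩
      rw [disjoint_disc_iff, not_le, AffineMap.lineMap_apply_module, e, norm_neg] at h
      exact ⟨1 - τ, ⟨by linarith, by linarith⟩, h⟩
    · rintro ⟨τ, ⟨h0, h1⟩, h⟩
      refine ⟨1 - τ, ⟨by linarith, by linarith⟩, ?_⟩
      rw [disjoint_disc_iff, not_le, AffineMap.lineMap_apply_module, e, norm_neg]
      simpa using h

theorem two_le_norm_axis {A B : Fin n} (hAB : A ≠ B) (k : Fin 2) : 2 ≤ ‖I.axis A B k‖ := by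
  fin_cases k
  · exact (disjoint_disc_iff _ _).1 (I.validS A B hAB)
  · exact (disjoint_disc_iff _ _).1 (I.validT _ _ fun h => hAB (I.M.injective h))

/-- The pair `A` has to move before the pair `B`. -/
def Precedes (v : Plane) (A B : Fin n) : Prop := A ≠ B ∧ ∃ k, v ∈ I.vippodrome A B k

theorem isItinerary_iff (v : Plane) (π : Equiv.Perm (Fin n)) :
    I.IsItinerary v π ↔ ∀ i j, i < j → ¬ I.Precedes v (π j) (π i) := by
  have h0 : ∀ A B, v ∈ I.vippodrome A B 0 ↔
      ∃ τ ∈ Set.Icc (0 : ℝ) 1, ¬ Disjoint (I.movingDisc v B τ) (disc (I.src A)) :=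
    fun A B => disc_inter_hull_nonempty_iff _ _ _
  have h1 : ∀ A B, v ∈ I.vippodrome A B 1 ↔
      ∃ τ ∈ Set.Icc (0 : ℝ) 1, ¬ Disjoint (I.movingDisc v A τ) (disc (I.tgt B + v)) :=
    fun A B => disc_inter_hull_nonempty_iff _ _ _
  have hp : ∀ i j, i < j → (I.Precedes v (π j) (π i) ↔
      v ∈ I.vippodrome (π j) (π i) 0 ∨ v ∈ I.vippodrome (π j) (π i) 1) := by
    intro i j hij
    have : π j ≠ π i := fun h => hij.ne (π.injective h).symm
    simp [Precedes, this, Fin.exists_fin_two]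
  constructor
  · intro h i j hij hpre
    rw [hp i j hij, h0, h1] at hpre
    rcases hpre with ⟨τ, hτ, hd⟩ | ⟨τ, hτ, hd⟩
    · exact hd ((h i τ hτ).1 j hij)
    · exact hd ((h j τ hτ).2 i hij)
  · intro h k τ hτ
    constructor
    · intro j hkj
      by_contra hd
      exact h k j hkj ((hp k j hkj).2 (Or.inl ((h0 _ _).2 ⟨τ, hτ, hd⟩)))
    · intro j hjk
      by_contra hd
      exact h j k hjk ((hp j k hjk).2 (Or.inr ((h1 _ _).2 ⟨τ, hτ, hd⟩)))

theorem mem_Q_iff (v : Plane) :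
    v ∈ I.Q ↔ ∃ π : Equiv.Perm (Fin n), ∀ i j, i < j → ¬ I.Precedes v (π j) (π i) :=
  exists_congr fun π => I.isItinerary_iff v π

theorem mem_Q_of_subset {v w : Plane} (hv : v ∈ I.Q)
    (h : ∀ A B k, A ≠ B → w ∈ I.vippodrome A B k → v ∈ I.vippodrome A B k) : w ∈ I.Q := by
  rw [mem_Q_iff] at hv ⊢
  obtain ⟨π, hπ⟩ := hv
  exact ⟨π, fun i j hij ⟨hne, k, hk⟩ => hπ i j hij ⟨hne, k, h _ _ k hne hk⟩⟩

theorem isOpen_vippodrome {A B : Fin n} (hAB : A ≠ B) (k : Fin 2) :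
    IsOpen (I.vippodrome A B k) := by
  rw [vippodrome_eq_shadow]
  exact isOpen_shadow (I.two_le_norm_axis hAB k)

theorem isClosed_Q : IsClosed I.Q := by
  have : I.Q = ⋃ π : Equiv.Perm (Fin n), ⋂ (i) (j) (_ : i < j) (k : Fin 2),
      (I.vippodrome (π j) (π i) k)ᶜ := by
    ext v
    rw [mem_Q_iff]
    simp only [Set.mem_iUnion, Set.mem_iInter, Set.mem_compl_iff]
    refine exists_congr fun π => forall_congr' fun i => forall_congr' fun j =>
      forall_congr' fun hij => ?_
    have : π j ≠ π i := fun h => hij.ne (π.injective h).symm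
    simp [Precedes, this]
  rw [this]
  refine isClosed_iUnion_of_finite fun π => isClosed_iInter fun i => isClosed_iInter fun j =>
    isClosed_iInter fun hij => isClosed_iInter fun k => ?_
  exact (I.isOpen_vippodrome (fun h => hij.ne (π.injective h).symm) k).isClosed_compl

theorem exists_isShortest (h : I.Q.Nonempty) : ∃ v, I.IsShortest v := by
  obtain ⟨v, hv, hd⟩ := I.isClosed_Q.exists_infDist_eq_dist h 0
  refine ⟨v, hv, fun w hw => ?_⟩
  have := Metric.infDist_le_dist_of_mem (x := (0 : Plane)) hw
  rw [hd] at this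
  simpa using this

/-- Off the boundaries of the vippodromes a valid translation stays valid when it is shortened a
little. -/
theorem IsShortest.eq_zero_or_mem_curve {v : Plane} (hv : I.IsShortest v) :
    v = 0 ∨ ∃ (A B : Fin n) (k : Fin 2), A ≠ B ∧ v ∈ I.curve A B k := by
  by_contra! h
  obtain ⟨hv0, hc⟩ := h
  have hev : ∀ᶠ w in nhds v, w ∈ I.Q := by
    have : ∀ᶠ w in nhds v, ∀ A B k, A ≠ B → w ∈ I.vippodrome A B k → v ∈ I.vippodrome A B k := by
      simp only [Filter.eventually_all]
      intro A B k hAB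
      by_cases hm : v ∈ I.vippodrome A B k
      · exact Filter.Eventually.of_forall fun _ _ => hm
      · have hcl : v ∉ closure (I.vippodrome A B k) := fun h' =>
          hc A B k hAB (by
            rw [curve, (I.isOpen_vippodrome hAB k).frontier_eq]; exact ⟨h', hm⟩)
        filter_upwards [isClosed_closure.isOpen_compl.mem_nhds hcl] with w hw hw'
        exact absurd (subset_closure hw') hw
    exact this.mono fun w hw => I.mem_Q_of_subset hv.1 hw
  have hc : Filter.Tendsto (fun ε : ℝ => (1 - ε) • v) (nhdsWithin 0 (Set.Ioi 0)) (nhds v) := by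
    have : Continuous fun ε : ℝ => (1 - ε) • v := by fun_prop
    have h0 := this.tendsto 0
    simp only [sub_zero, one_smul] at h0
    exact h0.mono_left nhdsWithin_le_nhds
  have h01 : ∀ᶠ ε : ℝ in nhdsWithin 0 (Set.Ioi 0), ε ∈ Set.Ioo (0 : ℝ) 1 :=
    Ioo_mem_nhdsGT one_pos
  obtain ⟨ε, hε, h0, h1⟩ := ((hc.eventually hev).and h01).exists
  have := hv.2 _ hε
  rw [norm_smul, Real.norm_eq_abs, abs_of_pos (by linarith)] at this
  nlinarith [norm_pos_iff.2 hv0]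

/-! ### Boundary curves -/

theorem curve_eq_frontier (A B : Fin n) (k : Fin 2) :
    I.curve A B k = frontier (shadow (I.axis A B k) (I.offset A B k)) := by
  rw [curve, vippodrome_eq_shadow]

theorem pos_eq {A B : Fin n} (hAB : A ≠ B) (k : Fin 2) (v : Plane) :
    I.pos A B k v = ‖I.axis A B k‖ * (across (I.axis A B k) (I.offset A B k) v -
      across (I.axis A B k) (I.offset A B k) 0) :=
  cross_eq_across (by linarith [I.two_le_norm_axis hAB k]) v

theorem exists_monotone_split :
    ∃ K : ℕ, ∀ (n : ℕ) (I : Instance n) (A B : Fin n) (k : Fin 2), A ≠ B →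
      ∃ F : Finset ℝ, F.card ≤ K ∧
        ∀ J : Set ℝ, J.OrdConnected → Disjoint J (F : Set ℝ) →
          (∀ x ∈ I.curve A B k, ∀ y ∈ I.curve A B k, I.pos A B k x ∈ J → I.pos A B k y ∈ J →
            I.pos A B k x ≤ I.pos A B k y → ‖x‖ ≤ ‖y‖) ∨
          (∀ x ∈ I.curve A B k, ∀ y ∈ I.curve A B k, I.pos A B k x ∈ J → I.pos A B k y ∈ J →
            I.pos A B k x ≤ I.pos A B k y → ‖y‖ ≤ ‖x‖) := by
  refine ⟨6, fun n I A B k hAB => ?_⟩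
  have ha := I.two_le_norm_axis hAB k
  have hpos := I.pos_eq hAB k
  rw [curve_eq_frontier]
  set a := I.axis A B k
  set d := I.offset A B k
  have ha0 : 0 < ‖a‖ := by linarith
  set c := across a d 0
  let g : ℝ → ℝ := fun y => ‖a‖ * (y - c)
  have hg : StrictMono g := fun x y hxy => mul_lt_mul_of_pos_left (by linarith) ha0
  refine ⟨(splitPoints ‖a‖ (along a d 0) c).image g, ?_, ?_⟩
  · exact Finset.card_image_le.trans Finset.card_le_six
  intro J hJ hd
  have hJ' : (g ⁻¹' J).OrdConnected := hJ.preimage_mono hg.monotone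
  have hd' : Disjoint (g ⁻¹' J) (splitPoints ‖a‖ (along a d 0) c : Set ℝ) := by
    rw [Set.disjoint_left] at hd ⊢
    intro y hy hys
    exact hd hy (Finset.mem_coe.2 (Finset.mem_image_of_mem g hys))
  have hn : ∀ x ∈ frontier (shadow a d),
      ‖x‖ ^ 2 = frontDist ‖a‖ (along a d 0) c (across a d x) := by
    intro x hx
    rw [← norm_sq_frontPoint ha, frontPoint_across ha hx]
  refine (frontDist_monotoneOn_or_antitoneOn ha _ _ hJ' hd').imp ?_ ?_
  · intro h x hx y hy hxJ hyJ hxy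
    rw [hpos, hpos] at hxy
    rw [hpos] at hxJ hyJ
    have := h hxJ hyJ (hg.le_iff_le.1 hxy)
    rw [← hn x hx, ← hn y hy] at this
    exact le_of_sq_le_sq this (norm_nonneg y)
  · intro h x hx y hy hxJ hyJ hxy
    rw [hpos, hpos] at hxy
    rw [hpos] at hxJ hyJ
    have := h hxJ hyJ (hg.le_iff_le.1 hxy)
    rw [← hn x hx, ← hn y hy] at this
    exact le_of_sq_le_sq this (norm_nonneg x)

/-- Along a boundary curve, validity changes `O(n²)` times. -/
theorem exists_changesIn_Q {A B : Fin n} (hAB : A ≠ B) (k : Fin 2) :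
    ∃ F : Finset ℝ, F.card ≤ 64 * n ^ 2 ∧
      ChangesIn (fun y => frontPoint (I.axis A B k) (I.offset A B k) y ∈ I.Q) F := by
  have ha := I.two_le_norm_axis hAB k
  have h : ∀ p : Fin n × Fin n × Fin 2, ∃ F : Finset ℝ, F.card ≤ 32 ∧ (p.1 ≠ p.2.1 →
      ChangesIn (fun y => frontPoint (I.axis A B k) (I.offset A B k) y ∈
        I.vippodrome p.1 p.2.1 p.2.2) F) := by
    rintro ⟨A', B', k'⟩
    by_cases h' : A' = B'
    · exact ⟨∅, by simp, fun h => absurd h' h⟩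
    · obtain ⟨F, hF, hc⟩ := exists_changesIn_shadow (d := I.offset A B k) ha
        (e := I.offset A' B' k') (I.two_le_norm_axis h' k')
      exact ⟨F, hF, fun _ => hc.congr fun y => by rw [vippodrome_eq_shadow]⟩
  choose F hF hc using h
  refine ⟨Finset.univ.biUnion F, ?_, ?_⟩
  · refine (Finset.card_biUnion_le_card_mul _ _ 32 fun p _ => hF p).trans ?_
    simp only [Finset.card_univ, Fintype.card_prod, Fintype.card_fin]
    apply le_of_eq; ring
  · intro x y hxy hz
    have key : ∀ A' B' k', A' ≠ B' →
        (frontPoint (I.axis A B k) (I.offset A B k) x ∈ I.vippodrome A' B' k' ↔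
          frontPoint (I.axis A B k) (I.offset A B k) y ∈ I.vippodrome A' B' k') :=
      fun A' B' k' h' => hc (A', B', k') h' x y hxy fun z hzF =>
        hz z (Finset.mem_biUnion.2 ⟨_, Finset.mem_univ _, hzF⟩)
    exact ⟨fun hx => I.mem_Q_of_subset hx fun A' B' k' h' => (key A' B' k' h').2,
      fun hy => I.mem_Q_of_subset hy fun A' B' k' h' => (key A' B' k' h').1⟩

/-- In the gap between two consecutive arcs validity changes, so the number of arcs on a boundary
curve is polynomial in `n`. -/
theorem length_arcList_le {A B : Fin n} (hAB : A ≠ B) (k : Fin 2) {l : List Arc}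
    (hl : IsArcList (I.curve A B k) I.Q (I.pos A B k) l) : l.length ≤ 64 * n ^ 2 + 1 := by
  obtain ⟨F, hF, hFc⟩ := I.exists_changesIn_Q hAB k
  refine le_trans ?_ (Nat.succ_le_succ hF)
  have ha := I.two_le_norm_axis hAB k
  have hpos := I.pos_eq hAB k
  obtain ⟨hend, hpw, hun⟩ := hl
  rw [curve_eq_frontier] at hend hun
  set a := I.axis A B k
  set d := I.offset A B k
  have ha0 : 0 < ‖a‖ := by linarith
  have hlt : ∀ x y, I.pos A B k x < I.pos A B k y ↔ across a d x < across a d y := by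
    intro x y
    rw [hpos, hpos, mul_lt_mul_iff_right₀ ha0, sub_lt_sub_iff_right]
  have hle : ∀ x y, I.pos A B k x ≤ I.pos A B k y ↔ across a d x ≤ across a d y := by
    intro x y
    rw [← not_lt, hlt, not_lt]
  classical
  -- the changes of validity behind the first arc of every suffix
  have key : ∀ (suf pre : List Arc), l = pre ++ suf → ∀ b rest, suf = b :: rest →
      suf.length ≤ (F.filter fun z => ∃ q ∈ b.hi, across a d q ≤ z).card + 1 := by
    intro suf
    induction suf with
    | nil => rintro _ _ b rest h; cases h
    | cons b' rest' ih =>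
      rintro pre hpre b rest h
      obtain ⟨rfl, rfl⟩ := List.cons.inj h
      rcases rest' with _ | ⟨c, rest⟩
      · simp
      have hi := ih (pre ++ [b']) (by simpa using hpre) c rest rfl
      rw [hpre, List.pairwise_append] at hpw
      obtain ⟨-, hsuf, hcross⟩ := hpw
      rw [List.pairwise_cons] at hsuf
      obtain ⟨hb, hc⟩ := hsuf
      rw [List.pairwise_cons] at hc
      obtain ⟨q, hq, p, hp, hqp⟩ := hb c (by simp)
      rw [hlt] at hqp
      have hbl : b' ∈ l := by simp [hpre]
      have hcl : c ∈ l := by simp [hpre]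
      have hqQ : q ∈ I.Q := by
        have : q ∈ {x | ∃ a' ∈ l, x ∈ a'.carrier (frontier (shadow a d)) (I.pos A B k)} :=
          ⟨b', hbl, (hend b' hbl).2.1 q hq, fun p' hp' => (hend b' hbl).2.2 p' hp' q hq,
            fun q' hq' => by rw [Option.mem_unique hq hq']⟩
        rw [hun] at this
        exact this.2
      have hmid : frontPoint a d ((across a d q + across a d p) / 2) ∉ I.Q := by
        intro hm
        have : frontPoint a d ((across a d q + across a d p) / 2) ∈
            frontier (shadow a d) ∩ I.Q := ⟨frontPoint_mem ha _, hm⟩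
        rw [← hun] at this
        obtain ⟨e, he, -, hlo, hhi⟩ := this
        rw [hpre, List.mem_append, List.mem_cons, List.mem_cons] at he
        rcases he with he | rfl | rfl | he
        · obtain ⟨q', hq', p', hp', h'⟩ := hcross e he b' (by simp)
          have h1 := hhi q' hq'
          have h2 := (hend b' hbl).2.2 p' hp' q hq
          rw [hle, across_frontPoint ha] at h1
          rw [hlt] at h'
          rw [hle] at h2
          linarith
        · have h1 := hhi q hq
          rw [hle, across_frontPoint ha] at h1
          linarith
        · have h1 := hlo p hp
          rw [hle, across_frontPoint ha] at h1
          linarith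
        · obtain ⟨q', hq', p', hp', h'⟩ := hc.1 e he
          have h1 := hlo p' hp'
          have h2 := (hend c hcl).2.2 p hp q' hq'
          rw [hle, across_frontPoint ha] at h1
          rw [hlt] at h'
          rw [hle] at h2
          linarith
      obtain ⟨z, hzF, hz1, hz2⟩ : ∃ z ∈ F, across a d q ≤ z ∧
          z ≤ (across a d q + across a d p) / 2 := by
        by_contra! hno
        have := hFc (across a d q) ((across a d q + across a d p) / 2) (by linarith)
          fun z hz hzI => absurd hzI.2 (not_le.2 (hno z hz hzI.1))
        beta_reduce at this
        rw [frontPoint_across ha ((hend b' hbl).2.1 q hq)] at this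
        exact hmid (this.1 hqQ)
      have hss : insert z (F.filter fun z => ∃ q ∈ c.hi, across a d q ≤ z) ⊆
          F.filter fun z => ∃ q ∈ b'.hi, across a d q ≤ z := by
        intro w hw
        rw [Finset.mem_insert, Finset.mem_filter] at hw
        rw [Finset.mem_filter]
        rcases hw with rfl | ⟨hw, q', hq', h'⟩
        · exact ⟨hzF, q, hq, hz1⟩
        · have h2 := (hend c hcl).2.2 p hp q' hq'
          rw [hle] at h2
          exact ⟨hw, q, hq, by linarith⟩
      have hnot : z ∉ F.filter fun z => ∃ q ∈ c.hi, across a d q ≤ z := by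
        rw [Finset.mem_filter]
        rintro ⟨-, q', hq', h'⟩
        have h2 := (hend c hcl).2.2 p hp q' hq'
        rw [hle] at h2
        linarith
      have hcard := Finset.card_le_card hss
      rw [Finset.card_insert_of_notMem hnot] at hcard
      rw [List.length_cons]
      omega
  rcases l with _ | ⟨b, rest⟩
  · simp
  · exact (key _ [] rfl b rest rfl).trans (Nat.succ_le_succ (Finset.card_filter_le _ _))

end Instance

/-! ### Running programs -/

/-- Started in `σ`, the program halts within `T` steps in a state with the property `Post`. -/
def Runs (p : Program) (σ : State) (T : ℕ) (Post : State → Prop) : Prop :=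
  ∃ t σ', Exec p σ t σ' ∧ t ≤ T ∧ Post σ'

namespace Program

/-- The natural-number variables that a program may change. -/
def natVars : Program → List ℕ
  | skip => []
  | setNat x _ => [x]
  | setReal _ _ => []
  | storeNat _ _ _ => []
  | storeReal _ _ _ => []
  | seq p q => p.natVars ++ q.natVars
  | ite _ p q => p.natVars ++ q.natVars
  | loop _ p => p.natVars

/-- The real variables that a program may change. -/
def realVars : Program → List ℕ
  | skip => []
  | setNat _ _ => []
  | setReal x _ => [x]
  | storeNat _ _ _ => []
  | storeReal _ _ _ => []
  | seq p q => p.realVars ++ q.realVars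
  | ite _ p q => p.realVars ++ q.realVars
  | loop _ p => p.realVars

/-- The natural-number arrays that a program may change. -/
def natArrs : Program → List ℕ
  | skip => []
  | setNat _ _ => []
  | setReal _ _ => []
  | storeNat a _ _ => [a]
  | storeReal _ _ _ => []
  | seq p q => p.natArrs ++ q.natArrs
  | ite _ p q => p.natArrs ++ q.natArrs
  | loop _ p => p.natArrs

/-- The program does not change any real array. -/
def noRealStore : Program → Bool
  | skip => true
  | setNat _ _ => true
  | setReal _ _ => true
  | storeNat _ _ _ => true
  | storeReal _ _ _ => false
  | seq p q => p.noRealStore && q.noRealStore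
  | ite _ p q => p.noRealStore && q.noRealStore
  | loop _ p => p.noRealStore

end Program

/-- `σ'` differs from `σ` only where the program `p` may write. -/
structure Frame (p : Program) (σ σ' : State) : Prop where
  natVar : ∀ x ∉ p.natVars, σ'.natVar x = σ.natVar x
  realVar : ∀ x ∉ p.realVars, σ'.realVar x = σ.realVar x
  natArr : ∀ a ∉ p.natArrs, σ'.natArr a = σ.natArr a
  realArr : p.noRealStore = true → σ'.realArr = σ.realArr

theorem Exec.frame {p : Program} {σ σ' : State} {t : ℕ} (h : Exec p σ t σ') : Frame p σ σ' := by
  induction h with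
  | skip | loopDone => exact ⟨fun _ _ => rfl, fun _ _ => rfl, fun _ _ => rfl, fun _ => rfl⟩
  | setNat σ x e =>
    refine ⟨fun y hy => ?_, fun _ _ => rfl, fun _ _ => rfl, fun _ => rfl⟩
    exact Function.update_of_ne (by simpa [Program.natVars] using hy) _ _
  | setReal σ x e =>
    refine ⟨fun _ _ => rfl, fun y hy => ?_, fun _ _ => rfl, fun _ => rfl⟩
    exact Function.update_of_ne (by simpa [Program.realVars] using hy) _ _
  | storeNat σ a i e =>
    refine ⟨fun _ _ => rfl, fun _ _ => rfl, fun y hy => ?_, fun _ => rfl⟩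
    exact Function.update_of_ne (by simpa [Program.natArrs] using hy) _ _
  | storeReal σ a i e =>
    exact ⟨fun _ _ => rfl, fun _ _ => rfl, fun _ _ => rfl,
      fun h => by simp [Program.noRealStore] at h⟩
  | seq _ _ ih₁ ih₂ =>
    refine ⟨fun x hx => ?_, fun x hx => ?_, fun x hx => ?_, fun h => ?_⟩
    · simp only [Program.natVars, List.mem_append, not_or] at hx
      rw [ih₂.natVar x hx.2, ih₁.natVar x hx.1]
    · simp only [Program.realVars, List.mem_append, not_or] at hx
      rw [ih₂.realVar x hx.2, ih₁.realVar x hx.1]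
    · simp only [Program.natArrs, List.mem_append, not_or] at hx
      rw [ih₂.natArr x hx.2, ih₁.natArr x hx.1]
    · simp only [Program.noRealStore, Bool.and_eq_true] at h
      rw [ih₂.realArr h.2, ih₁.realArr h.1]
  | iteTrue _ _ ih =>
    refine ⟨fun x hx => ?_, fun x hx => ?_, fun x hx => ?_, fun h => ?_⟩
    · simp only [Program.natVars, List.mem_append, not_or] at hx
      exact ih.natVar x hx.1
    · simp only [Program.realVars, List.mem_append, not_or] at hx
      exact ih.realVar x hx.1
    · simp only [Program.natArrs, List.mem_append, not_or] at hx
      exact ih.natArr x hx.1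
    · simp only [Program.noRealStore, Bool.and_eq_true] at h
      exact ih.realArr h.1
  | iteFalse _ _ ih =>
    refine ⟨fun x hx => ?_, fun x hx => ?_, fun x hx => ?_, fun h => ?_⟩
    · simp only [Program.natVars, List.mem_append, not_or] at hx
      exact ih.natVar x hx.2
    · simp only [Program.realVars, List.mem_append, not_or] at hx
      exact ih.realVar x hx.2
    · simp only [Program.natArrs, List.mem_append, not_or] at hx
      exact ih.natArr x hx.2
    · simp only [Program.noRealStore, Bool.and_eq_true] at h
      exact ih.realArr h.2
  | loopStep _ _ _ ih₁ ih₂ =>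
    refine ⟨fun x hx => ?_, fun x hx => ?_, fun x hx => ?_, fun h => ?_⟩
    · rw [ih₂.natVar x hx, ih₁.natVar x hx]
    · rw [ih₂.realVar x hx, ih₁.realVar x hx]
    · rw [ih₂.natArr x hx, ih₁.natArr x hx]
    · rw [ih₂.realArr h, ih₁.realArr h]

namespace Runs

variable {p q : Program} {σ : State} {T T₁ T₂ : ℕ} {Post Mid : State → Prop}

theorem mono {Post' : State → Prop} {T' : ℕ} (h : Runs p σ T Post) (hT : T ≤ T')
    (hP : ∀ σ', Frame p σ σ' → Post σ' → Post' σ') : Runs p σ T' Post' := by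
  obtain ⟨t, σ', he, ht, hp⟩ := h
  exact ⟨t, σ', he, ht.trans hT, hP σ' he.frame hp⟩

theorem skip (h : Post σ) : Runs .skip σ 1 Post := ⟨_, _, .skip σ, le_rfl, h⟩

theorem setNat {x : ℕ} {e : NExp} (hT : e.cost + 1 ≤ T) (h : Post (σ.setNat x (e.eval σ))) :
    Runs (.setNat x e) σ T Post := ⟨_, _, .setNat σ x e, hT, h⟩

theorem setReal {x : ℕ} {e : RExp} (hT : e.cost + 1 ≤ T) (h : Post (σ.setReal x (e.eval σ))) :
    Runs (.setReal x e) σ T Post := ⟨_, _, .setReal σ x e, hT, h⟩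

theorem storeNat {a : ℕ} {i e : NExp} (hT : i.cost + e.cost + 1 ≤ T)
    (h : Post (σ.storeNat a (i.eval σ) (e.eval σ))) :
    Runs (.storeNat a i e) σ T Post := ⟨_, _, .storeNat σ a i e, hT, h⟩

theorem seq (hp : Runs p σ T₁ Mid) (hq : ∀ σ', Frame p σ σ' → Mid σ' → Runs q σ' T₂ Post)
    (hT : T₁ + T₂ ≤ T) : Runs (.seq p q) σ T Post := by
  obtain ⟨t₁, σ₁, h₁, ht₁, hm⟩ := hp
  obtain ⟨t₂, σ₂, h₂, ht₂, hP⟩ := hq σ₁ h₁.frame hm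
  exact ⟨_, _, .seq h₁ h₂, by omega, hP⟩

theorem ite {b : BExp} (hp : b.eval σ → Runs p σ T₁ Post) (hq : ¬ b.eval σ → Runs q σ T₁ Post)
    (hT : b.cost + 1 + T₁ ≤ T) : Runs (.ite b p q) σ T Post := by
  by_cases hb : b.eval σ
  · obtain ⟨t, σ', h, ht, hP⟩ := hp hb
    exact ⟨_, _, .iteTrue hb h, by omega, hP⟩
  · obtain ⟨t, σ', h, ht, hP⟩ := hq hb
    exact ⟨_, _, .iteFalse hb h, by omega, hP⟩

theorem loopDone {b : BExp} (hb : ¬ b.eval σ) (hT : b.cost + 1 ≤ T) (h : Post σ) :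
    Runs (.loop b p) σ T Post := ⟨_, _, .loopDone hb, hT, h⟩

theorem loopStep {b : BExp} (hb : b.eval σ) (hp : Runs p σ T₁ Mid)
    (hl : ∀ σ', Frame p σ σ' → Mid σ' → Runs (.loop b p) σ' T₂ Post)
    (hT : b.cost + 1 + T₁ + T₂ ≤ T) : Runs (.loop b p) σ T Post := by
  obtain ⟨t₁, σ₁, h₁, ht₁, hm⟩ := hp
  obtain ⟨t₂, σ₂, h₂, ht₂, hP⟩ := hl σ₁ h₁.frame hm
  exact ⟨_, _, .loopStep hb h₁ h₂, by omega, hP⟩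

end Runs

/-! ### Programs without loops and counting loops -/

namespace Program

/-- The worst-case running time of a program without loops. -/
def flatCost : Program → ℕ
  | skip => 1
  | setNat _ e => e.cost + 1
  | setReal _ e => e.cost + 1
  | storeNat _ i e => i.cost + e.cost + 1
  | storeReal _ i e => i.cost + e.cost + 1
  | seq p q => p.flatCost + q.flatCost
  | ite b p q => b.cost + 1 + (p.flatCost + q.flatCost)
  | loop _ _ => 0

/-- The final state of a program without loops. -/
noncomputable def run : Program → State → State
  | skip, σ => σ
  | setNat x e, σ => σ.setNat x (e.eval σ)
  | setReal x e, σ => σ.setReal x (e.eval σ)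
  | storeNat a i e, σ => σ.storeNat a (i.eval σ) (e.eval σ)
  | storeReal a i e, σ => σ.storeReal a (i.eval σ) (e.eval σ)
  | seq p q, σ => q.run (p.run σ)
  | ite b p q, σ => by classical exact if b.eval σ then p.run σ else q.run σ
  | loop _ _, σ => σ

/-- The program has no loops. -/
def flat : Program → Bool
  | seq p q => p.flat && q.flat
  | ite _ p q => p.flat && q.flat
  | loop _ _ => false
  | _ => true

theorem exec_run (p : Program) (hp : p.flat = true) (σ : State) :
    ∃ t ≤ p.flatCost, Exec p σ t (p.run σ) := by
  induction p generalizing σ with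
  | skip => exact ⟨_, le_rfl, .skip σ⟩
  | setNat x e => exact ⟨_, le_rfl, .setNat σ x e⟩
  | setReal x e => exact ⟨_, le_rfl, .setReal σ x e⟩
  | storeNat a i e => exact ⟨_, le_rfl, .storeNat σ a i e⟩
  | storeReal a i e => exact ⟨_, le_rfl, .storeReal σ a i e⟩
  | seq p q ihp ihq =>
    simp only [flat, Bool.and_eq_true] at hp
    obtain ⟨t₁, h₁, e₁⟩ := ihp hp.1 σ
    obtain ⟨t₂, h₂, e₂⟩ := ihq hp.2 (p.run σ)
    exact ⟨_, Nat.add_le_add h₁ h₂, .seq e₁ e₂⟩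
  | ite b p q ihp ihq =>
    simp only [flat, Bool.and_eq_true] at hp
    by_cases hb : b.eval σ
    · obtain ⟨t, h, e⟩ := ihp hp.1 σ
      refine ⟨b.cost + 1 + t, by simp only [flatCost]; omega, ?_⟩
      simp only [run, if_pos hb]
      exact .iteTrue hb e
    · obtain ⟨t, h, e⟩ := ihq hp.2 σ
      refine ⟨b.cost + 1 + t, by simp only [flatCost]; omega, ?_⟩
      simp only [run, if_neg hb]
      exact .iteFalse hb e
  | loop b p => simp [flat] at hp

/-- The loop in which the variable `i` runs through the numbers below the variable `0`. -/
def forLoop (i : ℕ) (body : Program) : Program :=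
  .seq (.setNat i (.const 0))
    (.loop (.not (.natLe (.var 0) (.var i)))
      (.seq body (.setNat i (.add (.var i) (.const 1)))))

end Program

theorem Runs.flat {p : Program} {σ : State} {T : ℕ} {Post : State → Prop} (hp : p.flat = true)
    (hT : p.flatCost ≤ T) (h : Post (p.run σ)) : Runs p σ T Post := by
  obtain ⟨t, ht, he⟩ := p.exec_run hp σ
  exact ⟨t, _, he, ht.trans hT, h⟩

/-- A counting loop with an invariant: `Inv k` has to hold when the counter has the value `k`. -/
theorem Runs.forLoop {i n T T' : ℕ} {body : Program} {σ : State} (Inv : ℕ → State → Prop)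
    {Post : State → Prop} (hi : i ≠ 0) (hn : σ.natVar 0 = n) (h0 : 0 ∉ body.natVars)
    (hib : i ∉ body.natVars) (hinit : Inv 0 (σ.setNat i 0))
    (hbody : ∀ k < n, ∀ τ, τ.natVar i = k → τ.natVar 0 = n → Inv k τ →
      Runs body τ T fun τ' => Inv (k + 1) (τ'.setNat i (k + 1)))
    (hpost : ∀ τ, Inv n τ → Post τ) (hT : n * (T + 9) + 7 ≤ T') :
    Runs (Program.forLoop i body) σ T' Post := by
  have key : ∀ m k τ, k + m = n → τ.natVar i = k → τ.natVar 0 = n → Inv k τ →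
      Runs (.loop (.not (.natLe (.var 0) (.var i)))
        (.seq body (.setNat i (.add (.var i) (.const 1))))) τ (m * (T + 9) + 5) Post := by
    intro m
    induction m with
    | zero =>
      intro k τ hk hki hk0 hinv
      refine Runs.loopDone ?_ ?_ (hpost τ ?_)
      · simp only [BExp.eval, NExp.eval, not_not]; omega
      · simp [BExp.cost, NExp.cost]
      · rw [← hk]; simpa using hinv
    | succ m ih =>
      intro k τ hk hki hk0 hinv
      refine Runs.loopStep (T₁ := T + 4) (T₂ := m * (T + 9) + 5)
        (Mid := fun τ' => τ'.natVar i = k + 1 ∧ τ'.natVar 0 = n ∧ Inv (k + 1) τ') ?_ ?_ ?_ ?_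
      · simp only [BExp.eval, NExp.eval]; omega
      · refine Runs.seq (hbody k (by omega) τ hki hk0 hinv) (T₂ := 4) ?_ le_rfl
        intro τ' hf hinv'
        refine Runs.setNat (by simp [NExp.cost]) ?_
        have e1 : τ'.natVar i = k := by rw [hf.natVar i hib, hki]
        have e2 : τ'.natVar 0 = n := by rw [hf.natVar 0 h0, hk0]
        simp only [NExp.eval, e1]
        refine ⟨by simp [State.setNat], ?_, hinv'⟩
        simp [State.setNat, Function.update_of_ne hi.symm, e2]
      · rintro τ' - ⟨g1, g2, g3⟩
        exact ih (k + 1) τ' (by omega) g1 g2 g3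
      · simp only [BExp.cost, NExp.cost]
        rw [Nat.succ_mul]; omega
  refine Runs.seq (T₁ := 2) (Mid := fun τ => τ.natVar i = 0 ∧ τ.natVar 0 = n ∧ Inv 0 τ) ?_ ?_
    (T₂ := n * (T + 9) + 5) (by omega)
  · refine Runs.setNat (by simp [NExp.cost]) ⟨?_, ?_, hinit⟩
    · simp [State.setNat, NExp.eval]
    · simp [State.setNat, Function.update_of_ne hi.symm, hn]
  · rintro τ - ⟨g1, g2, g3⟩
    exact key n 0 τ (by omega) g1 g2 g3

/-! ### Acyclicity -/

/-- The elements of `l` have been removed in this order, each at a time when nothing that remained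
had to precede it. -/
structure IsRemovalList {n : ℕ} (E : Fin n → Fin n → Prop) (l : List (Fin n)) : Prop where
  nodup : l.Nodup
  pairwise : l.Pairwise fun x y => ¬ E y x
  closed : ∀ a ∉ l, ∀ b ∈ l, ¬ E a b

namespace IsRemovalList

variable {n : ℕ} {E : Fin n → Fin n → Prop} {l : List (Fin n)}

theorem nil : IsRemovalList E [] := ⟨List.nodup_nil, .nil, by simp⟩

theorem concat (h : IsRemovalList E l) {i : Fin n} (hi : i ∉ l) (hii : ¬ E i i)
    (hE : ∀ a ∉ l, ¬ E a i) : IsRemovalList E (l ++ [i]) := by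
  refine ⟨?_, ?_, ?_⟩
  · rw [List.nodup_append]
    exact ⟨h.nodup, by simp, by rintro a ha b hb rfl; simp at hb; exact hi (hb ▸ ha)⟩
  · rw [List.pairwise_append]
    refine ⟨h.pairwise, by simp, ?_⟩
    intro a ha b hb
    rw [List.mem_singleton] at hb
    subst hb
    exact h.closed b hi a ha
  · intro a ha b hb
    simp only [List.mem_append, List.mem_singleton, not_or] at ha hb
    rcases hb with hb | rfl
    · exact h.closed a ha.1 b hb
    · exact hE a ha.1

theorem length_le (h : IsRemovalList E l) : l.length ≤ n := by
  simpa using h.nodup.length_le_card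

theorem exists_order (h : IsRemovalList E l) (hl : l.length = n) :
    ∃ π : Equiv.Perm (Fin n), ∀ i j, i < j → ¬ E (π j) (π i) := by
  let f : Fin n → Fin n := fun k => l.get (k.cast hl.symm)
  have hf : Function.Injective f := fun x y hxy => by
    have := (List.nodup_iff_injective_get.1 h.nodup) hxy
    simpa [Fin.ext_iff] using this
  refine ⟨Equiv.ofBijective f hf.bijective_of_finite, fun i j hij => ?_⟩
  exact List.pairwise_iff_get.1 h.pairwise _ _ hij

/-- If everything that remains has a predecessor that remains, there is no order. -/
theorem not_exists_order (hl : l.length < n) (hirr : ∀ i, ¬ E i i)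
    (hE : ∀ i ∉ l, ∃ a ∉ l, E a i) :
    ¬ ∃ π : Equiv.Perm (Fin n), ∀ i j, i < j → ¬ E (π j) (π i) := by
  rintro ⟨π, hπ⟩
  have hall : ∀ k, π k ∈ l := by
    intro k
    induction k using WellFoundedLT.induction with
    | _ k ih =>
      by_contra hk
      obtain ⟨a, ha, hak⟩ := hE _ hk
      obtain ⟨j, rfl⟩ := π.surjective a
      rcases lt_trichotomy j k with h | rfl | h
      · exact ha (ih j h)
      · exact hirr _ hak
      · exact hπ k j h hak
  have : (Finset.univ : Finset (Fin n)) ⊆ l.toFinset := by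
    intro i _
    obtain ⟨k, rfl⟩ := π.surjective i
    exact List.mem_toFinset.2 (hall k)
  have := (Finset.card_le_card this).trans (List.toFinset_card_le l)
  simp at this
  omega

end IsRemovalList

/-! ### Access to the input -/

/-- A program that changes neither the number of pairs nor the input arrays. -/
def Program.KeepsInput (p : Program) : Prop :=
  0 ∉ p.natVars ∧ (∀ a < 6, a ∉ p.natArrs) ∧ p.noRealStore = true

instance (p : Program) : Decidable p.KeepsInput := by
  unfold Program.KeepsInput; infer_instance

/-- The parts of two memory states that belong to the input coincide. -/
structure SameInput (σ σ' : State) : Prop where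
  size : σ'.natVar 0 = σ.natVar 0
  natArr : ∀ a < 6, σ'.natArr a = σ.natArr a
  realArr : σ'.realArr = σ.realArr

theorem Frame.sameInput {p : Program} {σ σ' : State} (h : Frame p σ σ') (hp : p.KeepsInput) :
    SameInput σ σ' :=
  ⟨h.natVar 0 hp.1, fun a ha => h.natArr a (hp.2.1 a ha), h.realArr hp.2.2⟩

theorem SameInput.storesPoint {σ σ' : State} (h : SameInput σ σ') {flag x y c : ℕ}
    (hf : flag < 6) {o : Option Plane} (hs : StoresPoint σ flag x y c o) :
    StoresPoint σ' flag x y c o := by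
  cases o <;> simpa only [StoresPoint, h.natArr flag hf, h.realArr] using hs

/-- The search trees lie in the arrays that are kept. -/
theorem SameInput.storesTree {σ σ' : State} (h : SameInput σ σ') {t : BinaryTree Arc} {c : ℕ}
    (hs : StoresTree σ t c) : StoresTree σ' t c := by
  induction t generalizing c with
  | nil => exact hs
  | node a l r ihl ihr =>
    obtain ⟨h0, hlo, hhi, hl, hr⟩ := hs
    refine ⟨h0, h.storesPoint (by norm_num) hlo, h.storesPoint (by norm_num) hhi, ?_, ?_⟩
    · rw [h.natArr 2 (by norm_num)]; exact ihl hl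
    · rw [h.natArr 3 (by norm_num)]; exact ihr hr

theorem HoldsInput.of_sameInput {n : ℕ} {I : Instance n} {σ σ' : State} (hI : HoldsInput I σ)
    (h : SameInput σ σ') : HoldsInput I σ' := by
  obtain ⟨h0, harr, ht⟩ := hI
  refine ⟨h.size.trans h0, ?_, ?_⟩
  · rw [h.realArr, h.natArr 0 (by norm_num)]; exact harr
  · intro A B k hAB
    obtain ⟨t, h1, h2⟩ := ht A B k hAB
    rw [h.natArr 1 (by norm_num)]
    exact ⟨t, h1, h.storesTree h2⟩

theorem HoldsInput.frame {n : ℕ} {I : Instance n} {σ σ' : State} {p : Program}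
    (hI : HoldsInput I σ) (h : Frame p σ σ') (hp : p.KeepsInput) : HoldsInput I σ' :=
  hI.of_sameInput (h.sameInput hp)

theorem HoldsInput.setNat {n : ℕ} {I : Instance n} {σ : State} (hI : HoldsInput I σ) {x : ℕ}
    (hx : x ≠ 0) (v : ℕ) : HoldsInput I (σ.setNat x v) :=
  hI.of_sameInput ⟨Function.update_of_ne hx.symm _ _, fun _ _ => rfl, rfl⟩

/-! ### The program: tests and coordinates -/

/-!
Natural-number variables: `0` the number of pairs, `1` and `2` the pair `(A, B)`, `3` the index of
its first vippodrome in the table of roots, `4` the node visited in a tree, `5` whether a valid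
translation has been found, `6` the number of pairs removed and `7` the number of rounds in the test
of the origin, `8` whether `A` has to precede `B`. Natural-number arrays: `6` which pairs have been
removed, `7` the number of their remaining predecessors.

Real variables: `0` and `1` the best translation found, `2` and `3` the axis of a vippodrome, `4`
and `5` its offset, `6` the length `r` of the axis, `7` the number `√(r² - 4)`, `8` and `9` the
coordinates of the origin along and across the axis, `10` a position, `11` and `12` the boundary
point in this position, `13` the value of `Instance.pos` there.
-/

/-- The test `e₁ < e₂`. -/
def BExp.lt (e₁ e₂ : RExp) : BExp := .not (.realLe e₂ e₁)

/-- The disjunction of two tests. -/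
def BExp.or (b₁ b₂ : BExp) : BExp := .not (.and (.not b₁) (.not b₂))

theorem BExp.eval_lt (σ : State) (e₁ e₂ : RExp) :
    (BExp.lt e₁ e₂).eval σ ↔ e₁.eval σ < e₂.eval σ := by simp [BExp.lt, BExp.eval]

theorem BExp.eval_or (σ : State) (b₁ b₂ : BExp) :
    (BExp.or b₁ b₂).eval σ ↔ b₁.eval σ ∨ b₂.eval σ := by
  simp only [BExp.or, BExp.eval]; tauto

/-- The test whether the variables `1` and `2` differ. -/
def neq : BExp := .not (.and (.natLe (.var 1) (.var 2)) (.natLe (.var 2) (.var 1)))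

theorem eval_neq (σ : State) : neq.eval σ ↔ σ.natVar 1 ≠ σ.natVar 2 := by
  simp only [neq, BExp.eval, NExp.eval]; omega

/-- Loads the axis and the offset of the vippodrome `k` of the pair `(A, B)`. -/
def loadAxis : Fin 2 → Program
  | 0 =>
    .seq (.setReal 2 (.sub (.load 0 (.var 1)) (.load 0 (.var 2)))) <|
    .seq (.setReal 3 (.sub (.load 1 (.var 1)) (.load 1 (.var 2)))) <|
    .seq (.setReal 4 (.sub (.load 2 (.load 0 (.var 2))) (.load 0 (.var 2)))) <|
    .setReal 5 (.sub (.load 3 (.load 0 (.var 2))) (.load 1 (.var 2)))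
  | 1 =>
    .seq (.setReal 2 (.sub (.load 2 (.load 0 (.var 1))) (.load 2 (.load 0 (.var 2))))) <|
    .seq (.setReal 3 (.sub (.load 3 (.load 0 (.var 1))) (.load 3 (.load 0 (.var 2))))) <|
    .seq (.setReal 4 (.sub (.load 2 (.load 0 (.var 1))) (.load 0 (.var 1)))) <|
    .setReal 5 (.sub (.load 3 (.load 0 (.var 1))) (.load 1 (.var 1)))

/-- Computes the coordinates of the origin. -/
def loadCoords : Program :=
  .seq (.setReal 6 (.sqrt (.add (.mul (.var 2) (.var 2)) (.mul (.var 3) (.var 3))))) <|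
  .seq (.setReal 7 (.sqrt (.sub (.mul (.var 6) (.var 6)) (.const 4)))) <|
  .seq (.setReal 8 (.div (.add (.mul (.var 2) (.var 4)) (.mul (.var 3) (.var 5))) (.var 6))) <|
  .setReal 9 (.div (.sub (.mul (.var 2) (.var 5)) (.mul (.var 3) (.var 4))) (.var 6))

/-- The real variables `2` to `9` describe the vippodrome `(A, B, k)`. -/
structure HasCoords {n : ℕ} (I : Instance n) (A B : Fin n) (k : Fin 2) (σ : State) : Prop where
  axis0 : σ.realVar 2 = I.axis A B k 0
  axis1 : σ.realVar 3 = I.axis A B k 1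
  offset0 : σ.realVar 4 = I.offset A B k 0
  offset1 : σ.realVar 5 = I.offset A B k 1
  radius : σ.realVar 6 = ‖I.axis A B k‖
  slope : σ.realVar 7 = √(‖I.axis A B k‖ ^ 2 - 4)
  along : σ.realVar 8 = along (I.axis A B k) (I.offset A B k) 0
  across : σ.realVar 9 = across (I.axis A B k) (I.offset A B k) 0

theorem HasCoords.frame {n : ℕ} {I : Instance n} {A B : Fin n} {k : Fin 2} {σ σ' : State}
    {p : Program} (h : HasCoords I A B k σ) (hf : Frame p σ σ')
    (hp : ∀ x ∈ p.realVars, x ∉ Finset.Icc 2 9) : HasCoords I A B k σ' := by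
  have key : ∀ x ∈ Finset.Icc 2 9, σ'.realVar x = σ.realVar x :=
    fun x hx => hf.realVar x fun h' => hp x h' hx
  obtain ⟨h2, h3, h4, h5, h6, h7, h8, h9⟩ := h
  constructor <;> rw [key _ (by decide)] <;> assumption

/-- Loads the description of the vippodrome `k` of the pair `(A, B)`. -/
def setup (k : Fin 2) : Program := .seq (loadAxis k) loadCoords

theorem runs_setup {n : ℕ} {I : Instance n} {A B : Fin n} {σ : State} (hI : HoldsInput I σ)
    (hA : σ.natVar 1 = A) (hB : σ.natVar 2 = B) (k : Fin 2) :
    Runs (setup k) σ 100 (HasCoords I A B k) := by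
  have hax : Runs (loadAxis k) σ 40 fun σ' => σ'.realVar 2 = I.axis A B k 0 ∧
      σ'.realVar 3 = I.axis A B k 1 ∧ σ'.realVar 4 = I.offset A B k 0 ∧
      σ'.realVar 5 = I.offset A B k 1 := by
    obtain ⟨-, harr, -⟩ := hI
    obtain ⟨a0, a1, -, -, a4⟩ := harr A
    obtain ⟨b0, b1, -, -, b4⟩ := harr B
    obtain ⟨-, -, a2, a3, -⟩ := harr (I.M A)
    obtain ⟨-, -, b2, b3, -⟩ := harr (I.M B)
    fin_cases k
    · refine Runs.flat rfl (by decide) ?_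
      simp [loadAxis, Program.run, State.setReal, RExp.eval, NExp.eval, Instance.axis,
        Instance.offset, Instance.src, Instance.tgt, *]
    · refine Runs.flat rfl (by decide) ?_
      simp [loadAxis, Program.run, State.setReal, RExp.eval, NExp.eval, Instance.axis,
        Instance.offset, Instance.src, Instance.tgt, *]
  refine Runs.seq hax (T₂ := 60) ?_ (by norm_num)
  rintro τ - ⟨h2, h3, h4, h5⟩
  refine Runs.flat rfl (by decide) ?_
  constructor <;>
    simp [loadCoords, Program.run, State.setReal, RExp.eval, h2, h3, h4, h5, norm_plane, along,
      across, sq]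

/-- The test whether the origin lies in the vippodrome described by the real variables. -/
def originTest : BExp :=
  .and (BExp.lt (.mul (.var 7) (.var 9)) (.mul (.const 2) (.var 8))) <|
  .and (BExp.lt (.sub (.const 0) (.mul (.var 7) (.var 9))) (.mul (.const 2) (.var 8))) <|
  BExp.or
    (BExp.lt (.add (.mul (.sub (.var 8) (.var 6)) (.sub (.var 8) (.var 6)))
      (.mul (.var 9) (.var 9))) (.const 4))
    (BExp.lt (.sub (.mul (.var 6) (.var 6)) (.const 4)) (.mul (.var 6) (.var 8)))

theorem eval_originTest {n : ℕ} {I : Instance n} {A B : Fin n} {k : Fin 2} {σ : State}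
    (hAB : A ≠ B) (h : HasCoords I A B k σ) : originTest.eval σ ↔ 0 ∈ I.vippodrome A B k := by
  rw [I.vippodrome_eq_shadow, mem_shadow_iff (I.two_le_norm_axis hAB k),
    front_lt_iff (I.two_le_norm_axis hAB k)]
  simp only [originTest, BExp.eval, BExp.eval_lt, BExp.eval_or, RExp.eval, h.radius, h.slope,
    h.along, h.across, sq, Nat.cast_ofNat, Nat.cast_zero, zero_sub]

/-- Sets the variable `8` to `1` or `0`, as the pair `A` has to precede the pair `B` for the
translation `0` or not. -/
def edge : Program :=
  .seq (.setNat 8 (.const 0)) <| .ite neq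
    (.seq (setup 0) <| .seq (.ite originTest (.setNat 8 (.const 1)) .skip) <|
      .seq (setup 1) <| .ite originTest (.setNat 8 (.const 1)) .skip)
    .skip

theorem runs_edge {n : ℕ} {I : Instance n} {A B : Fin n} {σ : State} (hI : HoldsInput I σ)
    (hA : σ.natVar 1 = A) (hB : σ.natVar 2 = B) :
    Runs edge σ 400 fun σ' =>
      σ'.natVar 8 = by classical exact if I.Precedes 0 A B then 1 else 0 := by
  classical
  refine Runs.seq (T₁ := 2) (Mid := fun τ => τ.natVar 8 = 0) (T₂ := 390)
    (Runs.setNat (by decide) (by simp [State.setNat, NExp.eval])) ?_ (by norm_num)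
  intro τ hf h8
  have hI := hI.frame hf (by decide)
  have hA : τ.natVar 1 = A := by rw [hf.natVar 1 (by decide), hA]
  have hB : τ.natVar 2 = B := by rw [hf.natVar 2 (by decide), hB]
  refine Runs.ite (T₁ := 370) ?_ ?_ (by decide)
  · rw [eval_neq, hA, hB]
    intro hne
    have hAB : A ≠ B := fun h => hne (by rw [h])
    have test : ∀ k (τ : State), HasCoords I A B k τ →
        Runs (.ite originTest (.setNat 8 (.const 1)) .skip) τ 70 fun τ' =>
          τ'.natVar 8 = if 0 ∈ I.vippodrome A B k then 1 else τ.natVar 8 := by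
      intro k τ hc
      refine Runs.ite (T₁ := 2) ?_ ?_ (by decide)
      · intro h
        rw [eval_originTest hAB hc] at h
        refine Runs.setNat (by decide) ?_
        simp [State.setNat, NExp.eval, h]
      · intro h
        rw [eval_originTest hAB hc] at h
        exact (Runs.skip (by simp [h])).mono (by norm_num) fun _ _ h => h
    refine Runs.seq (runs_setup hI hA hB 0) (T₂ := 250) ?_ (by norm_num)
    intro τ₁ hf₁ hc₁
    refine Runs.seq (test 0 τ₁ hc₁) (T₂ := 180) ?_ (by norm_num)
    intro τ₂ hf₂ h₂
    have hI₂ := (hI.frame hf₁ (by decide)).frame hf₂ (by decide)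
    refine Runs.seq (runs_setup (A := A) (B := B) hI₂ ?_ ?_ 1) (T₂ := 80) ?_ (by norm_num)
    · rw [hf₂.natVar 1 (by decide), hf₁.natVar 1 (by decide), hA]
    · rw [hf₂.natVar 2 (by decide), hf₁.natVar 2 (by decide), hB]
    intro τ₃ hf₃ hc₃
    refine (test 1 τ₃ hc₃).mono (by norm_num) ?_
    intro τ₄ _ h₄
    rw [h₄, hf₃.natVar 8 (by decide), h₂, hf₁.natVar 8 (by decide), h8]
    simp only [Instance.Precedes, Fin.exists_fin_two, hAB, ne_eq, not_false_eq_true, true_and]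
    split_ifs <;> simp_all
  · rw [eval_neq, hA, hB]
    intro hne
    have hAB : A = B := Fin.ext (not_not.1 hne)
    refine (Runs.skip ?_).mono (by norm_num) fun _ _ h => h
    rw [h8, if_neg fun h => h.1 hAB]

/-! ### The program: is the origin a valid translation? -/

/-- The entry of the variable `x` in the natural-number array `a`. -/
def NExp.at (a x : ℕ) : NExp := .load a (.var x)

/-- Marks every pair as remaining, and counts the pairs that have to precede it. -/
def countPredecessors : Program :=
  Program.forLoop 2 <|
    .seq (.storeNat 6 (.var 2) (.const 0)) <|
    .seq (.storeNat 7 (.var 2) (.const 0)) <|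
    Program.forLoop 1 <| .seq edge (.storeNat 7 (.var 2) (.add (.at 7 2) (.var 8)))

/-- The test whether the pair in the variable `1` can be removed. -/
def removable : BExp := .and (.natLe (.at 6 1) (.const 0)) (.natLe (.at 7 1) (.const 0))

/-- Finds the first pair that can be removed. -/
def search : Program :=
  .seq (.setNat 1 (.const 0)) <|
    .loop (.and (.not (.natLe (.var 0) (.var 1))) (.not removable))
      (.setNat 1 (.add (.var 1) (.const 1)))

/-- Removes the pair in the variable `1`. -/
def remove : Program :=
  .seq (.storeNat 6 (.var 1) (.const 1)) <|
  .seq (.setNat 6 (.add (.var 6) (.const 1))) <|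
  Program.forLoop 2 <| .seq edge (.storeNat 7 (.var 2) (.sub (.at 7 2) (.var 8)))

/-- Removes as many pairs as possible, each after all pairs that have to precede it. -/
def removeAll : Program :=
  .seq countPredecessors <| .seq (.setNat 6 (.const 0)) <|
    Program.forLoop 7 <| .seq search <| .ite (.not (.natLe (.var 0) (.var 1))) remove .skip

section

variable {n : ℕ} (I : Instance n)

open Classical in
/-- The number of pairs outside of `l` that have to precede `B`. -/
noncomputable def remainingPredecessors (l : List (Fin n)) (B : Fin n) : ℕ :=
  (Finset.univ.filter fun A => A ∉ l ∧ I.Precedes 0 A B).card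

open Classical in
/-- The memory describes the situation after the removal of `l`. -/
structure HasRemoved (l : List (Fin n)) (σ : State) : Prop where
  mark : ∀ B : Fin n, σ.natArr 6 B = if B ∈ l then 1 else 0
  degree : ∀ B : Fin n, σ.natArr 7 B = remainingPredecessors I l B

variable {I}

theorem HasRemoved.congr {l : List (Fin n)} {σ σ' : State} (h : HasRemoved I l σ)
    (h6 : σ'.natArr 6 = σ.natArr 6) (h7 : σ'.natArr 7 = σ.natArr 7) : HasRemoved I l σ' :=
  ⟨by rw [h6]; exact h.mark, by rw [h7]; exact h.degree⟩

theorem runs_countPredecessors {σ : State} (hI : HoldsInput I σ) :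
    Runs countPredecessors σ (n * (n * 500 + 500) + 10) (HasRemoved I []) := by
  classical
  refine Runs.forLoop (T := n * 450 + 50) (n := n) (fun k τ => HoldsInput I τ ∧
      ∀ B : Fin n, B < k → τ.natArr 6 B = 0 ∧ τ.natArr 7 B = remainingPredecessors I [] B)
    (by norm_num) hI.1 (by decide) (by decide) ⟨hI.setNat (by norm_num) _, by simp⟩ ?_ ?_ ?_
  · rintro k hk τ h2 h0 ⟨hI, hinv⟩
    refine Runs.seq (T₁ := 3) (Mid := fun τ' => τ'.natArr 6 = Function.update (τ.natArr 6) k 0)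
      (Runs.storeNat (by decide) (by simp [State.storeNat, NExp.eval, h2])) (T₂ := n * 450 + 40)
      ?_ (by omega)
    intro τ₁ hf₁ h6
    refine Runs.seq (T₁ := 3) (Mid := fun τ' => τ'.natArr 7 = Function.update (τ.natArr 7) k 0)
      (Runs.storeNat (by decide) ?_) (T₂ := n * 450 + 30) ?_ (by omega)
    · simp [State.storeNat, NExp.eval, hf₁.natVar 2 (by decide), h2, hf₁.natArr 7 (by decide)]
    intro τ₂ hf₂ h7
    have hI₂ := (hI.frame hf₁ (by decide)).frame hf₂ (by decide)
    have h2' : τ₂.natVar 2 = k := by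
      rw [hf₂.natVar 2 (by decide), hf₁.natVar 2 (by decide), h2]
    have h6' : τ₂.natArr 6 = Function.update (τ.natArr 6) k 0 := by
      rw [hf₂.natArr 6 (by decide), h6]
    refine Runs.forLoop (T := 410) (n := n) (fun m υ => HoldsInput I υ ∧ υ.natVar 2 = k ∧
        υ.natArr 6 = Function.update (τ.natArr 6) k 0 ∧
        υ.natArr 7 = Function.update (τ.natArr 7) k
          (Finset.univ.filter fun A : Fin n => A < m ∧ I.Precedes 0 A ⟨k, hk⟩).card)
      (by norm_num) hI₂.1 (by decide) (by decide) ?_ ?_ ?_ (by omega)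
    · exact ⟨hI₂.setNat (by norm_num) _, h2', h6', by simpa [State.setNat] using h7⟩
    · rintro m hm υ g1 g0 ⟨gI, g2, g6, g7⟩
      refine Runs.seq (runs_edge (A := ⟨m, hm⟩) (B := ⟨k, hk⟩) gI g1 g2) (T₂ := 6) ?_ (by norm_num)
      intro υ' hf' g8
      refine Runs.storeNat (by decide) ?_
      have e2 : υ'.natVar 2 = k := by rw [hf'.natVar 2 (by decide), g2]
      have e7 := hf'.natArr 7 (by decide)
      refine ⟨?_, ?_, ?_, ?_⟩
      · refine (gI.frame hf' (by decide)).of_sameInput ⟨?_, ?_, rfl⟩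
        · simp [State.setNat, State.storeNat]
        · intro a ha
          simp [State.setNat, State.storeNat, Function.update_of_ne (show a ≠ 7 by omega)]
      · simp [State.setNat, State.storeNat, e2]
      · simp [State.setNat, State.storeNat, hf'.natArr 6 (by decide), g6]
      · have hcard : (Finset.univ.filter fun A : Fin n =>
              A < m + 1 ∧ I.Precedes 0 A ⟨k, hk⟩).card =
            (Finset.univ.filter fun A : Fin n => A < m ∧ I.Precedes 0 A ⟨k, hk⟩).card +
              if I.Precedes 0 ⟨m, hm⟩ ⟨k, hk⟩ then 1 else 0 := by
          split_ifs with hp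
          · rw [← Finset.card_insert_of_notMem (a := (⟨m, hm⟩ : Fin n)) (by simp)]
            congr 1
            ext A
            simp only [Finset.mem_filter, Finset.mem_univ, true_and, Finset.mem_insert]
            constructor
            · rintro ⟨h1, h2⟩
              rcases Nat.lt_succ_iff_lt_or_eq.1 h1 with h | h
              · exact Or.inr ⟨h, h2⟩
              · exact Or.inl (Fin.ext h)
            · rintro (rfl | ⟨h1, h2⟩)
              · exact ⟨Nat.lt_succ_self _, hp⟩
              · exact ⟨by omega, h2⟩
          · rw [add_zero]
            congr 1
            ext A
            simp only [Finset.mem_filter, Finset.mem_univ, true_and]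
            constructor
            · rintro ⟨h1, h2⟩
              rcases Nat.lt_succ_iff_lt_or_eq.1 h1 with h | h
              · exact ⟨h, h2⟩
              · exact absurd h2 (by rwa [show A = ⟨m, hm⟩ from Fin.ext h])
            · rintro ⟨h1, h2⟩
              exact ⟨by omega, h2⟩
        rw [hcard]
        simp [State.setNat, State.storeNat, NExp.eval, NExp.at, e2, e7, g7, g8]
    · rintro υ ⟨gI, g2, g6, g7⟩
      refine ⟨gI.setNat (by norm_num) _, fun B hB => ?_⟩
      simp only [State.setNat, g6, g7]
      rcases Nat.lt_succ_iff_lt_or_eq.1 hB with h | h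
      · rw [Function.update_of_ne h.ne, Function.update_of_ne h.ne]
        exact hinv B h
      · subst h
        simp [remainingPredecessors]
  · rintro τ ⟨-, h⟩
    exact ⟨fun B => by simp [(h B B.2).1], fun B => (h B B.2).2⟩
  · exact Nat.add_le_add (Nat.mul_le_mul_left n (by omega)) (by norm_num)

/-- A pair is removable if it is left and has no predecessor among those left. -/
theorem eval_removable {l : List (Fin n)} {σ : State} (h : HasRemoved I l σ) {A : Fin n}
    (hA : σ.natVar 1 = A) :
    removable.eval σ ↔ A ∉ l ∧ ∀ B ∉ l, ¬ I.Precedes 0 B A := by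
  classical
  simp only [removable, BExp.eval, NExp.at, NExp.eval, hA, h.mark, h.degree, Nat.le_zero,
    remainingPredecessors, Finset.card_eq_zero, Finset.filter_eq_empty_iff]
  refine and_congr (by simp) ?_
  simp

/-- The search ends at a pair without remaining predecessors, or beyond the last pair if every
remaining pair has a remaining predecessor. -/
theorem runs_search {l : List (Fin n)} {σ : State} (h0 : σ.natVar 0 = n)
    (h : HasRemoved I l σ) :
    Runs search σ (n * 30 + 30) fun σ' =>
      (∃ A : Fin n, σ'.natVar 1 = A ∧ A ∉ l ∧ ∀ B ∉ l, ¬ I.Precedes 0 B A) ∨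
      (σ'.natVar 1 = n ∧ ∀ A ∉ l, ∃ B ∉ l, I.Precedes 0 B A) := by
  have key : ∀ m k (τ : State), k + m = n → τ.natVar 0 = n → τ.natVar 1 = k →
      HasRemoved I l τ → (∀ A : Fin n, A < k → A ∉ l → ∃ B ∉ l, I.Precedes 0 B A) →
      Runs (.loop (.and (.not (.natLe (.var 0) (.var 1))) (.not removable))
        (.setNat 1 (.add (.var 1) (.const 1)))) τ (m * 30 + 20) fun σ' =>
      (∃ A : Fin n, σ'.natVar 1 = A ∧ A ∉ l ∧ ∀ B ∉ l, ¬ I.Precedes 0 B A) ∨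
      (σ'.natVar 1 = n ∧ ∀ A ∉ l, ∃ B ∉ l, I.Precedes 0 B A) := by
    intro m
    induction m with
    | zero =>
      intro k τ hk h0 h1 hR hinv
      refine Runs.loopDone ?_ (by decide) (Or.inr ⟨by omega, fun A hA => hinv A (by omega) hA⟩)
      simp only [BExp.eval, NExp.eval]
      omega
    | succ m ih =>
      intro k τ hk h0 h1 hR hinv
      by_cases hrem : removable.eval τ
      · refine Runs.loopDone ?_ ?_ (Or.inl ⟨⟨k, by omega⟩, h1, ?_⟩)
        · simp only [BExp.eval]; tauto
        · exact le_trans (show _ ≤ 20 by decide) (by omega)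
        · exact (eval_removable (A := ⟨k, by omega⟩) hR h1).1 hrem
      · refine Runs.loopStep (T₁ := 4) (T₂ := m * 30 + 20)
          (Mid := fun τ' => τ'.natVar 1 = k + 1) ?_ ?_ ?_ ?_
        · simp only [BExp.eval, NExp.eval]
          exact ⟨by omega, hrem⟩
        · exact Runs.setNat (by decide) (by simp [State.setNat, NExp.eval, h1])
        · intro τ' hf h1'
          refine ih (k + 1) τ' (by omega) ?_ h1' (hR.congr (hf.natArr 6 (by decide))
            (hf.natArr 7 (by decide))) ?_
          · rw [hf.natVar 0 (by decide), h0]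
          · intro A hA hAl
            rcases Nat.lt_succ_iff_lt_or_eq.1 hA with h | h
            · exact hinv A h hAl
            · by_contra! hcon
              exact hrem ((eval_removable (A := A) hR (by rw [h1, h])).2 ⟨hAl, hcon⟩)
        · rw [Nat.succ_mul]
          have : (BExp.and (.not (.natLe (.var 0) (.var 1))) (.not removable)).cost ≤ 20 := by
            decide
          omega
  refine Runs.seq (T₁ := 2) (Mid := fun τ => τ.natVar 1 = 0)
    (Runs.setNat (by decide) (by simp [State.setNat, NExp.eval])) (T₂ := n * 30 + 20) ?_ (by omega)
  intro τ hf h1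
  refine key n 0 τ (by omega) ?_ h1 (h.congr (hf.natArr 6 (by decide)) (hf.natArr 7 (by decide)))
    (by simp)
  rw [hf.natVar 0 (by decide), h0]

theorem remainingPredecessors_concat {l : List (Fin n)} {A : Fin n} (hA : A ∉ l) (B : Fin n) :
    remainingPredecessors I (l ++ [A]) B = remainingPredecessors I l B -
      (by classical exact if I.Precedes 0 A B then 1 else 0) := by
  classical
  unfold remainingPredecessors
  split_ifs with hp
  · rw [← Finset.card_erase_of_mem (a := A) (by simp [hA, hp])]
    congr 1
    ext C
    simp only [Finset.mem_filter, Finset.mem_univ, true_and, Finset.mem_erase, List.mem_append,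
      List.mem_singleton, not_or]
    tauto
  · rw [Nat.sub_zero]
    congr 1
    ext C
    simp only [Finset.mem_filter, Finset.mem_univ, true_and, List.mem_append,
      List.mem_singleton, not_or]
    constructor
    · rintro ⟨⟨h1, h2⟩, h3⟩; exact ⟨h1, h3⟩
    · rintro ⟨h1, h3⟩
      exact ⟨⟨h1, by rintro rfl; exact hp h3⟩, h3⟩

theorem runs_remove {l : List (Fin n)} {A : Fin n} {σ : State} (hI : HoldsInput I σ)
    (hA : σ.natVar 1 = A) (hAl : A ∉ l) (h : HasRemoved I l σ) :
    Runs remove σ (n * 450 + 30) fun σ' =>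
      HasRemoved I (l ++ [A]) σ' ∧ σ'.natVar 6 = σ.natVar 6 + 1 := by
  classical
  refine Runs.seq (T₁ := 3) (Mid := fun τ' => τ'.natArr 6 = Function.update (σ.natArr 6) A 1)
    (Runs.storeNat (by decide) (by simp [State.storeNat, NExp.eval, hA])) (T₂ := n * 450 + 20)
    ?_ (by omega)
  intro τ₁ hf₁ h6
  refine Runs.seq (T₁ := 4) (Mid := fun τ' => τ'.natVar 6 = σ.natVar 6 + 1)
    (Runs.setNat (by decide) ?_) (T₂ := n * 450 + 10) ?_ (by omega)
  · simp [State.setNat, NExp.eval, hf₁.natVar 6 (by decide)]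
  intro τ₂ hf₂ h6'
  have hI₂ := (hI.frame hf₁ (by decide)).frame hf₂ (by decide)
  have g1 : τ₂.natVar 1 = A := by rw [hf₂.natVar 1 (by decide), hf₁.natVar 1 (by decide), hA]
  have g6 : τ₂.natArr 6 = Function.update (σ.natArr 6) A 1 := by
    rw [hf₂.natArr 6 (by decide), h6]
  have g7 : τ₂.natArr 7 = σ.natArr 7 := by
    rw [hf₂.natArr 7 (by decide), hf₁.natArr 7 (by decide)]
  refine Runs.forLoop (T := 410) (n := n) (fun k υ => HoldsInput I υ ∧ υ.natVar 1 = A ∧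
      υ.natVar 6 = σ.natVar 6 + 1 ∧ υ.natArr 6 = Function.update (σ.natArr 6) A 1 ∧
      ∀ B : Fin n, υ.natArr 7 B = if (B : ℕ) < k then remainingPredecessors I (l ++ [A]) B
        else remainingPredecessors I l B)
    (by norm_num) hI₂.1 (by decide) (by decide) ?_ ?_ ?_ (by omega)
  · refine ⟨hI₂.setNat (by norm_num) _, ?_, ?_, g6, ?_⟩
    · simpa [State.setNat] using g1
    · simpa [State.setNat] using h6'
    · intro B
      simpa [State.setNat, g7] using h.degree B
  · rintro k hk υ u2 u0 ⟨uI, u1, uc, u6, u7⟩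
    refine Runs.seq (runs_edge (A := A) (B := ⟨k, hk⟩) uI u1 u2) (T₂ := 6) ?_ (by norm_num)
    intro υ' hf' u8
    refine Runs.storeNat (by decide) ?_
    have e2 : υ'.natVar 2 = k := by rw [hf'.natVar 2 (by decide), u2]
    have e7 := hf'.natArr 7 (by decide)
    refine ⟨?_, ?_, ?_, ?_, ?_⟩
    · refine (uI.frame hf' (by decide)).of_sameInput ⟨?_, ?_, rfl⟩
      · simp [State.setNat, State.storeNat]
      · intro a ha
        simp [State.setNat, State.storeNat, Function.update_of_ne (show a ≠ 7 by omega)]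
    · simp [State.setNat, State.storeNat, hf'.natVar 1 (by decide), u1]
    · simp [State.setNat, State.storeNat, hf'.natVar 6 (by decide), uc]
    · simp [State.setNat, State.storeNat, hf'.natArr 6 (by decide), u6]
    · intro B
      simp only [State.setNat, State.storeNat, NExp.eval, NExp.at, e2, e7, u8,
        Function.update_self]
      by_cases hB : (B : ℕ) = k
      · subst hB
        rw [Function.update_self, u7, if_neg (lt_irrefl _), if_pos (Nat.lt_succ_self _),
          remainingPredecessors_concat hAl]
      · rw [Function.update_of_ne hB, u7]
        by_cases hlt : (B : ℕ) < k
        · rw [if_pos hlt, if_pos (by omega)]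
        · rw [if_neg hlt, if_neg (by omega)]
  · rintro υ ⟨-, -, uc, u6, u7⟩
    refine ⟨⟨fun B => ?_, fun B => ?_⟩, uc⟩
    · rw [u6]
      by_cases hB : B = A
      · subst hB; simp
      · rw [Function.update_of_ne (by simpa [Fin.ext_iff] using hB), h.mark]
        simp [hB]
    · rw [u7, if_pos B.2]

/-- There are as many rounds as pairs. Either a pair is removed in every round and the removal order
is an itinerary, or the process gets stuck at a set of pairs that cannot be ordered. -/
theorem runs_removeAll {σ : State} (hI : HoldsInput I σ) :
    Runs removeAll σ (n * (n * 1000 + 1000) + 50) fun σ' =>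
      σ'.natVar 6 ≤ n ∧ (σ'.natVar 6 = n ↔ 0 ∈ I.Q) := by
  have hirr : ∀ A, ¬ I.Precedes 0 A A := fun A h => h.1 rfl
  refine Runs.seq (runs_countPredecessors hI) (T₂ := n * (n * 480 + 120) + 10) ?_ ?_
  · intro τ hf hR
    have hI := hI.frame hf (by decide)
    refine Runs.seq (T₁ := 2) (Mid := fun τ' => τ'.natVar 6 = 0)
      (Runs.setNat (by decide) (by simp [State.setNat, NExp.eval]))
      (T₂ := n * (n * 480 + 120) + 7) ?_ (by omega)
    intro τ₁ hf₁ h6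
    have hI₁ := hI.frame hf₁ (by decide)
    have hR₁ := hR.congr (hf₁.natArr 6 (by decide)) (hf₁.natArr 7 (by decide))
    refine Runs.forLoop (T := n * 480 + 100) (n := n) (fun k υ => HoldsInput I υ ∧
        ∃ l, IsRemovalList (I.Precedes 0) l ∧ HasRemoved I l υ ∧ υ.natVar 6 = l.length ∧
        (l.length = k ∨ (l.length < k ∧ ∀ A ∉ l, ∃ B ∉ l, I.Precedes 0 B A)))
      (by norm_num) hI₁.1 (by decide) (by decide) ?_ ?_ ?_ ?_
    · exact ⟨hI₁.setNat (by norm_num) _, [], .nil, hR₁.congr rfl rfl,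
        by simpa [State.setNat] using h6, Or.inl rfl⟩
    · rintro k hk υ - u0 ⟨uI, l, hl, uR, u6, hlen⟩
      refine Runs.seq (runs_search u0 uR) (T₂ := n * 450 + 50) ?_ (by omega)
      intro υ₁ hf' hs
      have uI₁ := uI.frame hf' (by decide)
      have uR₁ := uR.congr (hf'.natArr 6 (by decide)) (hf'.natArr 7 (by decide))
      have u6₁ : υ₁.natVar 6 = l.length := by rw [hf'.natVar 6 (by decide), u6]
      refine Runs.ite (T₁ := n * 450 + 30) ?_ ?_ ?_
      · intro hb
        simp only [BExp.eval, NExp.eval, not_le, uI₁.1] at hb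
        rcases hs with ⟨A, hA, hAl, hmin⟩ | ⟨hA, -⟩
        · refine (runs_remove uI₁ hA hAl uR₁).mono le_rfl ?_
          rintro υ₂ hf₂ ⟨uR₂, u6₂⟩
          refine ⟨(uI₁.frame hf₂ (by decide)).setNat (by norm_num) _, l ++ [A],
            hl.concat hAl (hirr A) hmin, uR₂.congr rfl rfl, ?_, ?_⟩
          · simp [State.setNat, u6₂, u6₁]
          · rcases hlen with h | ⟨-, h⟩
            · left; simp [h]
            · obtain ⟨B, hB, hBA⟩ := h A hAl
              exact absurd hBA (hmin B hB)
        · omega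
      · intro hb
        simp only [BExp.eval, NExp.eval, not_le, uI₁.1, not_lt] at hb
        rcases hs with ⟨A, hA, -⟩ | ⟨-, hstuck⟩
        · omega
        · refine (Runs.skip ?_).mono (by omega) fun _ _ h => h
          refine ⟨uI₁.setNat (by norm_num) _, l, hl, uR₁.congr rfl rfl, ?_, Or.inr ⟨?_, hstuck⟩⟩
          · simpa [State.setNat] using u6₁
          · rcases hlen with h | ⟨h, -⟩ <;> omega
      · have : (BExp.not (.natLe (.var 0) (.var 1))).cost = 4 := by decide
        omega
    · rintro υ ⟨-, l, hl, -, u6, hlen⟩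
      refine ⟨u6 ▸ hl.length_le, ?_⟩
      rw [u6, I.mem_Q_iff]
      constructor
      · exact hl.exists_order
      · intro hπ
        rcases hlen with h | ⟨h, hstuck⟩
        · exact h
        · exact absurd hπ (IsRemovalList.not_exists_order h hirr hstuck)
    · exact Nat.add_le_add (Nat.mul_le_mul_left n (by omega)) le_rfl
  · have : n * (n * 500 + 500) + n * (n * 480 + 120) ≤ n * (n * 1000 + 1000) := by
      rw [← Nat.mul_add]; exact Nat.mul_le_mul_left n (by omega)
    linarith

end

/-! ### The program: searching a boundary curve -/

/-- Replaces the best translation found so far by the given point if that is shorter. -/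
def tryPoint (ex ey : RExp) : Program :=
  .ite (BExp.or (.natLe (.var 5) (.const 0))
      (BExp.lt (.add (.mul ex ex) (.mul ey ey))
        (.add (.mul (.var 0) (.var 0)) (.mul (.var 1) (.var 1)))))
    (.seq (.setReal 0 ex) (.seq (.setReal 1 ey) (.setNat 5 (.const 1)))) .skip

/-- The best translation found so far. -/
noncomputable def best (σ : State) : Plane := !₂[σ.realVar 0, σ.realVar 1]

/-- The best translation found so far is valid, if there is one. -/
def Sound {n : ℕ} (I : Instance n) (σ : State) : Prop :=
  σ.natVar 5 = 0 ∨ (σ.natVar 5 = 1 ∧ best σ ∈ I.Q)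

/-- A translation not longer than `x` has been found. -/
def Covers (σ : State) (x : Plane) : Prop := σ.natVar 5 = 1 ∧ ‖best σ‖ ≤ ‖x‖

/-- The progress of the search between two states. -/
structure Improves {n : ℕ} (I : Instance n) (σ σ' : State) : Prop where
  sound : Sound I σ'
  covers : ∀ x, Covers σ x → Covers σ' x

theorem Improves.trans {n : ℕ} {I : Instance n} {σ σ' σ'' : State} (h : Improves I σ σ')
    (h' : Improves I σ' σ'') : Improves I σ σ'' :=
  ⟨h'.sound, fun x hx => h'.covers x (h.covers x hx)⟩

theorem Frame.improves {n : ℕ} {I : Instance n} {p : Program} {σ σ' : State} (h : Frame p σ σ')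
    (hs : Sound I σ) (h5 : 5 ∉ p.natVars) (h0 : 0 ∉ p.realVars) (h1 : 1 ∉ p.realVars) :
    Improves I σ σ' := by
  have e : best σ' = best σ := by simp only [best, h.realVar 0 h0, h.realVar 1 h1]
  refine ⟨?_, fun x hx => ?_⟩
  · simpa only [Sound, e, h.natVar 5 h5] using hs
  · simpa only [Covers, e, h.natVar 5 h5] using hx

theorem runs_tryPoint {n : ℕ} {I : Instance n} {σ : State} {ex ey : RExp} {p : Plane}
    (hs : Sound I σ) (hp : p ∈ I.Q) (hx : ex.eval σ = p 0) (hy : ey.eval σ = p 1)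
    (hy' : ey.eval (σ.setReal 0 (p 0)) = p 1) (hcx : ex.cost ≤ 5) (hcy : ey.cost ≤ 5) :
    Runs (tryPoint ex ey) σ 100 fun σ' => Improves I σ σ' ∧ Covers σ' p := by
  refine Runs.ite (T₁ := 14) ?_ ?_ ?_
  · intro hb
    simp only [BExp.eval_or, BExp.eval_lt, BExp.eval, NExp.eval, RExp.eval, hx, hy] at hb
    refine Runs.seq (T₁ := 6) (Mid := fun τ => τ = σ.setReal 0 (p 0)) (T₂ := 8)
      (Runs.setReal (by omega) (by rw [hx])) ?_ le_rfl
    rintro τ - rfl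
    refine Runs.seq (T₁ := 6) (Mid := fun τ => τ = (σ.setReal 0 (p 0)).setReal 1 (p 1)) (T₂ := 2)
      (Runs.setReal (by omega) (by rw [hy'])) ?_ le_rfl
    rintro τ - rfl
    refine Runs.setNat (by decide) ?_
    have e : best (((σ.setReal 0 (p 0)).setReal 1 (p 1)).setNat 5 1) = p := by
      ext i
      fin_cases i <;> simp [best, State.setReal, State.setNat]
    have e5 : (((σ.setReal 0 (p 0)).setReal 1 (p 1)).setNat 5 1).natVar 5 = 1 := by
      simp [State.setNat]
    simp only [NExp.eval]
    refine ⟨⟨Or.inr ⟨e5, by rwa [e]⟩, fun x hx => ⟨e5, ?_⟩⟩, e5, by rw [e]⟩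
    rw [e]
    refine le_trans ?_ hx.2
    rcases hb with hb | hb
    · have := hx.1; omega
    · rw [norm_plane, norm_plane]
      exact Real.sqrt_le_sqrt (by simpa [best] using hb.le)
  · intro hb
    simp only [BExp.eval_or, BExp.eval_lt, BExp.eval, NExp.eval, RExp.eval, hx, hy, not_or,
      not_lt, not_le] at hb
    refine (Runs.skip ?_).mono (by norm_num) fun _ _ h => h
    have h5 : σ.natVar 5 = 1 := by
      rcases hs with h | h
      · omega
      · exact h.1
    refine ⟨⟨hs, fun _ h => h⟩, h5, ?_⟩
    rw [norm_plane, norm_plane]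
    exact Real.sqrt_le_sqrt (by simpa [best] using hb.2)
  · simp only [BExp.or, BExp.lt, BExp.cost, NExp.cost, RExp.cost]
    omega

/-- The position along the curve of the point stored at the current node. -/
def nodePos (x y : ℕ) : RExp :=
  .sub (.mul (.var 2) (.load y (.var 4))) (.mul (.var 3) (.load x (.var 4)))

/-- Descends in a search tree towards the position in the variable `13`, and tries the nearest
point of every arc on the way. -/
def descend : Program :=
  .loop (.not (.natLe (.var 4) (.const 0))) <|
    .ite (.and (.natLe (.const 1) (.at 4 4)) (BExp.lt (.var 13) (nodePos 4 5)))
      (.seq (tryPoint (.load 4 (.var 4)) (.load 5 (.var 4))) (.setNat 4 (.at 2 4))) <|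
    .ite (.and (.natLe (.const 1) (.at 5 4)) (BExp.lt (nodePos 6 7) (.var 13)))
      (.seq (tryPoint (.load 6 (.var 4)) (.load 7 (.var 4))) (.setNat 4 (.at 3 4)))
      (.seq (tryPoint (.var 11) (.var 12)) (.setNat 4 (.const 0)))

theorem mem_inorder_node {α : Type} {a b : α} {l r : BinaryTree α} :
    b ∈ inorder (.node a l r) ↔ b ∈ inorder l ∨ b = a ∨ b ∈ inorder r := by
  simp [inorder]

/-- The facts on a list of arcs that a search for the point `c` relies on. -/
structure IsSearchable (γ Q : Set Plane) (f : Plane → ℝ) (c : Plane) (l : List Arc) : Prop where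
  lo_mem : ∀ a ∈ l, ∀ p ∈ a.lo, p ∈ γ ∩ Q
  hi_mem : ∀ a ∈ l, ∀ q ∈ a.hi, q ∈ γ ∩ Q
  lo_le_hi : ∀ a ∈ l, ∀ p ∈ a.lo, ∀ q ∈ a.hi, f p ≤ f q
  sep : l.Pairwise fun a b => ∃ q ∈ a.hi, ∃ p ∈ b.lo, f q < f p
  center_mem : ∀ a ∈ l, c ∈ a.carrier γ f → c ∈ Q
  center_curve : c ∈ γ

theorem IsArcList.isSearchable {γ Q : Set Plane} {f : Plane → ℝ} {l : List Arc}
    (h : IsArcList γ Q f l) {c : Plane} (hc : c ∈ γ) : IsSearchable γ Q f c l := by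
  obtain ⟨h1, h2, h3⟩ := h
  have hsub : ∀ a ∈ l, ∀ x ∈ a.carrier γ f, x ∈ γ ∩ Q := fun a ha x hx => by
    rw [← h3]; exact ⟨a, ha, hx⟩
  refine ⟨?_, ?_, fun a ha => (h1 a ha).2.2, h2, fun a ha hca => (hsub a ha c hca).2, hc⟩
  · exact fun a ha p hp => hsub a ha p ⟨(h1 a ha).1 p hp,
      fun p' hp' => by rw [Option.mem_unique hp hp'], fun q hq => (h1 a ha).2.2 p hp q hq⟩
  · exact fun a ha q hq => hsub a ha q ⟨(h1 a ha).2.1 q hq,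
      fun p hp => (h1 a ha).2.2 p hp q hq, fun q' hq' => by rw [Option.mem_unique hq hq']⟩

theorem IsSearchable.sublist {γ Q : Set Plane} {f : Plane → ℝ} {c : Plane} {l l' : List Arc}
    (h : IsSearchable γ Q f c l) (hl : l'.Sublist l) : IsSearchable γ Q f c l' :=
  ⟨fun a ha => h.lo_mem a (hl.subset ha), fun a ha => h.hi_mem a (hl.subset ha),
    fun a ha => h.lo_le_hi a (hl.subset ha), h.sep.sublist hl,
    fun a ha => h.center_mem a (hl.subset ha), h.center_curve⟩

theorem StoresPoint.some {σ : State} {flag x y c : ℕ} {o : Option Plane}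
    (h : StoresPoint σ flag x y c o) (hf : 1 ≤ σ.natArr flag c) :
    ∃ p ∈ o, σ.realArr x c = p 0 ∧ σ.realArr y c = p 1 := by
  cases o with
  | none => simp only [StoresPoint] at h; omega
  | some p => exact ⟨p, rfl, h.2⟩

/-- For every point `x` of an arc in the tree, a point of the curve between the target `c` and `x`
is tried: if the search turns away from the arc of `x` at some node, then the nearest point of the
arc at that node lies between `c` and `x`. -/
theorem runs_descend {n : ℕ} {I : Instance n} {γ : Set Plane} {a c : Plane} (t : BinaryTree Arc) :
    ∀ σ : State, StoresTree σ t (σ.natVar 4) →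
    IsSearchable γ I.Q (fun v => a 0 * v 1 - a 1 * v 0) c (inorder t) → Sound I σ →
    σ.realVar 2 = a 0 → σ.realVar 3 = a 1 → σ.realVar 11 = c 0 → σ.realVar 12 = c 1 →
    σ.realVar 13 = a 0 * c 1 - a 1 * c 0 →
    Runs descend σ (t.height * 200 + 10) fun σ' => Improves I σ σ' ∧
      ∀ x, (∃ b ∈ inorder t, x ∈ b.carrier γ fun v => a 0 * v 1 - a 1 * v 0) →
        ∃ w ∈ γ, a 0 * w 1 - a 1 * w 0 ∈
          Set.uIcc (a 0 * c 1 - a 1 * c 0) (a 0 * x 1 - a 1 * x 0) ∧ Covers σ' w := by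
  set f : Plane → ℝ := fun v => a 0 * v 1 - a 1 * v 0 with hfdef
  have hfv : ∀ v : Plane, a 0 * v 1 - a 1 * v 0 = f v := fun v => rfl
  simp only [hfv]
  clear_value f
  induction t with
  | nil =>
    intro σ ht _ hs _ _ _ _ _
    refine Runs.loopDone ?_ (by decide) ⟨⟨hs, fun _ h => h⟩, by simp [inorder]⟩
    simp only [StoresTree] at ht
    simp [BExp.eval, NExp.eval, ht]
  | node b l r ihl ihr =>
    rintro σ ⟨hne, hlo, hhi, hl, hr⟩ hS hs h2 h3 h11 h12 h13
    have hsl : (inorder l).Sublist (inorder (.node b l r)) := List.sublist_append_left _ _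
    have hsr : (inorder r).Sublist (inorder (.node b l r)) :=
      (List.sublist_cons_self _ _).trans (List.sublist_append_right _ _)
    have hb : b ∈ inorder (.node b l r) := by simp [inorder]
    have hsep := hS.sep
    simp only [inorder, List.pairwise_append, List.pairwise_cons] at hsep
    obtain ⟨-, ⟨hbr, -⟩, hcross⟩ := hsep
    have hbc : (BExp.not (.natLe (.var 4) (.const 0))).eval σ := by
      simp only [BExp.eval, NExp.eval]; omega
    -- the state after one visit, and what the search in the child reached has to do there
    have child : ∀ (t : BinaryTree Arc) (σ₁ : State) (w : Plane),
        (∀ σ : State, StoresTree σ t (σ.natVar 4) → IsSearchable γ I.Q f c (inorder t) →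
          Sound I σ → σ.realVar 2 = a 0 → σ.realVar 3 = a 1 → σ.realVar 11 = c 0 →
          σ.realVar 12 = c 1 → σ.realVar 13 = f c →
          Runs descend σ (t.height * 200 + 10) fun σ' => Improves I σ σ' ∧
            ∀ x, (∃ b ∈ inorder t, x ∈ b.carrier γ f) →
              ∃ w ∈ γ, f w ∈ Set.uIcc (f c) (f x) ∧ Covers σ' w) →
        (∀ x, (∃ b' ∈ inorder (.node b l r), x ∈ b'.carrier γ f) →
          (∃ b' ∈ inorder t, x ∈ b'.carrier γ f) ∨ f w ∈ Set.uIcc (f c) (f x)) →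
        w ∈ γ →
        (inorder t).Sublist (inorder (.node b l r)) →
        StoresTree σ t (σ₁.natVar 4) →
        t.height ≤ max l.height r.height →
        SameInput σ σ₁ → (∀ x, x ≠ 0 → x ≠ 1 → σ₁.realVar x = σ.realVar x) →
        Improves I σ σ₁ → Covers σ₁ w →
        Runs descend σ₁ (max l.height r.height * 200 + 10) fun σ' => Improves I σ σ' ∧
          ∀ x, (∃ b' ∈ inorder (.node b l r), x ∈ b'.carrier γ f) →
            ∃ w ∈ γ, f w ∈ Set.uIcc (f c) (f x) ∧ Covers σ' w := by
      intro t σ₁ w ih hw hwγ hsub hst hh hsame hreal himp hcov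
      refine (ih σ₁ (hsame.storesTree hst) (hS.sublist hsub) himp.sound ?_ ?_ ?_ ?_ ?_).mono
        (by omega) ?_
      · rw [hreal 2 (by norm_num) (by norm_num), h2]
      · rw [hreal 3 (by norm_num) (by norm_num), h3]
      · rw [hreal 11 (by norm_num) (by norm_num), h11]
      · rw [hreal 12 (by norm_num) (by norm_num), h12]
      · rw [hreal 13 (by norm_num) (by norm_num), h13]
      rintro σ' - ⟨him', hcv⟩
      refine ⟨himp.trans him', fun x hx => ?_⟩
      rcases hw x hx with h | h
      · exact hcv x h
      · exact ⟨w, hwγ, h, him'.covers w hcov⟩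
    have step : ∀ (ex ey : RExp) (en : NExp) (w : Plane), w ∈ I.Q → ex.eval σ = w 0 →
        ey.eval σ = w 1 → ey.eval (σ.setReal 0 (w 0)) = w 1 → ex.cost ≤ 5 → ey.cost ≤ 5 →
        en.cost ≤ 5 → (∀ σ' : State, σ'.natVar 4 = σ.natVar 4 → SameInput σ σ' →
          en.eval σ' = en.eval σ) →
        Runs (.seq (tryPoint ex ey) (.setNat 4 en)) σ 110 fun σ₁ =>
          SameInput σ σ₁ ∧ (∀ x, x ≠ 0 → x ≠ 1 → σ₁.realVar x = σ.realVar x) ∧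
          Improves I σ σ₁ ∧ Covers σ₁ w ∧ σ₁.natVar 4 = en.eval σ := by
      intro ex ey en w hwQ hx hy hy' cx cy cn hen
      refine Runs.seq (runs_tryPoint hs hwQ hx hy hy' cx cy) (T₂ := 6) ?_ (by norm_num)
      rintro τ hf ⟨him, hcov⟩
      have hsame : SameInput σ τ := hf.sameInput (by
        refine ⟨by simp [tryPoint, Program.natVars], by simp [tryPoint, Program.natArrs], rfl⟩)
      have h4 : τ.natVar 4 = σ.natVar 4 := hf.natVar 4 (by simp [tryPoint, Program.natVars])
      refine Runs.setNat (by omega) ⟨?_, ?_, ?_, hcov, ?_⟩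
      · exact ⟨by simpa [State.setNat] using hsame.size, hsame.natArr, hsame.realArr⟩
      · intro x hx0 hx1
        exact hf.realVar x (by simp [tryPoint, Program.realVars, hx0, hx1])
      · exact him.trans ((Exec.setNat τ 4 en).frame.improves him.sound
          (by simp [Program.natVars]) (by simp [Program.realVars]) (by simp [Program.realVars]))
      · simp [State.setNat, hen τ h4 hsame]
    have bar : ∀ {w x : Plane}, f c ≤ f w → f w ≤ f x → f w ∈ Set.uIcc (f c) (f x) :=
      fun h1 h2 => Set.mem_uIcc.2 (Or.inl ⟨h1, h2⟩)
    have bar' : ∀ {w x : Plane}, f x ≤ f w → f w ≤ f c → f w ∈ Set.uIcc (f c) (f x) :=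
      fun h1 h2 => Set.mem_uIcc.2 (Or.inr ⟨h1, h2⟩)
    -- the arcs in the left subtree precede the arc at the root
    have hleft : ∀ x, (∃ b' ∈ inorder l, x ∈ b'.carrier γ f) → ∃ p ∈ b.lo, f x ≤ f p := by
      rintro x ⟨b', hb', hx⟩
      obtain ⟨q, hq, p, hp, hqp⟩ := hcross b' hb' b (by simp)
      exact ⟨p, hp, (hx.2.2 q hq).trans hqp.le⟩
    have hright : ∀ x, (∃ b' ∈ inorder r, x ∈ b'.carrier γ f) → ∃ q ∈ b.hi, f q ≤ f x := by
      rintro x ⟨b', hb', hx⟩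
      obtain ⟨q, hq, p, hp, hqp⟩ := hbr b' hb'
      exact ⟨q, hq, hqp.le.trans (hx.2.1 p hp)⟩
    have hsplit : ∀ x, (∃ b' ∈ inorder (.node b l r), x ∈ b'.carrier γ f) →
        (∃ b' ∈ inorder l, x ∈ b'.carrier γ f) ∨ x ∈ b.carrier γ f ∨
          (∃ b' ∈ inorder r, x ∈ b'.carrier γ f) := by
      rintro x ⟨b', hb', hx⟩
      rcases mem_inorder_node.1 hb' with h | rfl | h
      · exact Or.inl ⟨b', h, hx⟩
      · exact Or.inr (Or.inl hx)
      · exact Or.inr (Or.inr ⟨b', h, hx⟩)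
    have visit : Runs (.ite (.and (.natLe (.const 1) (.at 4 4)) (BExp.lt (.var 13) (nodePos 4 5)))
        (.seq (tryPoint (.load 4 (.var 4)) (.load 5 (.var 4))) (.setNat 4 (.at 2 4))) <|
      .ite (.and (.natLe (.const 1) (.at 5 4)) (BExp.lt (nodePos 6 7) (.var 13)))
        (.seq (tryPoint (.load 6 (.var 4)) (.load 7 (.var 4))) (.setNat 4 (.at 3 4)))
        (.seq (tryPoint (.var 11) (.var 12)) (.setNat 4 (.const 0)))) σ 180
        fun σ₁ => Runs descend σ₁ (max l.height r.height * 200 + 10) fun σ' => Improves I σ σ' ∧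
          ∀ x, (∃ b' ∈ inorder (.node b l r), x ∈ b'.carrier γ f) →
            ∃ w ∈ γ, f w ∈ Set.uIcc (f c) (f x) ∧ Covers σ' w := by
      have evpos : ∀ x y (p : Plane), σ.realArr x (σ.natVar 4) = p 0 →
          σ.realArr y (σ.natVar 4) = p 1 → (nodePos x y).eval σ = f p := by
        intro x y p hx hy
        simp only [nodePos, RExp.eval, NExp.eval, h2, h3, hx, hy, hfv]
      refine Runs.ite (T₁ := 150) ?_ ?_ (by decide)
      · intro hcond
        simp only [BExp.eval, BExp.eval_lt, NExp.eval, NExp.at] at hcond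
        obtain ⟨hflag, hlt⟩ := hcond
        obtain ⟨p, hp, hpx, hpy⟩ := hlo.some hflag
        rw [evpos 4 5 p hpx hpy, RExp.eval, h13] at hlt
        have hpQ := hS.lo_mem b hb p hp
        refine (step (.load 4 (.var 4)) (.load 5 (.var 4)) (.at 2 4) p hpQ.2 hpx hpy hpy
          (by decide) (by decide) (by decide) ?_).mono (by norm_num) ?_
        · intro σ' h4 hsame
          simp only [NExp.at, NExp.eval, h4, hsame.natArr 2 (by norm_num)]
        rintro σ₁ - ⟨hsame, hreal, him, hcov, h4⟩
        refine child l σ₁ p ihl ?_ hpQ.1 hsl (h4 ▸ hl) (le_max_left _ _) hsame hreal him hcov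
        intro x hx
        rcases hsplit x hx with h | h | h
        · exact Or.inl h
        · exact Or.inr (bar hlt.le (h.2.1 p hp))
        · obtain ⟨q, hq, hqx⟩ := hright x h
          exact Or.inr (bar hlt.le ((hS.lo_le_hi b hb p hp q hq).trans hqx))
      intro hc1
      refine Runs.ite (T₁ := 120) ?_ ?_ (by decide)
      · intro hcond
        simp only [BExp.eval, BExp.eval_lt, NExp.eval, NExp.at] at hcond
        obtain ⟨hflag, hlt⟩ := hcond
        obtain ⟨q, hq, hqx, hqy⟩ := hhi.some hflag
        rw [evpos 6 7 q hqx hqy, RExp.eval, h13] at hlt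
        have hqQ := hS.hi_mem b hb q hq
        refine (step (.load 6 (.var 4)) (.load 7 (.var 4)) (.at 3 4) q hqQ.2 hqx hqy hqy
          (by decide) (by decide) (by decide) ?_).mono (by norm_num) ?_
        · intro σ' h4 hsame
          simp only [NExp.at, NExp.eval, h4, hsame.natArr 3 (by norm_num)]
        rintro σ₁ - ⟨hsame, hreal, him, hcov, h4⟩
        refine child r σ₁ q ihr ?_ hqQ.1 hsr (h4 ▸ hr) (le_max_right _ _) hsame hreal him hcov
        intro x hx
        rcases hsplit x hx with h | h | h
        · obtain ⟨p, hp, hxp⟩ := hleft x h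
          exact Or.inr (bar' (hxp.trans (hS.lo_le_hi b hb p hp q hq)) hlt.le)
        · exact Or.inr (bar' (h.2.2 q hq) hlt.le)
        · exact Or.inl h
      intro hc2
      simp only [BExp.eval, BExp.eval_lt, NExp.eval, NExp.at, not_and, not_lt] at hc1 hc2
      have hlo' : ∀ p ∈ b.lo, f p ≤ f c := by
        intro p hp
        rw [Option.mem_def] at hp
        rw [hp] at hlo
        have := hc1 hlo.1.ge
        rwa [evpos 4 5 p hlo.2.1 hlo.2.2, RExp.eval, h13] at this
      have hhi' : ∀ q ∈ b.hi, f c ≤ f q := by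
        intro q hq
        rw [Option.mem_def] at hq
        rw [hq] at hhi
        have := hc2 hhi.1.ge
        rwa [evpos 6 7 q hhi.2.1 hhi.2.2, RExp.eval, h13] at this
      have hcQ : c ∈ I.Q := hS.center_mem b hb ⟨hS.center_curve, hlo', hhi'⟩
      refine (step (.var 11) (.var 12) (.const 0) c hcQ h11 h12 ?_
        (by decide) (by decide) (by decide) ?_).mono (by norm_num) ?_
      · simpa [RExp.eval, State.setReal] using h12
      · intro σ' _ _
        rfl
      rintro σ₁ - ⟨hsame, hreal, him, hcov, h4⟩
      refine Runs.loopDone ?_ (le_trans (show _ ≤ 10 by decide) (by omega))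
        ⟨him, fun x hx => ⟨c, hS.center_curve, Set.left_mem_uIcc, hcov⟩⟩
      simp only [BExp.eval, NExp.eval, h4]
      omega
    refine Runs.loopStep hbc visit (fun _ _ h => h) ?_
    simp only [BExp.cost, NExp.cost, BinaryTree.height]
    omega

/-- Computes the boundary point in the position given by an expression. -/
def loadPoint (e : RExp) : Program :=
  .seq (.setReal 10 e) <|
  .seq (.ite (BExp.lt (.sqrt (.mul (.var 10) (.var 10))) (.div (.mul (.const 2) (.var 7)) (.var 6)))
    (.setReal 11 (.sub (.var 6) (.sqrt (.sub (.const 4) (.mul (.var 10) (.var 10))))))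
    (.setReal 11 (.div (.mul (.var 7) (.sqrt (.mul (.var 10) (.var 10)))) (.const 2)))) <|
  .seq (.setReal 12 (.sub (.div (.add (.mul (.var 11) (.var 3)) (.mul (.var 10) (.var 2)))
    (.var 6)) (.var 5))) <|
  .seq (.setReal 11 (.sub (.div (.sub (.mul (.var 11) (.var 2)) (.mul (.var 10) (.var 3)))
    (.var 6)) (.var 4))) <|
  .setReal 13 (.sub (.mul (.var 2) (.var 12)) (.mul (.var 3) (.var 11)))

theorem runs_loadPoint {n : ℕ} {I : Instance n} {A B : Fin n} {k : Fin 2} {σ : State} {e : RExp}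
    {y : ℝ} (hc : HasCoords I A B k σ) (he : e.eval σ = y) (hcost : e.cost ≤ 50) :
    Runs (loadPoint e) σ 150 fun σ' =>
      σ'.realVar 11 = frontPoint (I.axis A B k) (I.offset A B k) y 0 ∧
      σ'.realVar 12 = frontPoint (I.axis A B k) (I.offset A B k) y 1 ∧
      σ'.realVar 13 = I.pos A B k (frontPoint (I.axis A B k) (I.offset A B k) y) := by
  refine Runs.seq (T₁ := 51) (Mid := fun τ => τ.realVar 10 = y) (T₂ := 99)
    (Runs.setReal (by omega) (by simp [State.setReal, he])) ?_ le_rfl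
  intro τ hf h10
  have hc := hc.frame hf (by simp [Program.realVars])
  refine Runs.seq (T₁ := 40) (Mid := fun τ => τ.realVar 11 = front ‖I.axis A B k‖ y) (T₂ := 50)
    ?_ ?_ (by norm_num)
  · refine Runs.ite (T₁ := 20) ?_ ?_ (by decide)
    · intro h
      simp only [BExp.eval_lt, RExp.eval, h10, hc.radius, hc.slope, Real.sqrt_mul_self_eq_abs,
        Nat.cast_ofNat] at h
      refine Runs.setReal (by decide) ?_
      simp only [State.setReal, RExp.eval, h10, hc.radius, Function.update_self, Nat.cast_ofNat]
      rw [front, if_pos h, sq y]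
    · intro h
      simp only [BExp.eval_lt, RExp.eval, h10, hc.radius, hc.slope, Real.sqrt_mul_self_eq_abs,
        Nat.cast_ofNat] at h
      refine Runs.setReal (by decide) ?_
      simp only [State.setReal, RExp.eval, h10, hc.slope, front, if_neg h, Function.update_self,
        Real.sqrt_mul_self_eq_abs, Nat.cast_ofNat]
  intro τ₁ hf₁ h11
  have hc₁ := hc.frame hf₁ (by decide)
  have h10' : τ₁.realVar 10 = y := by rw [hf₁.realVar 10 (by decide), h10]
  refine Runs.flat rfl (by decide) ?_
  simp [Program.run, State.setReal, RExp.eval, h10', h11, hc₁.radius, hc₁.axis0, hc₁.axis1,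
    hc₁.offset0, hc₁.offset1, frontPoint, pointAt, Instance.pos]

/-- Searches the boundary curve with the root `e` for the position given by an expression. -/
def query (root : NExp) (e : RExp) : Program :=
  .seq (loadPoint e) <| .seq (.setNat 4 root) descend

theorem runs_query {n : ℕ} {I : Instance n} {A B : Fin n} {k : Fin 2} (hAB : A ≠ B) {σ : State}
    (hs : Sound I σ) (hc : HasCoords I A B k σ) {root : NExp} {e : RExp} {y : ℝ}
    (he : e.eval σ = y) (hcost : e.cost ≤ 50) (hrcost : root.cost ≤ 10) {t : BinaryTree Arc}
    (ht : IsDQ I A B k t) (hst : StoresTree σ t (root.eval σ))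
    (hroot : ∀ σ', Frame (loadPoint e) σ σ' → root.eval σ' = root.eval σ) :
    Runs (query root e) σ (t.height * 200 + 200) fun σ' => Improves I σ σ' ∧
      ∀ x ∈ I.curve A B k ∩ I.Q,
        (∀ w ∈ Set.uIcc y (across (I.axis A B k) (I.offset A B k) x),
          ‖frontPoint (I.axis A B k) (I.offset A B k) w‖ ≤ ‖x‖) → Covers σ' x := by
  refine Runs.seq (runs_loadPoint hc he hcost) (T₂ := t.height * 200 + 30) ?_ (by omega)
  rintro τ hf ⟨h11, h12, h13⟩
  have hcτ := hc.frame hf (by simp [Program.realVars, loadPoint])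
  have him := hf.improves hs (by simp [Program.natVars, loadPoint])
    (by simp [Program.realVars, loadPoint]) (by simp [Program.realVars, loadPoint])
  have hsame : SameInput σ τ := hf.sameInput ⟨by simp [Program.natVars, loadPoint],
    by simp [Program.natArrs, loadPoint], rfl⟩
  refine Runs.seq (T₁ := 11) (Mid := fun τ' => τ' = τ.setNat 4 (root.eval σ))
    (T₂ := t.height * 200 + 10) (Runs.setNat (by omega) (by rw [hroot τ hf])) ?_ (by omega)
  rintro τ' hf' rfl
  have hsame' : SameInput τ (τ.setNat 4 (root.eval σ)) := ⟨rfl, fun _ _ => rfl, rfl⟩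
  have him' := him.trans (hf'.improves him.sound (by simp [Program.natVars])
    (by simp [Program.realVars]) (by simp [Program.realVars]))
  have ha := I.two_le_norm_axis hAB k
  have hctr : frontPoint (I.axis A B k) (I.offset A B k) y ∈ I.curve A B k := by
    rw [I.curve_eq_frontier]; exact frontPoint_mem ha y
  refine (runs_descend (a := I.axis A B k)
    (c := frontPoint (I.axis A B k) (I.offset A B k) y) (γ := I.curve A B k) t _ ?_
    (ht.1.isSearchable hctr) him'.sound hcτ.axis0 hcτ.axis1 h11 h12 h13).mono le_rfl ?_
  · have := hsame'.storesTree (hsame.storesTree hst)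
    simpa [State.setNat] using this
  · rintro σ' - ⟨him'', hcv⟩
    refine ⟨him'.trans him'', fun x hx hw => ?_⟩
    have hx' : ∃ b ∈ inorder t, x ∈ b.carrier (I.curve A B k) (I.pos A B k) := by
      rw [← ht.1.2.2] at hx; exact hx
    obtain ⟨w, hwγ, hwpos, hcov⟩ := hcv x hx'
    refine ⟨hcov.1, hcov.2.trans ?_⟩
    rw [I.curve_eq_frontier] at hwγ
    rw [← frontPoint_across ha hwγ]
    apply hw
    have hpos := I.pos_eq hAB k
    simp only [Instance.pos] at hpos
    have ha0 : 0 < ‖I.axis A B k‖ := by linarith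
    rw [hpos, hpos, hpos, across_frontPoint ha, Set.mem_uIcc] at hwpos
    simp only [mul_le_mul_iff_right₀ ha0, sub_le_sub_iff_right] at hwpos
    exact Set.mem_uIcc.2 hwpos

/-! ### The whole program -/

/-- Expressions for the split points of a boundary curve. -/
def splitExps : List RExp :=
  let t : RExp := .div (.mul (.const 2) (.var 7)) (.var 6)
  let p : RExp := .mul (.mul (.const 2) (.var 7)) (.var 8)
  let q : RExp := .mul (.const 4) (.var 9)
  let m : RExp := .div (.mul (.const 2) (.var 9)) (.sqrt (.add
    (.mul (.sub (.var 6) (.var 8)) (.sub (.var 6) (.var 8))) (.mul (.var 9) (.var 9))))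
  [t, .sub (.const 0) t, .div (.add p q) (.mul (.var 6) (.var 6)),
    .div (.sub q p) (.mul (.var 6) (.var 6)), m, .sub (.const 0) m]

/-- The root of the search tree of the vippodrome `k` of the current pair. -/
def rootOf (k : Fin 2) : NExp := .load 1 (.add (.var 3) (.const k))

/-- Searches the boundary curve `k` for all positions in the list. -/
def queryAll (k : Fin 2) : List RExp → Program
  | [] => .skip
  | e :: es => .seq (query (rootOf k) e) (queryAll k es)

/-- Searches the boundary curve of the vippodrome `k` of the current pair. -/
def searchCurve (k : Fin 2) : Program := .seq (setup k) (queryAll k splitExps)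

/-- Searches both boundary curves of the current pair. -/
def searchPair : Program :=
  .seq (.ite neq (.seq (searchCurve 0) (searchCurve 1)) .skip)
    (.setNat 3 (.add (.var 3) (.const 2)))

/-- Searches all boundary curves. -/
def searchAll : Program :=
  .seq (.setNat 3 (.const 0)) <| Program.forLoop 1 <| Program.forLoop 2 searchPair

/-- Starts the search with the origin, if it is a valid translation. -/
def tryOrigin : Program :=
  .seq removeAll <| .seq (.setReal 0 (.const 0)) <| .seq (.setReal 1 (.const 0)) <|
    .ite (.natLe (.var 0) (.var 6)) (.setNat 5 (.const 1)) (.setNat 5 (.const 0))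

/-- The program that finds a shortest valid translation. -/
def shortestTranslation : Program :=
  .seq tryOrigin <| .seq searchAll <| .setNat 0 (.var 5)

theorem exists_splitExp {n : ℕ} {I : Instance n} {A B : Fin n} {k : Fin 2} {y : ℝ}
    (hy : y ∈ splitPoints ‖I.axis A B k‖ (along (I.axis A B k) (I.offset A B k) 0)
      (across (I.axis A B k) (I.offset A B k) 0)) :
    ∃ e ∈ splitExps, ∀ σ, HasCoords I A B k σ → e.eval σ = y := by
  simp only [splitPoints, Finset.mem_insert, Finset.mem_singleton] at hy
  simp only [splitExps, List.mem_cons, List.not_mem_nil, or_false, exists_eq_or_imp,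
    exists_eq_left]
  rcases hy with rfl | rfl | rfl | rfl | rfl | rfl
  · left
    intro σ hc; simp [RExp.eval, hc.radius, hc.slope]
  · right; left
    intro σ hc; simp [RExp.eval, hc.radius, hc.slope]
  · right; right; left
    intro σ hc; simp [RExp.eval, hc.radius, hc.slope, hc.along, hc.across, sq]
  · right; right; right; left
    intro σ hc; simp [RExp.eval, hc.radius, hc.slope, hc.along, hc.across, sq]
  · right; right; right; right; left
    intro σ hc; simp [RExp.eval, hc.radius, hc.along, hc.across, sq]
  · right; right; right; right; right
    intro σ hc; simp [RExp.eval, hc.radius, hc.along, hc.across, sq]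

/-- The values `y` are described by their expressions in any state that holds the coordinates, since
the searches in between change other variables. -/
theorem runs_queryAll {n : ℕ} {I : Instance n} {A B : Fin n} {k : Fin 2} (hAB : A ≠ B)
    {t : BinaryTree Arc} (ht : IsDQ I A B k t) (es : List RExp) (hcost : ∀ e ∈ es, e.cost ≤ 50) :
    ∀ σ : State, Sound I σ → HasCoords I A B k σ →
      StoresTree σ t (σ.natArr 1 (σ.natVar 3 + k)) →
    Runs (queryAll k es) σ (es.length * (t.height * 200 + 200) + 1) fun σ' => Improves I σ σ' ∧
      ∀ y, (∃ e ∈ es, ∀ τ, HasCoords I A B k τ → e.eval τ = y) → ∀ x ∈ I.curve A B k ∩ I.Q,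
        (∀ w ∈ Set.uIcc y (across (I.axis A B k) (I.offset A B k) x),
          ‖frontPoint (I.axis A B k) (I.offset A B k) w‖ ≤ ‖x‖) → Covers σ' x := by
  induction es with
  | nil =>
    intro σ hs _ _
    exact (Runs.skip ⟨⟨hs, fun _ h => h⟩, by simp⟩).mono (by simp) fun _ _ h => h
  | cons e es ih =>
    intro σ hs hc hst
    refine Runs.seq (runs_query hAB hs hc (root := rootOf k) (y := e.eval σ) rfl
      (hcost e (by simp)) (by simp [rootOf, NExp.cost]) ht hst ?_)
      (T₂ := es.length * (t.height * 200 + 200) + 1) ?_ ?_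
    · intro σ' hf
      simp [rootOf, NExp.eval, hf.natVar 3 (by simp [loadPoint, Program.natVars]),
        hf.natArr 1 (by simp [loadPoint, Program.natArrs])]
    · rintro τ hf ⟨him, hcov⟩
      have hvars : ∀ x ∈ (query (rootOf k) e).natVars, x = 4 ∨ x = 5 := by
        have : (query (rootOf k) e).natVars = (query (.const 0) (.const 0)).natVars := rfl
        rw [this]; decide
      have hreals : ∀ x ∈ (query (rootOf k) e).realVars, x ∉ Finset.Icc 2 9 := by
        have : (query (rootOf k) e).realVars = (query (.const 0) (.const 0)).realVars := rfl
        rw [this]; decide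
      have hsame : SameInput σ τ := hf.sameInput ⟨fun h => by have := hvars 0 h; omega,
        fun a _ => by
          have : (query (rootOf k) e).natArrs = [] := rfl
          simp [this], rfl⟩
      have h3 : τ.natVar 3 = σ.natVar 3 := hf.natVar 3 fun h => by have := hvars 3 h; omega
      refine (ih (fun e' he' => hcost e' (by simp [he'])) τ him.sound (hc.frame hf hreals) ?_).mono
        le_rfl ?_
      · rw [h3, hsame.natArr 1 (by norm_num)]
        exact hsame.storesTree hst
      rintro σ' - ⟨him', hcov'⟩
      refine ⟨him.trans him', ?_⟩
      rintro y ⟨e', he', hey⟩ x hx hw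
      rcases List.mem_cons.1 he' with rfl | he'
      · refine him'.covers x (hcov x hx ?_)
        rwa [hey σ hc]
      · exact hcov' y ⟨e', he', hey⟩ x hx hw
    · rw [List.length_cons, Nat.succ_mul]; omega

/-- A bound for the height of the search trees: logarithmic in `n`. -/
noncomputable def heightBound (n : ℕ) : ℕ := ⌊2 * Real.logb 2 (64 * n ^ 2 + 2)⌋₊

theorem length_inorder {α : Type} (t : BinaryTree α) : (inorder t).length = t.numNodes := by
  induction t with
  | nil => rfl
  | node a l r ihl ihr => simp [inorder, ihl, ihr]; omega

theorem IsDQ.height_le {n : ℕ} {I : Instance n} {A B : Fin n} (hAB : A ≠ B) {k : Fin 2}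
    {t : BinaryTree Arc} (ht : IsDQ I A B k t) : t.height ≤ heightBound n := by
  have h1 := I.length_arcList_le hAB k ht.1
  rw [length_inorder] at h1
  refine Nat.le_floor (ht.2.trans ?_)
  have h2 : (t.numNodes : ℝ) ≤ 64 * n ^ 2 + 1 := by exact_mod_cast h1
  have := Real.logb_le_logb_of_le (b := 2) (by norm_num) (x := (t.numNodes : ℝ) + 1)
    (y := 64 * n ^ 2 + 2) (by positivity) (by linarith)
  linarith

theorem runs_searchCurve {n : ℕ} {I : Instance n} {A B : Fin n} (hAB : A ≠ B) {σ : State}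
    (hI : HoldsInput I σ) (hs : Sound I σ) (hA : σ.natVar 1 = A) (hB : σ.natVar 2 = B)
    (h3 : σ.natVar 3 = 2 * (n * A + B)) (k : Fin 2) :
    Runs (searchCurve k) σ (heightBound n * 1200 + 1400) fun σ' => Improves I σ σ' ∧
      ∀ x ∈ I.curve A B k ∩ I.Q, Covers σ' x := by
  obtain ⟨t, ht, hst⟩ := hI.2.2 A B k hAB
  refine Runs.seq (runs_setup hI hA hB k) (T₂ := heightBound n * 1200 + 1300) ?_ (by omega)
  intro τ hf hc
  have hfr : (setup k).KeepsInput ∧ 5 ∉ (setup k).natVars ∧ 3 ∉ (setup k).natVars ∧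
      0 ∉ (setup k).realVars ∧ 1 ∉ (setup k).realVars := by
    fin_cases k <;> decide
  have hsame := hf.sameInput hfr.1
  have him := hf.improves hs hfr.2.1 hfr.2.2.2.1 hfr.2.2.2.2
  have hh := ht.height_le hAB
  refine (runs_queryAll hAB ht splitExps (by decide) τ him.sound hc ?_).mono ?_ ?_
  · rw [hf.natVar 3 hfr.2.2.1, hsame.natArr 1 (by norm_num), h3]
    exact hsame.storesTree hst
  · have : splitExps.length = 6 := rfl
    rw [this]; omega
  rintro σ' - ⟨him', hcov⟩
  refine ⟨him.trans him', fun x hx => ?_⟩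
  have ha := I.two_le_norm_axis hAB k
  have hxc := hx.1
  rw [I.curve_eq_frontier] at hxc
  obtain ⟨z, hz, hw⟩ := exists_splitPoint_descent ha
    (along (I.axis A B k) (I.offset A B k) 0) (across (I.axis A B k) (I.offset A B k) 0)
    (across (I.axis A B k) (I.offset A B k) x)
  refine hcov z (exists_splitExp hz) x hx fun w hwz => ?_
  have := hw w hwz
  rw [← norm_sq_frontPoint ha, ← norm_sq_frontPoint ha, frontPoint_across ha hxc] at this
  exact le_of_sq_le_sq this (norm_nonneg x)

theorem runs_searchPair {n : ℕ} {I : Instance n} {A B : Fin n} {σ : State}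
    (hI : HoldsInput I σ) (hs : Sound I σ) (hA : σ.natVar 1 = A) (hB : σ.natVar 2 = B)
    (h3 : σ.natVar 3 = 2 * (n * A + B)) :
    Runs searchPair σ (heightBound n * 2400 + 3000) fun σ' => Improves I σ σ' ∧
      σ'.natVar 3 = 2 * (n * A + B) + 2 ∧
      ∀ k, A ≠ B → ∀ x ∈ I.curve A B k ∩ I.Q, Covers σ' x := by
  refine Runs.seq (T₁ := heightBound n * 2400 + 2900) (Mid := fun τ => Improves I σ τ ∧
    τ.natVar 3 = 2 * (n * A + B) ∧ ∀ k, A ≠ B → ∀ x ∈ I.curve A B k ∩ I.Q, Covers τ x)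
    (T₂ := 10) ?_ ?_ (by omega)
  · refine Runs.ite (T₁ := heightBound n * 2400 + 2800) ?_ ?_ ?_
    · rw [eval_neq, hA, hB]
      intro hne
      have hAB : A ≠ B := fun h => hne (by rw [h])
      refine Runs.seq (runs_searchCurve hAB hI hs hA hB h3 0)
        (T₂ := heightBound n * 1200 + 1400) ?_ (by omega)
      rintro τ hf ⟨him, hcov⟩
      have e3 : τ.natVar 3 = 2 * (n * A + B) := by rw [hf.natVar 3 (by decide), h3]
      refine (runs_searchCurve (A := A) (B := B) hAB (hI.frame hf (by decide)) him.sound ?_ ?_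
        e3 1).mono le_rfl ?_
      · rw [hf.natVar 1 (by decide), hA]
      · rw [hf.natVar 2 (by decide), hB]
      rintro τ' hf' ⟨him', hcov'⟩
      refine ⟨him.trans him', by rw [hf'.natVar 3 (by decide), e3], fun k _ x hx => ?_⟩
      revert hx
      match k with
      | 0 => exact fun hx => him'.covers x (hcov x hx)
      | 1 => exact fun hx => hcov' x hx
    · rw [eval_neq, hA, hB]
      intro hne
      refine (Runs.skip ⟨⟨hs, fun _ h => h⟩, h3, fun k hAB => ?_⟩).mono (by omega) fun _ _ h => h
      exact absurd (Fin.ext (not_not.1 hne)) hAB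
    · have : neq.cost = 8 := by decide
      omega
  · rintro τ - ⟨him, h3, hcov⟩
    refine Runs.setNat (by decide) ⟨?_, by simp [State.setNat, NExp.eval, h3], ?_⟩
    · exact him.trans ((Exec.setNat τ 3 _).frame.improves him.sound (by simp [Program.natVars])
        (by simp [Program.realVars]) (by simp [Program.realVars]))
    · intro k hAB x hx
      exact ((Exec.setNat τ 3 _).frame.improves him.sound (by simp [Program.natVars])
        (by simp [Program.realVars]) (by simp [Program.realVars])).covers x (hcov k hAB x hx)

theorem Improves.setNat {n : ℕ} {I : Instance n} {σ : State} (hs : Sound I σ) {x : ℕ}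
    (hx : x ≠ 5) (v : ℕ) : Improves I σ (σ.setNat x v) :=
  (Exec.setNat σ x (.const v)).frame.improves hs (by simpa [Program.natVars] using hx.symm)
    (by simp [Program.realVars]) (by simp [Program.realVars])

/-- The table of roots is read consecutively, because indices cannot be multiplied: at the pair
`(A, B)` the running index is `2 * (n * A + B)`. -/
theorem runs_searchAll {n : ℕ} {I : Instance n} {σ : State} (hI : HoldsInput I σ)
    (hs : Sound I σ) :
    Runs searchAll σ (n * (n * (heightBound n * 2400 + 3100) + 100) + 50) fun σ' =>
      Improves I σ σ' ∧
      ∀ A B k, A ≠ B → ∀ x ∈ I.curve A B k ∩ I.Q, Covers σ' x := by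
  refine Runs.seq (T₁ := 2) (Mid := fun τ => τ.natVar 3 = 0)
    (T₂ := n * (n * (heightBound n * 2400 + 3100) + 100) + 40)
    (Runs.setNat (by decide) (by simp [State.setNat, NExp.eval])) ?_ (by omega)
  intro τ hf h3
  have hI₁ := hI.frame hf (by decide)
  have him₁ := hf.improves hs (by decide) (by decide) (by decide)
  refine Runs.forLoop (T := n * (heightBound n * 2400 + 3100) + 20) (n := n) (fun k υ =>
      HoldsInput I υ ∧ Improves I σ υ ∧ υ.natVar 3 = 2 * (n * k) ∧
      ∀ (A B : Fin n) (κ : Fin 2), A < k → A ≠ B → ∀ x ∈ I.curve A B κ ∩ I.Q, Covers υ x)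
    (by norm_num) hI₁.1 (by decide) (by decide) ?_ ?_ ?_ ?_
  · exact ⟨hI₁.setNat (by norm_num) _, him₁.trans (.setNat him₁.sound (by norm_num) _),
      by simpa [State.setNat] using h3, by simp⟩
  · rintro k hk υ u1 u0 ⟨uI, uim, u3, ucov⟩
    refine Runs.forLoop (T := heightBound n * 2400 + 3000) (n := n) (fun m ω =>
        HoldsInput I ω ∧ Improves I σ ω ∧ ω.natVar 1 = k ∧ ω.natVar 3 = 2 * (n * k + m) ∧
        ∀ (A B : Fin n) (κ : Fin 2), (A < k ∨ (A.val = k ∧ B < m)) → A ≠ B →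
          ∀ x ∈ I.curve A B κ ∩ I.Q, Covers ω x)
      (by norm_num) uI.1 (by decide) (by decide) ?_ ?_ ?_ ?_
    · have i := Improves.setNat (I := I) uim.sound (show 2 ≠ 5 by norm_num) 0
      refine ⟨uI.setNat (by norm_num) _, uim.trans i, by simpa [State.setNat] using u1,
        by simpa [State.setNat] using u3, ?_⟩
      rintro A B κ h hAB x hx
      exact i.covers x (ucov A B κ (by simpa using h) hAB x hx)
    · rintro m hm ω w2 w0 ⟨wI, wim, w1, w3, wcov⟩
      refine (runs_searchPair (A := ⟨k, hk⟩) (B := ⟨m, hm⟩) wI wim.sound w1 w2 w3).mono le_rfl ?_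
      rintro ω' hf' ⟨him, h3', hcov⟩
      have i := Improves.setNat (I := I) him.sound (show 2 ≠ 5 by norm_num) (m + 1)
      refine ⟨(wI.frame hf' (by decide)).setNat (by norm_num) _, (wim.trans him).trans i, ?_, ?_, ?_⟩
      · simp [State.setNat, hf'.natVar 1 (by decide), w1]
      · simp [State.setNat, h3']; ring
      · rintro A B κ h hAB x hx
        refine i.covers x ?_
        by_cases hnew : A = ⟨k, hk⟩ ∧ B = ⟨m, hm⟩
        · obtain ⟨rfl, rfl⟩ := hnew
          exact hcov κ hAB x hx
        · refine him.covers x (wcov A B κ ?_ hAB x hx)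
          simp only [Fin.ext_iff] at hnew
          omega
    · rintro ω ⟨wI, wim, w1, w3, wcov⟩
      have i := Improves.setNat (I := I) wim.sound (show 1 ≠ 5 by norm_num) (k + 1)
      refine ⟨wI.setNat (by norm_num) _, wim.trans i, ?_, ?_⟩
      · simp [State.setNat, w3]; ring
      · rintro A B κ h hAB x hx
        refine i.covers x (wcov A B κ ?_ hAB x hx)
        have := B.2
        omega
    · exact Nat.add_le_add (Nat.mul_le_mul_left n (by omega)) (by norm_num)
  · rintro υ ⟨-, uim, -, ucov⟩
    exact ⟨uim, fun A B κ hAB x hx => ucov A B κ A.2 hAB x hx⟩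
  · exact Nat.add_le_add (Nat.mul_le_mul_left n (by omega)) (by norm_num)

theorem runs_tryOrigin {n : ℕ} {I : Instance n} {σ : State} (hI : HoldsInput I σ) :
    Runs tryOrigin σ (n * (n * 1000 + 1000) + 70) fun σ' =>
      Sound I σ' ∧ (0 ∈ I.Q → Covers σ' 0) := by
  refine Runs.seq (runs_removeAll hI) (T₂ := 20) ?_ (by omega)
  rintro τ hf ⟨hle, hiff⟩
  have h0 : τ.natVar 0 = n := (hI.frame hf (by decide)).1
  refine Runs.seq (T₁ := 2) (Mid := fun τ' => τ'.realVar 0 = 0) (T₂ := 18)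
    (Runs.setReal (by decide) (by simp [State.setReal, RExp.eval])) ?_ le_rfl
  intro τ₁ hf₁ r0
  refine Runs.seq (T₁ := 2) (Mid := fun τ' => τ'.realVar 1 = 0) (T₂ := 16)
    (Runs.setReal (by decide) (by simp [State.setReal, RExp.eval])) ?_ le_rfl
  intro τ₂ hf₂ r1
  have hbest : ∀ v, best (τ₂.setNat 5 v) = 0 := by
    intro v
    have r0' : τ₂.realVar 0 = 0 := by rw [hf₂.realVar 0 (by decide), r0]
    ext i
    fin_cases i <;> simp [best, State.setNat, r0', r1]
  have e0 : τ₂.natVar 0 = n := by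
    rw [hf₂.natVar 0 (by decide), hf₁.natVar 0 (by decide), h0]
  have e6 : τ₂.natVar 6 = τ.natVar 6 := by
    rw [hf₂.natVar 6 (by decide), hf₁.natVar 6 (by decide)]
  refine Runs.ite (T₁ := 4) ?_ ?_ (by decide)
  · intro h
    simp only [BExp.eval, NExp.eval, e0, e6] at h
    have hQ := hiff.1 (le_antisymm hle h)
    refine Runs.setNat (by decide) ⟨Or.inr ⟨?_, ?_⟩, fun _ => ⟨?_, ?_⟩⟩
    · simp [State.setNat, NExp.eval]
    · rwa [hbest]
    · simp [State.setNat, NExp.eval]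
    · rw [hbest]
  · intro h
    simp only [BExp.eval, NExp.eval, e0, e6] at h
    refine Runs.setNat (by decide) ⟨Or.inl ?_, fun hQ => ?_⟩
    · simp [State.setNat, NExp.eval]
    · exact absurd (hiff.2 hQ).ge h

/-- A search that has tried the origin and all boundary curves has found a shortest valid
translation. -/
theorem holdsOutput_of_covers {n : ℕ} {I : Instance n} {σ σ' : State} (hs : Sound I σ)
    (h0 : 0 ∈ I.Q → Covers σ 0)
    (hc : ∀ A B k, A ≠ B → ∀ x ∈ I.curve A B k ∩ I.Q, Covers σ x)
    (hflag : σ'.natVar 0 = σ.natVar 5) (hreal : σ'.realVar = σ.realVar) : HoldsOutput I σ' := by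
  have hopt : ∀ v, I.IsShortest v → Covers σ v := by
    intro v hv
    rcases hv.eq_zero_or_mem_curve with rfl | ⟨A, B, k, hAB, h⟩
    · exact h0 hv.1
    · exact hc A B k hAB v ⟨h, hv.1⟩
  rcases hs with h5 | ⟨h5, hQ⟩
  · right
    refine ⟨by rw [hflag, h5], ?_⟩
    by_contra hne
    obtain ⟨v, hv⟩ := I.exists_isShortest (Set.nonempty_iff_ne_empty.2 hne)
    have := (hopt v hv).1
    omega
  · left
    refine ⟨by rw [hflag, h5], ?_⟩
    rw [hreal]
    refine ⟨hQ, fun w hw => ?_⟩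
    obtain ⟨v, hv⟩ := I.exists_isShortest ⟨w, hw⟩
    exact (hopt v hv).2.trans (hv.2 w hw)

theorem runs_shortestTranslation {n : ℕ} {I : Instance n} {σ : State} (hI : HoldsInput I σ) :
    Runs shortestTranslation σ (10000 * (n ^ 2 * (heightBound n + 1) + 1)) (HoldsOutput I) := by
  refine Runs.seq (runs_tryOrigin hI)
    (T₂ := n * (n * (heightBound n * 2400 + 3100) + 100) + 60) ?_ ?_
  · rintro τ hf ⟨hs, h0⟩
    refine Runs.seq (runs_searchAll (hI.frame hf (by decide)) hs) (T₂ := 2) ?_ (by omega)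
    rintro τ' - ⟨him, hcov⟩
    refine Runs.setNat (by decide) ?_
    refine holdsOutput_of_covers him.sound (fun h => him.covers 0 (h0 h)) hcov ?_ rfl
    simp [State.setNat, NExp.eval]
  · have : n ≤ n ^ 2 := Nat.le_self_pow two_ne_zero n
    nlinarith [Nat.zero_le (n ^ 2 * heightBound n)]

theorem exists_time_bound : ∃ C : ℝ, ∀ n : ℕ,
    ((10000 * (n ^ 2 * (heightBound n + 1) + 1) : ℕ) : ℝ) ≤
      C * ((n : ℝ) ^ 2 * Real.log n + 1) := by
  have hlog2 : 0 < Real.log 2 := Real.log_pos (by norm_num)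
  refine ⟨10000 * (19 / Real.log 2 + heightBound 1 + 2), fun n => ?_⟩
  have hc : 0 ≤ 19 / Real.log 2 := by positivity
  have hb1 : (0 : ℝ) ≤ heightBound 1 := Nat.cast_nonneg _
  push_cast
  rcases Nat.lt_or_ge n 2 with hn | hn
  · interval_cases n
    · simp only [Nat.cast_zero, Real.log_zero]
      nlinarith
    · simp only [Nat.cast_one, Real.log_one]
      nlinarith
  · have hn' : (2 : ℝ) ≤ n := by exact_mod_cast hn
    have hlog : Real.log 2 ≤ Real.log n := Real.log_le_log (by norm_num) hn'
    have hh : (heightBound n : ℝ) + 1 ≤ 19 / Real.log 2 * Real.log n := by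
      have h1 : (heightBound n : ℝ) ≤ 2 * Real.logb 2 (64 * n ^ 2 + 2) :=
        Nat.floor_le (mul_nonneg (by norm_num) (Real.logb_nonneg (by norm_num) (by nlinarith)))
      have h2 : Real.logb 2 (64 * n ^ 2 + 2) ≤ Real.logb 2 ((n : ℝ) ^ 9) := by
        refine Real.logb_le_logb_of_le (by norm_num) (by positivity) ?_
        have h7 : (2 : ℝ) ^ 7 ≤ n ^ 7 := pow_le_pow_left₀ (by norm_num) hn' 7
        calc 64 * (n : ℝ) ^ 2 + 2 ≤ 2 ^ 7 * (n : ℝ) ^ 2 := by nlinarith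
          _ ≤ (n : ℝ) ^ 7 * (n : ℝ) ^ 2 := by gcongr
          _ = (n : ℝ) ^ 9 := by ring
      have h3 : Real.logb 2 ((n : ℝ) ^ 9) = 9 * (Real.log n / Real.log 2) := by
        rw [Real.logb_pow, Real.logb]; norm_num
      have h4 : 1 ≤ Real.log n / Real.log 2 := (one_le_div hlog2).2 hlog
      have h5 : 19 / Real.log 2 * Real.log n = 19 * (Real.log n / Real.log 2) := by ring
      linarith
    have hlog0 : 0 ≤ Real.log n := hlog2.le.trans hlog
    have hn2 : (0 : ℝ) ≤ (n : ℝ) ^ 2 := by positivity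
    have h6 := mul_le_mul_of_nonneg_left hh hn2
    have h7 : 0 ≤ (n : ℝ) ^ 2 * Real.log n := by positivity
    nlinarith [mul_nonneg (add_nonneg hb1 (zero_le_two (α := ℝ))) h7]

end DiscReconfig

theorem mainTheorem2 :
    -- one program solves every instance, given the structures `D_Q`, in time `O(n ^ 2 log n)`
    (∃ (P : DiscReconfig.Program) (C : ℝ),
      ∀ (n : ℕ) (I : DiscReconfig.Instance n) (σ : DiscReconfig.State),
        DiscReconfig.HoldsInput I σ →
        ∃ (t : ℕ) (σ' : DiscReconfig.State),
          DiscReconfig.Exec P σ t σ' ∧ DiscReconfig.HoldsOutput I σ' ∧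
          (t : ℝ) ≤ C * ((n : ℝ) ^ 2 * Real.log n + 1)) ∧
    -- an optimum is the origin or lies on the boundary of a vippodrome
    (∀ (n : ℕ) (I : DiscReconfig.Instance n) (v : DiscReconfig.Plane),
      I.IsShortest v → v = 0 ∨ ∃ (A B : Fin n) (k : Fin 2), A ≠ B ∧ v ∈ I.curve A B k) ∧
    -- each boundary splits into `O(1)` subarcs along which the length is monotone
    (∃ K : ℕ, ∀ (n : ℕ) (I : DiscReconfig.Instance n) (A B : Fin n) (k : Fin 2), A ≠ B →
      ∃ F : Finset ℝ, F.card ≤ K ∧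
        ∀ J : Set ℝ, J.OrdConnected → Disjoint J (F : Set ℝ) →
          (∀ x ∈ I.curve A B k, ∀ y ∈ I.curve A B k, I.pos A B k x ∈ J → I.pos A B k y ∈ J →
            I.pos A B k x ≤ I.pos A B k y → ‖x‖ ≤ ‖y‖) ∨
          (∀ x ∈ I.curve A B k, ∀ y ∈ I.curve A B k, I.pos A B k x ∈ J → I.pos A B k y ∈ J →
            I.pos A B k x ≤ I.pos A B k y → ‖y‖ ≤ ‖x‖)) := by
  refine ⟨?_, fun n I v hv => hv.eq_zero_or_mem_curve,
    DiscReconfig.Instance.exists_monotone_split⟩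
  obtain ⟨C, hC⟩ := DiscReconfig.exists_time_bound
  refine ⟨DiscReconfig.shortestTranslation, C, fun n I σ hI => ?_⟩
  obtain ⟨t, σ', he, ht, hout⟩ := DiscReconfig.runs_shortestTranslation hI
  exact ⟨t, σ', he, hout, le_trans (by exact_mod_cast ht) (hC n)⟩
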